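/- All groups are abelian. A group $A$ is \emph{cancellable} if for all groups $G,H$ (of any size), $A\oplus G\cong A\oplus H$ implies $G\cong H$. A torsion-free group has rank 1 if it is isomorphic to a nonzero subgroup of $\mathbb{Q}$. Fix an oracle $X:\mathbb{N}\to\mathbb{N}$ (the unrelativized case is $X=0$) and a standard effective numbering $(\varphi^X_e)_{e\in\mathbb{N}}$ of the partial $X$-computable functions. The $e$-th $X$-computable group, where $e=\langle d,o\rangle$, is the group with domain $D=\{n:\varphi^X_d(n)=1\}\subseteq\mathbb{N}$ and addition $a+b=\varphi^X_o(\langle a,b\rangle)$ for $a,b\in D$; it is defined only if $\varphi^X_d$ is total with values in $\{0,1\}$ and the operation is defined on $D$ and makes $D$ an abelian group. Let \[ I^X_{C}=\{e : \text{the $e$-th $X$-computable group is defined, torsion-free of rank 1, and cancellable}\}. \] \textbf{Theorem.} For every $X$, the set $I^X_{C}$ is $\Pi^0_4$ $m$-complete relative to $X$. That is: (1) $I^X_C$ is $\Pi^0_4$ relative to $X$; (2) for every set $S\subseteq\mathbb{N}$ that is $\Pi^0_4$ relative to $X$ there is a computable function $f:\mathbb{N}\to\mathbb{N}$ such that for every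 $n$, $f(n)$ is an index of an $X$-computable torsion-free group of rank 1, and $n\in S$ if and only if $f(n)\in I^X_C$ (that is, if and only if that group is cancellable). -/

import Mathlib

universe u

/-! ### Partial functions computable from an oracle -/

/-- The finite initial segment `[X (k-1), …, X 1, X 0]` of the oracle `X`, latest value first. -/
def initSeg (X : ℕ → ℕ) : ℕ → List ℕ
  | 0 => []
  | k + 1 => X k :: initSeg X k

/-- The `e`-th partial function computable from the oracle `X`: on input `n`, run the `e`-th
program on `n` together with longer and longer initial segments of `X` and for longer and longer
times, until the first halting computation is found; its output is the value.
The lemma `exists_phi_eq_iff` says that this lists exactly the partial `X`-computable functions. -/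
def phi (X : ℕ → ℕ) (e : ℕ) : ℕ →. ℕ := fun n =>
  Nat.rfindOpt fun s =>
    Nat.Partrec.Code.evaln s.unpair.1 (Nat.Partrec.Code.ofNatCode e)
      (Nat.pair (Encodable.encode (initSeg X s.unpair.2)) n)

lemma initSeg_suffix (X : ℕ → ℕ) {k l : ℕ} (h : k ≤ l) : initSeg X k <:+ initSeg X l := by
  induction h with
  | refl => exact List.suffix_rfl
  | step _ ih => exact ih.trans (List.suffix_cons _ _)

lemma initSeg_lookup (X : ℕ → ℕ) (k n m : ℕ) :
    (initSeg X k).reverse[n]? = some m ↔ n < k ∧ m = X n := by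
  induction k with
  | zero => simp [initSeg]
  | succ k ih =>
    have hl : (initSeg X k).length = k := by
      clear ih; induction k with
      | zero => rfl
      | succ k ih => simp [initSeg, ih]
    simp only [initSeg, List.reverse_cons, List.getElem?_append, List.length_reverse, hl]
    split_ifs with h
    · rw [ih]; omega
    · rcases Nat.eq_or_lt_of_le (not_lt.1 h) with rfl | h'
      · simp [eq_comm]
      · have : n - k ≠ 0 := by omega
        obtain ⟨j, hj⟩ := Nat.exists_eq_succ_of_ne_zero this
        simp [hj]; omega

lemma mem_rfind_map (G : ℕ → Part ℕ) (n : ℕ) :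
    n ∈ Nat.rfind (fun j => (G j).map fun m => decide (m = 0)) ↔
      0 ∈ G n ∧ ∀ j < n, ∃ m ∈ G j, m ≠ 0 := by
  refine Nat.mem_rfind.trans (and_congr ?_ (forall_congr' fun j => imp_congr_right fun _ => ?_))
  · exact (Part.mem_map_iff _).trans (by simp)
  · exact (Part.mem_map_iff _).trans (by simp)

/-- Every function recursive in `X` is computed from finite initial segments of `X`. -/
lemma exists_finite_use (X : ℕ → ℕ) {f : ℕ →. ℕ} (hf : Nat.RecursiveIn {(X : ℕ →. ℕ)} f) :
    ∃ F : List ℕ → ℕ →. ℕ, Partrec₂ F ∧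
      (∀ l l' n m, l <:+ l' → m ∈ F l n → m ∈ F l' n) ∧
      ∀ n m, m ∈ f n ↔ ∃ k, m ∈ F (initSeg X k) n := by
  have plain : ∀ f : ℕ →. ℕ, Nat.Partrec f → ∃ F : List ℕ → ℕ →. ℕ, Partrec₂ F ∧
      (∀ l l' n m, l <:+ l' → m ∈ F l n → m ∈ F l' n) ∧
      ∀ n m, m ∈ f n ↔ ∃ k, m ∈ F (initSeg X k) n := fun f hf =>
    ⟨fun _ n => f n, (Partrec.nat_iff.2 hf).comp Computable.snd,
      fun _ _ _ _ _ h => h, fun _ _ => by simp⟩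
  induction hf with
  | zero => exact plain _ .zero
  | succ => exact plain _ .succ
  | left => exact plain _ .left
  | right => exact plain _ .right
  | oracle g hg =>
    rw [Set.mem_singleton_iff] at hg; subst hg
    refine ⟨fun l n => (l.reverse[n]? : Option ℕ), ?_, ?_, ?_⟩
    · exact Computable.ofOption (Primrec.list_getElem?.comp
        (Primrec.list_reverse.comp Primrec.fst) Primrec.snd).to_comp
    · rintro l _ n m ⟨t, rfl⟩ h
      simp only [Part.mem_ofOption, Option.mem_def, List.reverse_append] at h ⊢
      obtain ⟨hn, _⟩ := List.getElem?_eq_some_iff.1 h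
      rwa [List.getElem?_append_left hn]
    · intro n m
      simp only [Part.mem_ofOption, Option.mem_def, initSeg_lookup, PFun.coe_val, Part.mem_some_iff]
      exact ⟨fun h => ⟨n + 1, by omega, h⟩, fun ⟨_, _, h⟩ => h⟩
  | pair _ _ ihf ihh =>
    obtain ⟨F, hF, mF, eF⟩ := ihf
    obtain ⟨H, hH, mH, eH⟩ := ihh
    refine ⟨fun l n => (F l n).bind fun a => (H l n).map fun b => Nat.pair a b, ?_, ?_, ?_⟩
    · refine Partrec.bind hF (Partrec.map
        (hH.comp (Computable.fst.comp Computable.fst) (Computable.snd.comp Computable.fst)) ?_)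
      exact (Primrec₂.natPair.comp (Primrec.snd.comp Primrec.fst) Primrec.snd).to_comp
    · intro l l' n m hl
      simp only [Part.mem_bind_iff, Part.mem_map_iff]
      rintro ⟨a, ha, b, hb, rfl⟩
      exact ⟨a, mF _ _ _ _ hl ha, b, mH _ _ _ _ hl hb, rfl⟩
    · intro n m
      simp only [Seq.seq, Part.map_eq_map, Part.mem_bind_iff, Part.mem_map_iff, eF, eH]
      constructor
      · rintro ⟨_, ⟨a, ⟨k, ha⟩, rfl⟩, b, ⟨k', hb⟩, rfl⟩
        exact ⟨max k k', a, mF _ _ _ _ (initSeg_suffix X (le_max_left _ _)) ha, b,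
          mH _ _ _ _ (initSeg_suffix X (le_max_right _ _)) hb, rfl⟩
      · rintro ⟨k, a, ha, b, hb, rfl⟩
        exact ⟨_, ⟨a, ⟨k, ha⟩, rfl⟩, b, ⟨k, hb⟩, rfl⟩
  | comp _ _ ihf ihh =>
    obtain ⟨F, hF, mF, eF⟩ := ihf
    obtain ⟨H, hH, mH, eH⟩ := ihh
    refine ⟨fun l n => (H l n).bind fun a => F l a, ?_, ?_, ?_⟩
    · exact Partrec.bind hH (hF.comp (Computable.fst.comp Computable.fst) Computable.snd)
    · intro l l' n m hl
      simp only [Part.mem_bind_iff]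
      rintro ⟨a, ha, hb⟩
      exact ⟨a, mH _ _ _ _ hl ha, mF _ _ _ _ hl hb⟩
    · intro n m
      refine Part.mem_bind_iff.trans ?_
      simp only [Part.mem_bind_iff, eF, eH]
      constructor
      · rintro ⟨a, ⟨k, ha⟩, ⟨k', hb⟩⟩
        exact ⟨max k k', a, mH _ _ _ _ (initSeg_suffix X (le_max_left _ _)) ha,
          mF _ _ _ _ (initSeg_suffix X (le_max_right _ _)) hb⟩
      · rintro ⟨k, a, ha, hb⟩
        exact ⟨a, ⟨k, ha⟩, ⟨k, hb⟩⟩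
  | prec _ _ ihf ihh =>
    obtain ⟨F, hF, mF, eF⟩ := ihf
    obtain ⟨H, hH, mH, eH⟩ := ihh
    let R : List ℕ → ℕ → ℕ →. ℕ := fun l a n =>
      Nat.rec (F l a) (fun y IH => IH.bind fun i => H l (Nat.pair a (Nat.pair y i))) n
    have mR : ∀ l l' a n m, l <:+ l' → m ∈ R l a n → m ∈ R l' a n := by
      intro l l' a n m hl
      induction n generalizing m with
      | zero => exact mF _ _ _ _ hl
      | succ n ih =>
        simp only [R, Part.mem_bind_iff]
        rintro ⟨i, hi, hm⟩
        exact ⟨i, ih _ hi, mH _ _ _ _ hl hm⟩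
    refine ⟨fun l p => R l p.unpair.1 p.unpair.2, ?_, fun _ _ _ _ => mR _ _ _ _ _, ?_⟩
    · have h1 : Computable fun q : List ℕ × ℕ => q.2.unpair.1 :=
        (Primrec.fst.comp (Primrec.unpair.comp Primrec.snd)).to_comp
      have h2 : Computable fun q : List ℕ × ℕ => q.2.unpair.2 :=
        (Primrec.snd.comp (Primrec.unpair.comp Primrec.snd)).to_comp
      refine Partrec.nat_rec (h := fun (q : List ℕ × ℕ) (r : ℕ × ℕ) =>
        H q.1 (Nat.pair q.2.unpair.1 (Nat.pair r.1 r.2))) h2 (hF.comp Computable.fst h1) ?_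
      refine hH.comp (Computable.fst.comp Computable.fst) ?_
      exact Primrec₂.natPair.to_comp.comp (h1.comp Computable.fst)
        (Primrec₂.natPair.to_comp.comp (Computable.fst.comp Computable.snd)
          (Computable.snd.comp Computable.snd))
    · intro p m
      generalize ha : p.unpair.1 = a
      generalize hn : p.unpair.2 = n
      have hp : p.unpair = (a, n) := by rw [← ha, ← hn]
      simp only [hp]
      clear ha hn hp
      induction n generalizing m with
      | zero => exact eF a m
      | succ n ih =>
        simp only [Part.bind_eq_bind, Part.mem_bind_iff] at ih ⊢
        constructor
        · rintro ⟨i, hi, hm⟩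
          obtain ⟨k, hk⟩ := (ih i).1 hi
          obtain ⟨k', hk'⟩ := (eH _ _).1 hm
          refine ⟨max k k', Part.mem_bind_iff.2
            ⟨i, mR _ _ _ _ _ (initSeg_suffix X (le_max_left _ _)) hk,
              mH _ _ _ _ (initSeg_suffix X (le_max_right _ _)) hk'⟩⟩
        · rintro ⟨k, hk⟩
          obtain ⟨i, hi, hm⟩ := Part.mem_bind_iff.1 hk
          exact ⟨i, (ih i).2 ⟨k, hi⟩, (eH _ _).2 ⟨k, hm⟩⟩
  | @rfind f _ ih =>
    obtain ⟨F, hF, mF, eF⟩ := ih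
    refine ⟨fun l a => Nat.rfind fun n => (F l (Nat.pair a n)).map fun m => decide (m = 0),
      ?_, ?_, ?_⟩
    · refine Partrec.rfind (Partrec.map (hF.comp (Computable.fst.comp Computable.fst)
        (Primrec₂.natPair.to_comp.comp (Computable.snd.comp Computable.fst) Computable.snd)) ?_)
      exact (Primrec.eq.decide.comp Primrec.snd (Primrec.const 0)).to_comp
    · intro l l' a n hl hn
      obtain ⟨h, h'⟩ := (mem_rfind_map _ _).1 hn
      refine (mem_rfind_map _ _).2 ⟨mF _ _ _ _ hl h, fun j hj => ?_⟩
      obtain ⟨m, hm, h0⟩ := h' j hj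
      exact ⟨m, mF _ _ _ _ hl hm, h0⟩
    · intro a n
      refine (mem_rfind_map (fun n => f (Nat.pair a n)) n).trans ?_
      constructor
      · rintro ⟨h, h'⟩
        obtain ⟨k, hk⟩ := (eF _ _).1 h
        have h'' : ∀ j, ∃ k, j < n → ∃ m, m ∈ F (initSeg X k) (Nat.pair a j) ∧ m ≠ 0 := by
          intro j
          by_cases hj : j < n
          · obtain ⟨m, hm, h0⟩ := h' j hj
            obtain ⟨k, hk⟩ := (eF _ _).1 hm
            exact ⟨k, fun _ => ⟨m, hk, h0⟩⟩
          · exact ⟨0, fun h => absurd h hj⟩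
        choose K hK using h''
        refine ⟨max k ((Finset.range n).sup K), (mem_rfind_map _ _).2
          ⟨mF _ _ _ _ (initSeg_suffix X (le_max_left _ _)) hk, fun j hj => ?_⟩⟩
        obtain ⟨m, hm, h0⟩ := hK j hj
        exact ⟨m, mF _ _ _ _ (initSeg_suffix X
          ((Finset.le_sup (Finset.mem_range.2 hj)).trans (le_max_right _ _))) hm, h0⟩
      · rintro ⟨k, hk⟩
        obtain ⟨h, h'⟩ := (mem_rfind_map _ _).1 hk
        refine ⟨(eF _ _).2 ⟨k, h⟩, fun j hj => ?_⟩
        obtain ⟨m, hm, h0⟩ := h' j hj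
        exact ⟨m, (eF _ _).2 ⟨k, hm⟩, h0⟩

/-- `phi X 0, phi X 1, …` lists exactly the partial functions that are recursive in `X`. -/
theorem exists_phi_eq_iff (X : ℕ → ℕ) (f : ℕ →. ℕ) :
    (∃ e, phi X e = f) ↔ Nat.RecursiveIn {(X : ℕ →. ℕ)} f := by
  constructor
  · rintro ⟨e, rfl⟩
    have hX : Nat.RecursiveIn {(X : ℕ →. ℕ)} (X : ℕ →. ℕ) := .oracle _ rfl
    have prim : ∀ {g : ℕ → ℕ}, Primrec g → Nat.RecursiveIn {(X : ℕ →. ℕ)} (g : ℕ →. ℕ) :=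
      fun h => (Primrec.nat_iff.1 h).recursiveIn
    have comp : ∀ {g h : ℕ → ℕ}, Nat.RecursiveIn {(X : ℕ →. ℕ)} (g : ℕ →. ℕ) →
        Nat.RecursiveIn {(X : ℕ →. ℕ)} (h : ℕ →. ℕ) →
        Nat.RecursiveIn {(X : ℕ →. ℕ)} ((fun n => g (h n) : ℕ → ℕ) : ℕ →. ℕ) :=
      fun hg hh => (Nat.RecursiveIn.comp hg hh).of_eq fun n => Part.bind_some _ _
    have pair : ∀ {g h : ℕ → ℕ}, Nat.RecursiveIn {(X : ℕ →. ℕ)} (g : ℕ →. ℕ) →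
        Nat.RecursiveIn {(X : ℕ →. ℕ)} (h : ℕ →. ℕ) →
        Nat.RecursiveIn {(X : ℕ →. ℕ)} ((fun n => Nat.pair (g n) (h n) : ℕ → ℕ) : ℕ →. ℕ) :=
      fun hg hh => (Nat.RecursiveIn.pair hg hh).of_eq fun n => by simp [Seq.seq]
    have pfst : Primrec fun p : ℕ => p.unpair.1 := Primrec.fst.comp Primrec.unpair
    have psnd : Primrec fun p : ℕ => p.unpair.2 := Primrec.snd.comp Primrec.unpair
    have hseg : Nat.RecursiveIn {(X : ℕ →. ℕ)}
        ((fun k => Encodable.encode (initSeg X k) : ℕ → ℕ) : ℕ →. ℕ) := by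
      have h1 := Nat.RecursiveIn.prec (O := {(X : ℕ →. ℕ)}) (prim (Primrec.const 0))
        (comp (prim Primrec.succ) (pair (comp hX (prim (pfst.comp psnd)))
          (prim (psnd.comp psnd))))
      refine (Nat.RecursiveIn.comp h1 (pair (prim (Primrec.const 0)) (prim Primrec.id))).of_eq
        fun k => ?_
      simp only [PFun.coe_val, Part.bind_eq_bind, Part.bind_some, Nat.unpair_pair, id]
      induction k with
      | zero => rfl
      | succ k ih => simp only [ih]; simp [initSeg, Encodable.encode_list_cons]
    let E : ℕ → ℕ := fun q => Encodable.encode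
      (Nat.Partrec.Code.evaln q.unpair.2.unpair.2.unpair.1 (Nat.Partrec.Code.ofNatCode e)
        (Nat.pair q.unpair.1 q.unpair.2.unpair.1))
    have hE : Primrec E := Primrec.encode.comp (Nat.Partrec.Code.primrec_evaln.comp
      (((pfst.comp (psnd.comp psnd)).pair (Primrec.const _)).pair
        (Primrec₂.natPair.comp pfst (pfst.comp psnd))))
    let T : ℕ → ℕ := fun p => E (Nat.pair (Encodable.encode (initSeg X p.unpair.2.unpair.2)) p)
    have hT : Nat.RecursiveIn {(X : ℕ →. ℕ)} (T : ℕ →. ℕ) :=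
      comp (prim hE) (pair (comp hseg (prim (psnd.comp psnd))) (prim Primrec.id))
    have hU := Nat.RecursiveIn.rfind
      (comp (prim (Primrec.nat_sub.comp (Primrec.const 1) Primrec.id)) hT)
    have hV := Nat.RecursiveIn.comp (comp (prim Primrec.pred) hT)
      (Nat.RecursiveIn.pair (prim Primrec.id) hU)
    refine hV.of_eq fun n => ?_
    have hTn : ∀ s, T (Nat.pair n s) = Encodable.encode
        (Nat.Partrec.Code.evaln s.unpair.1 (Nat.Partrec.Code.ofNatCode e)
          (Nat.pair (Encodable.encode (initSeg X s.unpair.2)) n)) := by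
      intro s; simp [T, E]
    have hs : (fun s => (fun m => decide (m = 0)) <$>
          ((fun p => 1 - id (T p) : ℕ → ℕ) : ℕ →. ℕ) (Nat.pair n s)) =
        ((fun s => (Nat.Partrec.Code.evaln s.unpair.1 (Nat.Partrec.Code.ofNatCode e)
          (Nat.pair (Encodable.encode (initSeg X s.unpair.2)) n)).isSome : ℕ → Bool) :
            ℕ →. Bool) := by
      funext s
      simp only [PFun.coe_val, hTn, id, Part.map_eq_map, Part.map_some]
      cases Nat.Partrec.Code.evaln s.unpair.1 (Nat.Partrec.Code.ofNatCode e)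
          (Nat.pair (Encodable.encode (initSeg X s.unpair.2)) n) <;> simp
    rw [hs]
    have hb : ∀ P : Part ℕ, ((Nat.pair <$> Part.some (id n) <*> P) >>= fun p =>
        Part.some (T p).pred) = P.bind fun s => Part.some (T (Nat.pair n s)).pred := by
      intro P
      simp [Seq.seq, Part.map_some, Part.bind_map]
    refine (hb _).trans (Part.ext fun m => ?_)
    refine Part.mem_bind_iff.trans (Iff.trans ?_ Part.mem_bind_iff.symm)
    refine exists_congr fun s => and_congr_right fun hs => ?_
    have hd := Nat.rfind_spec hs
    simp only [PFun.coe_val, Part.mem_some_iff] at hd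
    obtain ⟨v, hv⟩ := Option.isSome_iff_exists.1 hd.symm
    rw [hTn, hv]; simp [hv]
  · intro hf
    obtain ⟨F, hF, mF, eF⟩ := exists_finite_use X hf
    have hG : Partrec fun p : ℕ => F (Denumerable.ofNat (List ℕ) p.unpair.1) p.unpair.2 :=
      hF.comp ((Computable.ofNat _).comp (Computable.fst.comp Computable.unpair))
        (Computable.snd.comp Computable.unpair)
    obtain ⟨c, hc⟩ := Nat.Partrec.Code.exists_code.1 (Partrec.nat_iff.1 hG)
    have hc' : ∀ k n m, m ∈ c.eval (Nat.pair (Encodable.encode (initSeg X k)) n) ↔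
        m ∈ F (initSeg X k) n := by
      intro k n m; rw [hc]; simp
    refine ⟨Encodable.encode c, funext fun n => Part.ext fun m => ?_⟩
    have he : Nat.Partrec.Code.ofNatCode (Encodable.encode c) = c := by
      rw [← Nat.Partrec.Code.ofNatCode_eq]; exact Denumerable.ofNat_encode c
    have sound : ∀ m, m ∈ phi X (Encodable.encode c) n → m ∈ f n := by
      intro m hm
      obtain ⟨s, hs⟩ := Nat.rfindOpt_spec hm
      rw [he] at hs
      exact (eF n m).2 ⟨_, (hc' _ _ _).1 (Nat.Partrec.Code.evaln_sound hs)⟩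
    refine ⟨sound m, fun hm => ?_⟩
    obtain ⟨k, hk⟩ := (eF n m).1 hm
    obtain ⟨t, ht⟩ := Nat.Partrec.Code.evaln_complete.1 ((hc' _ _ _).2 hk)
    have hd : (phi X (Encodable.encode c) n).Dom :=
      Nat.rfindOpt_dom.2 ⟨Nat.pair t k, m, by simpa [he] using ht⟩
    have := sound _ (Part.get_mem hd)
    rw [Part.mem_unique hm this]
    exact Part.get_mem hd

/-! ### The arithmetical hierarchy relative to an oracle -/

/-- `S` is `Σ⁰ₖ` relative to `X`: it is `X`-computable for `k = 0`, and a projection of a set whose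
complement is `Σ⁰ₖ₋₁` relative to `X` for `k > 0`. -/
def IsSigma (X : ℕ → ℕ) : ℕ → Set ℕ → Prop
  | 0, S => ∃ χ : ℕ → Bool, ComputableIn {(X : ℕ →. ℕ)} χ ∧ ∀ n, n ∈ S ↔ χ n = true
  | k + 1, S => ∃ R : Set ℕ, IsSigma X k Rᶜ ∧ ∀ n, n ∈ S ↔ ∃ m, Nat.pair n m ∈ R

/-- `S` is `Π⁰ₖ` relative to `X`. -/
def IsPi (X : ℕ → ℕ) (k : ℕ) (S : Set ℕ) : Prop := IsSigma X k Sᶜ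

/-! ### Torsion-free rank 1 groups and cancellation -/

/-- `A` is a torsion-free abelian group of rank 1. -/
def IsTorsionFreeRankOne (A : Type*) [AddCommGroup A] : Prop :=
  IsAddTorsionFree A ∧ Module.rank ℤ A = 1

/-- `A` has the cancellation property: `A ⊕ G ≅ A ⊕ H` implies `G ≅ H`, for all abelian groups
`G` and `H` (in an arbitrary universe). -/
def IsCancellable (A : Type*) [AddCommGroup A] : Prop :=
  ∀ (G H : Type u) [AddCommGroup G] [AddCommGroup H],
    Nonempty (A × G ≃+ A × H) → Nonempty (G ≃+ H)

/-! ### The listing of the computable groups and the index sets -/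

/-- The domain of the `e`-th `X`-computable structure: the set decided by the program coded in the
first component of `e`. -/
def structDomain (X : ℕ → ℕ) (e : ℕ) : Set ℕ := {n | 1 ∈ phi X e.unpair.1 n}

/-- The `e`-th `X`-computable structure is a group, and `inst` is its group structure: the first
component of `e` codes a program that computes the characteristic function of the domain, and the
second one a program that computes the addition on the domain. -/
def IsComputableGroup (X : ℕ → ℕ) (e : ℕ) (inst : AddCommGroup (structDomain X e)) : Prop :=
  (∀ n, 0 ∈ phi X e.unpair.1 n ∨ 1 ∈ phi X e.unpair.1 n) ∧
    ∀ a b : structDomain X e,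
      ((a + b : structDomain X e) : ℕ) ∈ phi X e.unpair.2 (Nat.pair (a : ℕ) (b : ℕ))

/-- The indices of the `X`-computable torsion-free rank 1 groups. -/
def rankOneIndexSet (X : ℕ → ℕ) : Set ℕ :=
  {e | ∃ inst : AddCommGroup (structDomain X e),
    IsComputableGroup X e inst ∧ IsTorsionFreeRankOne (structDomain X e)}

/-- The indices of the `X`-computable torsion-free rank 1 groups that are cancellable. -/
def cancellableIndexSet (X : ℕ → ℕ) : Set ℕ :=
  {e | ∃ inst : AddCommGroup (structDomain X e),
    IsComputableGroup X e inst ∧ IsTorsionFreeRankOne (structDomain X e) ∧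
      IsCancellable.{u} (structDomain X e)}

/-! A torsion-free group `A` of rank one is regarded as a subgroup of ℚ containing 1. Its
endomorphism ring is then the subring `R = A.multipliers` of ℚ, which is determined by the primes
inverted in it.

Algebra (`isCancellable_iff`): `A` is cancellable exactly if it is cyclic or satisfies `LiftsUnits`.
If units lift, then `R` has stable range one (`AddSubgroup.exists_unit_add_mul`), and the two copies
of `A` in `A ⊕ G ≅ A ⊕ H` have a common complement, so `G ≅ H`
(`AddSubgroup.isCancellable_of_liftsUnits`). The ring ℤ does not have stable range one, but the
group ℤ cancels because its nonzero subgroups are isomorphic to it (`nonempty_equiv_of_int_prod`).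
Conversely, let `A` be noncyclic and let the unit `u` modulo `b` not lift. Choose `B ≤ ℚ` with no
nonzero homomorphisms to or from `A` and with automorphisms ±1 only. The groups `A × B + ℤ(1/b,
1/b)` and `A × B + ℤ(u/b, 1/b)` become isomorphic after adding `A`, by a matrix of determinant 1. An
isomorphism between them would be diagonal, and its first entry would be a unit of `R` congruent to
`±u` modulo `b` (`AddSubgroup.exists_unit_of_glue_equiv`).

Upper bound: divisibility of the group by a given number is Π⁰₂, so `LiftsUnits`, which reads "for
all `b, u` there are `v, w` acting invertibly", is Π⁰₄; being cyclic is Σ⁰₃, and the remaining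
conditions are Π⁰₄ as well.

Hardness: write `n ∈ S` as `∀ m ∃ k ∀ s ∃ t, c(n,m,k,s,t) = 0`. Each prime of a computable sequence
either answers a request or belongs to none. A request consists of a modulus `b`, a residue `u` and
a list of candidates for `k`; its prime is congruent to `u` modulo `b`, and it is inverted in the
`n`-th group exactly if the listed candidates are correct for all `m < b - 1`. If `n ∈ S`, every
unit modulo every `b` is represented by an inverted prime (`liftsUnits_codingGroup`). If some `m`
fails, only primes requested with moduli at most `m + 1` are inverted. Modulo a large prime `q`
without request, the congruences built into the sequence and quadratic reciprocity make all inverted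
primes and -1 squares, so nonsquares modulo `q` do not lift (`not_liftsUnits_codingGroup`). The
coding groups have uniformly computable presentations (`exists_computable_presentation`). -/

/-! ### The unit lifting condition and invariance under isomorphism. -/

/-- Multiplication by `n` is surjective on `A`. -/
def DivBy (A : Type*) [AddCommGroup A] (n : ℕ) : Prop := ∀ x : A, ∃ y : A, n • y = x

/-- For every modulus `b` without divisors that act invertibly on `A`, every unit modulo `b` is
represented, up to sign, by a quotient of numbers acting invertibly on `A`. -/
def LiftsUnits (A : Type*) [AddCommGroup A] : Prop :=
  ∀ b u : ℕ, 0 < b → u.Coprime b →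
    (∃ p, 1 < p ∧ p ∣ b ∧ DivBy A p) ∨
      ∃ v w, 0 < v ∧ 0 < w ∧ DivBy A v ∧ DivBy A w ∧ (v ≡ u * w [MOD b] ∨ b ∣ v + u * w)

section Transfer

variable {A B : Type*} [AddCommGroup A] [AddCommGroup B]

theorem DivBy.congr (e : A ≃+ B) {n : ℕ} (h : DivBy A n) : DivBy B n := fun x => by
  obtain ⟨y, hy⟩ := h (e.symm x)
  exact ⟨e y, by rw [← map_nsmul, hy, e.apply_symm_apply]⟩

theorem LiftsUnits.congr (e : A ≃+ B) (h : LiftsUnits A) : LiftsUnits B := by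
  intro b u hb hu
  rcases h b u hb hu with ⟨p, h1, h2, h3⟩ | ⟨v, w, h1, h2, h3, h4, h5⟩
  · exact .inl ⟨p, h1, h2, h3.congr e⟩
  · exact .inr ⟨v, w, h1, h2, h3.congr e, h4.congr e, h5⟩

theorem IsCancellable.congr (e : A ≃+ B) (h : IsCancellable.{u} A) : IsCancellable.{u} B := by
  rintro G H _ _ ⟨f⟩
  exact h G H ⟨(e.prodCongr (.refl G)).trans (f.trans (e.symm.prodCongr (.refl H)))⟩

theorem isAddCyclic_congr (e : A ≃+ B) (h : IsAddCyclic A) : IsAddCyclic B :=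
  isAddCyclic_of_surjective e e.surjective

end Transfer

/-! ### Rank one groups as subgroups of ℚ. -/

/-- This form quantifies over elements and integers only. It yields the embedding into ℚ and can be
expressed arithmetically. -/
theorem isTorsionFreeRankOne_iff (A : Type*) [AddCommGroup A] :
    IsTorsionFreeRankOne A ↔ IsAddTorsionFree A ∧
      ∃ g : A, g ≠ 0 ∧ ∀ a : A, ∃ n m : ℤ, n ≠ 0 ∧ n • a = m • g := by
  refine and_congr_right fun hA => ?_
  constructor
  · intro h
    obtain ⟨g, hg⟩ := rank_pos_iff_exists_ne_zero.1 (show 0 < Module.rank ℤ A by simp [h])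
    refine ⟨g, hg, fun a => ?_⟩
    by_contra! hc
    have hli : LinearIndependent ℤ ![a, g] := by
      rw [LinearIndependent.pair_iff]
      intro s t hst
      have hs : s = 0 := by
        by_contra hs
        exact hc s (-t) hs (by rw [neg_smul]; exact eq_neg_of_add_eq_zero_left hst)
      subst hs
      simpa [hg] using hst
    have := hli.cardinal_lift_le_rank
    simp [h] at this
  · rintro ⟨g, hg, h⟩
    refine le_antisymm ?_ ?_
    · have := rank_le (R := ℤ) (M := A) (n := 1) ?_
      · simpa using this
      · intro s hs
        by_contra! hc
        obtain ⟨a, ha, b, hb, hab⟩ := Finset.one_lt_card.1 hc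
        have hli : LinearIndependent ℤ ![a, b] := by
          have := hs.comp ![(⟨a, ha⟩ : s), ⟨b, hb⟩] (by
            intro i j hij
            fin_cases i <;> fin_cases j <;> simp_all [eq_comm])
          convert! this using 1
          ext i; fin_cases i <;> rfl
        rw [LinearIndependent.pair_iff] at hli
        obtain ⟨n, m, hn, e⟩ := h a
        obtain ⟨n', m', hn', e'⟩ := h b
        have := hli (m' * n) (-(m * n')) (by
          rw [neg_smul, mul_smul, mul_smul, e, e', smul_comm m' m, add_neg_cancel])
        have hm : m = 0 := by simpa [hn'] using this.2
        rw [hm, zero_smul] at e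
        have ha0 : a = 0 := by simpa [hn] using e
        have := hli 1 0 (by simp [ha0])
        simp at this
    · rw [Cardinal.one_le_iff_pos]
      exact rank_pos_iff_exists_ne_zero.2 ⟨g, hg⟩

/-- A torsion-free group of rank one embeds in `ℚ` with a given nonzero element going to `1`. -/
theorem IsTorsionFreeRankOne.exists_equiv_subgroup {A : Type*} [AddCommGroup A]
    (hA : IsTorsionFreeRankOne A) {g : A} (hg : g ≠ 0) :
    ∃ (B : AddSubgroup ℚ) (e : A ≃+ B), (e g : ℚ) = 1 := by
  obtain ⟨htf, g₀, hg₀, h₀⟩ := (isTorsionFreeRankOne_iff A).1 hA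
  have h : ∀ a : A, ∃ n m : ℤ, n ≠ 0 ∧ n • a = m • g := by
    intro a
    obtain ⟨n, m, hn, e⟩ := h₀ a
    obtain ⟨n', m', hn', e'⟩ := h₀ g
    have hm' : m' ≠ 0 := by
      rintro rfl
      rw [zero_smul, smul_eq_zero] at e'
      exact e'.elim hn' hg
    exact ⟨m' * n, m * n', mul_ne_zero hm' hn, by
      rw [mul_smul, mul_smul, e, e', smul_comm]⟩
  choose n m hn e using h
  -- The fraction does not depend on the chosen relation between `a` and `g`; this makes `φ`
  -- additive.
  have key : ∀ a (k l : ℤ), k ≠ 0 → k • a = l • g → (m a : ℚ) / n a = l / k := by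
    intro a k l hk hkl
    have : (m a * k) • g = (l * n a) • g := by
      rw [mul_comm, mul_smul, ← e, smul_comm, hkl, ← mul_smul, mul_comm]
    rw [← sub_eq_zero, ← sub_smul, smul_eq_zero, sub_eq_zero] at this
    have h1 := this.resolve_right hg
    rw [div_eq_div_iff (by exact_mod_cast hn a) (by exact_mod_cast hk)]
    exact_mod_cast h1
  let φ : A →+ ℚ := AddMonoidHom.mk' (fun a => (m a : ℚ) / n a) (by
    intro a b
    rw [key (a + b) (n a * n b) (n b * m a + n a * m b) (mul_ne_zero (hn a) (hn b)) (by
      rw [smul_add, mul_smul, smul_comm (n a), e, mul_smul, e, add_smul, mul_smul, mul_smul])]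
    have h1 : (n a : ℚ) ≠ 0 := by exact_mod_cast hn a
    have h2 : (n b : ℚ) ≠ 0 := by exact_mod_cast hn b
    push_cast
    field_simp)
  have hφ : Function.Injective φ := by
    rw [injective_iff_map_eq_zero]
    intro a ha
    have h1 : (n a : ℚ) ≠ 0 := by exact_mod_cast hn a
    have : m a = 0 := by
      have : (m a : ℚ) / n a = 0 := ha
      simpa [h1] using this
    have h2 := e a
    rw [this, zero_smul, smul_eq_zero] at h2
    exact h2.resolve_left (hn a)
  refine ⟨φ.range, AddMonoidHom.ofInjective hφ, ?_⟩
  change (m g : ℚ) / n g = 1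
  rw [key g 1 1 one_ne_zero rfl]; simp

theorem AddSubgroup.isTorsionFreeRankOne_of_one_mem (A : AddSubgroup ℚ) (h : 1 ∈ A) :
    IsTorsionFreeRankOne A := by
  refine (isTorsionFreeRankOne_iff A).2 ⟨inferInstance, ⟨1, h⟩, by simp [Subtype.ext_iff], ?_⟩
  rintro ⟨a, ha⟩
  refine ⟨a.den, a.num, by simp, Subtype.ext ?_⟩
  simp [Rat.den_mul_eq_num]

/-! ### Multiplier rings, stable range one and cancellation. -/

namespace AddSubgroup

/-- The rational numbers mapping `A` into itself; this is the endomorphism ring of `A`. -/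
def multipliers (A : AddSubgroup ℚ) : Subring ℚ where
  carrier := {r | ∀ x ∈ A, r * x ∈ A}
  mul_mem' ha hb x hx := by rw [mul_assoc]; exact ha _ (hb _ hx)
  one_mem' x hx := by rwa [one_mul]
  add_mem' ha hb x hx := by rw [add_mul]; exact A.add_mem (ha _ hx) (hb _ hx)
  zero_mem' x _ := by rw [zero_mul]; exact A.zero_mem
  neg_mem' ha x hx := by rw [neg_mul]; exact A.neg_mem (ha _ hx)

variable {A : AddSubgroup ℚ}

theorem divBy_iff_inv_mem {n : ℕ} (hn : 0 < n) : DivBy A n ↔ (n : ℚ)⁻¹ ∈ A.multipliers := by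
  have hn' : (n : ℚ) ≠ 0 := by positivity
  constructor
  · intro h x hx
    obtain ⟨y, hy⟩ := h ⟨x, hx⟩
    have : (n : ℚ) * y = x := by simpa using congrArg Subtype.val hy
    rw [← this, inv_mul_cancel_left₀ hn']
    exact y.2
  · rintro h ⟨x, hx⟩
    exact ⟨⟨_, h x hx⟩, Subtype.ext (by simp [hn'])⟩

theorem inv_mem_multipliers_of_dvd {m n : ℕ} (hn : 0 < n) (hmn : m ∣ n)
    (h : (n : ℚ)⁻¹ ∈ A.multipliers) : (m : ℚ)⁻¹ ∈ A.multipliers := by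
  obtain ⟨k, rfl⟩ := hmn
  have hm : (m : ℚ) ≠ 0 := by rintro h0; simp_all
  have hk : (k : ℚ) ≠ 0 := by rintro h0; simp_all
  have : (m : ℚ)⁻¹ = k * ((m * k : ℕ) : ℚ)⁻¹ := by push_cast; field_simp
  rw [this]
  exact mul_mem (natCast_mem _ k) h

/-- By Bézout, the inverse of the denominator of `r` is an integral combination of `r` and 1. -/
theorem inv_den_mem_multipliers {r : ℚ} (hr : r ∈ A.multipliers) :
    (r.den : ℚ)⁻¹ ∈ A.multipliers := by
  have hc : IsCoprime r.num (r.den : ℤ) := Int.isCoprime_iff_nat_coprime.2 r.reduced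
  obtain ⟨x, y, hxy⟩ := hc
  have hd : (r.den : ℚ) ≠ 0 := by simp
  have : (r.den : ℚ)⁻¹ = x * r + y := by
    have h1 : ((x * r.num + y * r.den : ℤ) : ℚ) = 1 := by rw [hxy]; simp
    have h2 : r * r.den = r.num := Rat.mul_den_eq_num r
    push_cast at h1
    field_simp
    rw [← h1, ← h2]; ring
  rw [this]
  exact add_mem (mul_mem (intCast_mem _ x) hr) (intCast_mem _ y)

/-- Splitting off the part of `k` that acts invertibly. -/
theorem exists_eq_unit_mul (R : Subring ℚ) (k : ℕ) (hk : 0 < k) :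
    ∃ c b : ℕ, k = c * b ∧ (c : ℚ)⁻¹ ∈ R ∧ ∀ p, 1 < p → p ∣ b → (p : ℚ)⁻¹ ∉ R := by
  induction k using Nat.strong_induction_on with
  | _ k ih =>
    by_cases h : ∃ p, 1 < p ∧ p ∣ k ∧ (p : ℚ)⁻¹ ∈ R
    · obtain ⟨p, hp, ⟨l, rfl⟩, hpR⟩ := h
      have hl : 0 < l := Nat.pos_of_mul_pos_left hk
      obtain ⟨c, b, rfl, hc, hb⟩ := ih l (by nlinarith) hl
      exact ⟨p * c, b, by ring, by push_cast; rw [mul_inv]; exact mul_mem hpR hc, hb⟩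
    · push Not at h
      exact ⟨1, k, by simp, by simp, h⟩

/-- If units lift, then the endomorphism ring of `A` has stable range one. -/
theorem exists_unit_add_mul (hA : LiftsUnits A) {a s x : ℚ} (ha : a ∈ A.multipliers)
    (hs : s ∈ A.multipliers) (hx : x ∈ A.multipliers) (h : x * a + s = 1) :
    ∃ t ∈ A.multipliers, a + t * s ≠ 0 ∧ (a + t * s)⁻¹ ∈ A.multipliers := by
  rcases eq_or_ne s 0 with rfl | hs0
  · have hxa : x * a = 1 := by simpa using h
    refine ⟨0, zero_mem _, ?_, ?_⟩
    · rintro h0; simp at h0; simp [h0] at hxa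
    · rwa [zero_mul, add_zero, inv_eq_of_mul_eq_one_left hxa]
  set n : ℕ := a.den * s.den with hn
  set m : ℤ := a.num * s.den with hm
  set k : ℤ := s.num * a.den with hk
  have hn0 : (n : ℚ) ≠ 0 := by simp [hn]
  have hnE : (n : ℚ)⁻¹ ∈ A.multipliers := by
    rw [hn]; push_cast; rw [mul_inv]
    exact mul_mem (inv_den_mem_multipliers ha) (inv_den_mem_multipliers hs)
  have hda : (a.den : ℚ) ≠ 0 := by simp
  have hds : (s.den : ℚ) ≠ 0 := by simp
  have ea : a = m / n := by
    rw [hm, hn]; push_cast; rw [mul_div_mul_right _ _ hds, Rat.num_div_den]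
  have es : s = k / n := by
    rw [hk, hn]; push_cast; rw [mul_comm (a.den : ℚ), mul_div_mul_right _ _ hda, Rat.num_div_den]
  have hk0 : k ≠ 0 := by
    rintro h0; rw [h0] at es; simp at es; exact hs0 es
  obtain ⟨c, b, hcb, hc, hb⟩ := exists_eq_unit_mul A.multipliers k.natAbs (Int.natAbs_pos.2 hk0)
  have hcb0 : c * b ≠ 0 := by rw [← hcb]; exact Int.natAbs_ne_zero.2 hk0
  have hc0 : c ≠ 0 := left_ne_zero_of_mul hcb0
  have hb0 : b ≠ 0 := right_ne_zero_of_mul hcb0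
  have hbk : (b : ℤ) ∣ k := Int.natCast_dvd.2 ⟨c, by rw [hcb, mul_comm]⟩
  have hu : ((m % b).toNat : ℤ) = m % b :=
    Int.toNat_of_nonneg (Int.emod_nonneg _ (by exact_mod_cast hb0))
  have hub : (b : ℤ) ∣ m - (m % b).toNat := by rw [hu]; exact Int.dvd_self_sub_emod
  -- If a prime `p` divided both `m` and `b`, then `a` and `s` would be multiples of `p / n`, and
  -- dividing `x * a + s = 1` by `p` would put the inverse of `p` into the ring, against the choice
  -- of `b`.
  have hcop : (m % b).toNat.Coprime b := by
    by_contra hnc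
    obtain ⟨p, hp, hp1, hp2⟩ := Nat.Prime.not_coprime_iff_dvd.1 hnc
    have hp1' : (p : ℤ) ∣ m := by
      have h1 : (p : ℤ) ∣ (m % b).toNat := by exact_mod_cast hp1
      have h2 : (p : ℤ) ∣ b := by exact_mod_cast hp2
      have := dvd_add (h2.trans hub) h1
      simpa using this
    have hp2' : (p : ℤ) ∣ k := (Int.natCast_dvd_natCast.2 hp2).trans hbk
    obtain ⟨m', hm'⟩ := hp1'
    obtain ⟨k', hk'⟩ := hp2'
    have hp0 : (p : ℚ) ≠ 0 := by exact_mod_cast hp.ne_zero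
    refine hb p hp.one_lt hp2 ?_
    have : (p : ℚ)⁻¹ = x * (m' * (n : ℚ)⁻¹) + k' * (n : ℚ)⁻¹ := by
      rw [ea, es, hm', hk'] at h
      push_cast at h
      field_simp
      field_simp at h
      linear_combination -h
    rw [this]
    exact add_mem (mul_mem hx (mul_mem (intCast_mem _ _) hnE)) (mul_mem (intCast_mem _ _) hnE)
  rcases hA b _ (Nat.pos_of_ne_zero hb0) hcop with ⟨p, hp, hpb, hpd⟩ | ⟨v, w, hv, hw, hvd, hwd, hvw⟩
  · exact absurd ((divBy_iff_inv_mem (by omega)).1 hpd) (hb p hp hpb)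
  rw [divBy_iff_inv_mem hv] at hvd
  rw [divBy_iff_inv_mem hw] at hwd
  -- The sign `ε` unites the two alternatives in `LiftsUnits`.
  obtain ⟨ε, j, hε, hj⟩ : ∃ ε j : ℤ, ε * ε = 1 ∧ m * w + b * j = ε * v := by
    obtain ⟨i, hi⟩ := hub
    rcases hvw with hvw | hvw
    · obtain ⟨l, hl⟩ := (Nat.modEq_iff_dvd.1 hvw)
      push_cast at hl
      exact ⟨1, -l - i * w, rfl, by linear_combination hl + w * hi⟩
    · obtain ⟨l, hl⟩ := Int.natCast_dvd_natCast.2 hvw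
      push_cast at hl
      refine ⟨-1, -l - i * w, rfl, by linear_combination w * hi + hl⟩
  obtain ⟨σ, hσ, hkσ⟩ : ∃ σ : ℤ, σ * σ = 1 ∧ k = σ * (c * b) := by
    have : (k.natAbs : ℤ) = c * b := by rw [hcb]; push_cast; rfl
    rcases Int.natAbs_eq k with h1 | h1
    · exact ⟨1, rfl, by rw [← this, one_mul]; exact h1⟩
    · exact ⟨-1, rfl, by rw [← this, neg_one_mul]; exact h1⟩
  have hv0 : (v : ℚ) ≠ 0 := by positivity
  have hw0 : (w : ℚ) ≠ 0 := by positivity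
  have hc0' : (c : ℚ) ≠ 0 := by exact_mod_cast hc0
  have hε' : (ε : ℚ) * ε = 1 := by exact_mod_cast hε
  have hσ' : (σ : ℚ) * σ = 1 := by exact_mod_cast hσ
  have hε0 : (ε : ℚ) ≠ 0 := by rintro h0; simp [h0] at hε'
  have hj' : (m : ℚ) * w + b * j = ε * v := by exact_mod_cast hj
  -- Since `s = σ c b / n`, the multiplier `t = σ j / (c w)` turns `s` into `b j / (w n)`, and the
  -- numerator of the sum over `w n` becomes `m w + b j = ε v`.
  have heq : a + (σ * j * (c : ℚ)⁻¹ * (w : ℚ)⁻¹) * s = ε * v * (w : ℚ)⁻¹ * (n : ℚ)⁻¹ := by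
    rw [ea, es, hkσ]
    push_cast
    field_simp
    linear_combination hj' + j * b * hσ'
  refine ⟨σ * j * (c : ℚ)⁻¹ * (w : ℚ)⁻¹, ?_, ?_, ?_⟩
  · exact mul_mem (mul_mem (mul_mem (intCast_mem _ _) (intCast_mem _ _)) hc) hwd
  · rw [heq]
    exact mul_ne_zero (mul_ne_zero (mul_ne_zero hε0 hv0) (inv_ne_zero hw0)) (inv_ne_zero hn0)
  · have : (a + (σ * j * (c : ℚ)⁻¹ * (w : ℚ)⁻¹) * s)⁻¹ = ε * w * n * (v : ℚ)⁻¹ := by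
      rw [heq]; field_simp; linear_combination -hε'
    rw [this]
    exact mul_mem (mul_mem (mul_mem (intCast_mem _ _) (natCast_mem _ _)) (natCast_mem _ _)) hvd

/-- Clearing the denominator of `x` shows that an endomorphism is multiplication by the image of 1.
-/
theorem addMonoidHom_apply (h1 : (1 : ℚ) ∈ A) (f : A →+ A) (x : A) :
    (f x : ℚ) = f ⟨1, h1⟩ * x := by
  have h : (x : ℚ).den • x = (x : ℚ).num • (⟨1, h1⟩ : A) := Subtype.ext (by
    simp [Rat.den_mul_eq_num])
  have h' := congrArg (fun y : A => (f y : ℚ)) h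
  simp only [map_nsmul, map_zsmul, coe_nsmul, coe_zsmul, nsmul_eq_mul, zsmul_eq_mul] at h'
  have hd : ((x : ℚ).den : ℚ) ≠ 0 := by simp
  apply mul_left_cancel₀ hd
  rw [h', mul_left_comm, Rat.den_mul_eq_num, mul_comm]

end AddSubgroup

/-- The quotient by the image of `i` is isomorphic to every complement of that image. -/
noncomputable def AddMonoidHom.kerEquivOfComplement {A M G : Type*} [AddCommGroup A]
    [AddCommGroup M] [AddCommGroup G] (i : A →+ M) (ρ : M →+ A) (p : M →+ G)
    (hp : Function.Surjective p) (hpi : ∀ z, p z = 0 ↔ ∃ x, i x = z)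
    (hρ : Function.Bijective (ρ.comp i)) : ρ.ker ≃+ G :=
  AddEquiv.ofBijective (p.comp ρ.ker.subtype) <| by
    constructor
    · rw [injective_iff_map_eq_zero]
      rintro ⟨z, hz⟩ h
      obtain ⟨x, rfl⟩ := (hpi z).1 h
      have : x = 0 := hρ.1 (by rw [map_zero]; exact hz)
      exact Subtype.ext (by simp [this])
    · intro g
      obtain ⟨z, rfl⟩ := hp g
      obtain ⟨x, hx⟩ := hρ.2 (ρ z)
      refine ⟨⟨z - i x, ?_⟩, ?_⟩
      · rw [AddMonoidHom.mem_ker, map_sub, ← hx, AddMonoidHom.comp_apply, sub_self]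
      · have : p (i x) = 0 := (hpi _).2 ⟨x, rfl⟩
        simp [this]

/-- The group `A × G` contains two copies of `A`, given by `i` and `i'`, with quotients `G` and `H`.
Stable range one provides a map `ρ` to `A` that is bijective on both copies. Its kernel is a
complement of both, hence isomorphic to both quotients. -/
theorem AddSubgroup.isCancellable_of_liftsUnits {A : AddSubgroup ℚ} (h1 : (1 : ℚ) ∈ A)
    (hA : LiftsUnits A) : IsCancellable.{u} A := by
  rintro G H _ _ ⟨e⟩
  let i : A →+ A × G := AddMonoidHom.inl A G
  let i' : A →+ A × G := e.symm.toAddMonoidHom.comp (AddMonoidHom.inl A H)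
  let fa : A →+ A := (AddMonoidHom.fst A H).comp (e.toAddMonoidHom.comp i)
  let fx : A →+ A := (AddMonoidHom.fst A G).comp i'
  let q : A × G →+ A := (AddMonoidHom.fst A G).comp (e.symm.toAddMonoidHom.comp
    ((AddMonoidHom.inr A H).comp ((AddMonoidHom.snd A H).comp e.toAddMonoidHom)))
  let fs : A →+ A := q.comp i
  -- Split `e (y, 0)` into its components in `A` and `H`, carry both back and add the
  -- `A`-coordinates.
  have hsum : ∀ y : A, fx (fa y) + fs y = y := by
    intro y
    change (e.symm ((e (y, 0)).1, 0)).1 + (e.symm (0, (e (y, 0)).2)).1 = y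
    rw [← Prod.fst_add, ← map_add]
    simp
  have hmem : ∀ f : A →+ A, ((f ⟨1, h1⟩ : A) : ℚ) ∈ A.multipliers := fun f x hx => by
    rw [← addMonoidHom_apply h1 f ⟨x, hx⟩]; exact (f _).2
  obtain ⟨t, ht, h0, hinv⟩ := exists_unit_add_mul hA (hmem fa) (hmem fs) (hmem fx) (by
    have := congrArg (Subtype.val) (hsum ⟨1, h1⟩)
    rw [coe_add, addMonoidHom_apply h1 fx] at this
    exact this)
  let ft : A →+ A := AddMonoidHom.mk' (fun x => ⟨t * x, ht x x.2⟩)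
    (fun x y => Subtype.ext (by simp [mul_add]))
  -- On the first copy of `A` this is `fa + t * fs`, which is invertible; on the second copy `q`
  -- vanishes and `ρ` is the identity.
  let ρ : A × G →+ A := (AddMonoidHom.fst A H).comp e.toAddMonoidHom + ft.comp q
  have hρi : ∀ y, ((ρ (i y) : A) : ℚ) = (fa ⟨1, h1⟩ + t * fs ⟨1, h1⟩) * y := by
    intro y
    change ((fa y : A) : ℚ) + t * (fs y : A) = _
    rw [addMonoidHom_apply h1 fa, addMonoidHom_apply h1 fs]
    ring
  have hρi' : ∀ y, ρ (i' y) = y := by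
    intro y
    apply Subtype.ext
    change (((e (e.symm (y, 0))).1 : A) : ℚ) + t * ((e.symm (0, (e (e.symm (y, 0))).2)).1 : A) = y
    have h00 : ((0 : A), (0 : H)) = 0 := rfl
    simp [h00]
  have E₁ : ρ.ker ≃+ G := i.kerEquivOfComplement ρ (AddMonoidHom.snd A G) Prod.snd_surjective
    (by
      rintro ⟨x, g⟩
      constructor
      · rintro h; exact ⟨x, Prod.ext rfl (Eq.symm h)⟩
      · rintro ⟨y, hy⟩; exact (congrArg Prod.snd hy).symm)
    (by
      constructor
      · intro y z hyz
        have := congrArg Subtype.val hyz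
        rw [AddMonoidHom.comp_apply, AddMonoidHom.comp_apply, hρi, hρi] at this
        exact Subtype.ext (mul_left_cancel₀ h0 this)
      · intro y
        refine ⟨⟨_, hinv y y.2⟩, Subtype.ext ?_⟩
        rw [AddMonoidHom.comp_apply, hρi, mul_inv_cancel_left₀ h0])
  have E₂ : ρ.ker ≃+ H := i'.kerEquivOfComplement ρ
    ((AddMonoidHom.snd A H).comp e.toAddMonoidHom) (Prod.snd_surjective.comp e.surjective)
    (by
      intro z
      constructor
      · intro h
        refine ⟨(e z).1, ?_⟩
        change e.symm ((e z).1, 0) = z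
        rw [AddEquiv.symm_apply_eq]
        exact Prod.ext rfl (Eq.symm h)
      · rintro ⟨y, rfl⟩
        change (e (e.symm (y, 0))).2 = 0
        simp)
    (by
      constructor
      · intro y z hyz
        have h : ρ (i' y) = ρ (i' z) := hyz
        rwa [hρi', hρi'] at h
      · intro y; exact ⟨y, hρi' y⟩)
  exact ⟨E₁.symm.trans E₂⟩

/-! ### Cancellation of ℤ. -/

section IntCancellation

variable {G H : Type*} [AddCommGroup G] [AddCommGroup H]

/-- The image is generated by some `d ≠ 0` and is free, so a preimage of `d` generates a complement
of the kernel. -/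
theorem AddMonoidHom.nonempty_equiv_int_prod_ker (f : G →+ ℤ) (hf : f ≠ 0) :
    Nonempty (G ≃+ ℤ × f.ker) := by
  obtain ⟨d, hd⟩ := Int.subgroup_cyclic f.range
  rw [← AddSubgroup.zmultiples_eq_closure] at hd
  obtain ⟨g₀, hg₀⟩ : d ∈ f.range := by rw [hd]; exact AddSubgroup.mem_zmultiples d
  have hd0 : d ≠ 0 := by
    rintro rfl
    apply hf
    ext g
    have : f g ∈ f.range := ⟨g, rfl⟩
    rw [hd] at this
    simpa using this
  let φ : ℤ × f.ker →+ G := (zmultiplesHom G g₀).coprod f.ker.subtype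
  have hφ : ∀ n k, φ (n, k) = n • g₀ + k := fun _ _ => rfl
  refine ⟨(AddEquiv.ofBijective φ ⟨?_, ?_⟩).symm⟩
  · rw [injective_iff_map_eq_zero]
    rintro ⟨n, k, hk⟩ h
    rw [hφ] at h
    have hn : n = 0 := by
      have := congrArg f h
      rw [AddMonoidHom.mem_ker] at hk
      simpa [hk, hg₀, hd0] using this
    subst hn
    simpa using h
  · intro g
    have : f g ∈ f.range := ⟨g, rfl⟩
    rw [hd, AddSubgroup.mem_zmultiples_iff] at this
    obtain ⟨n, hn⟩ := this
    exact ⟨(n, ⟨g - n • g₀, by rw [AddMonoidHom.mem_ker, map_sub, map_zsmul, hg₀, hn, sub_self]⟩),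
      by rw [hφ]; simp⟩

/-- The ℤ-coordinate of `e (n, g)` is a fixed nonzero multiple of `n`. It vanishes only for `n = 0`,
so `e` restricts to a bijection from `G` onto `H`. -/
theorem nonempty_equiv_of_fst_eq_zero (e : ℤ × G ≃+ ℤ × H) (h : ∀ g, (e (0, g)).1 = 0) :
    Nonempty (G ≃+ H) := by
  have hlin : ∀ n g, (e (n, g)).1 = n * (e (1, 0)).1 := by
    intro n g
    have : ((n, g) : ℤ × G) = n • (1, 0) + (0, g) := by simp
    rw [this, map_add, map_zsmul, Prod.fst_add, h, add_zero, Prod.smul_fst, smul_eq_mul]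
  have hne : (e (1, 0)).1 ≠ 0 := by
    intro h0
    have := hlin (e.symm (1, 0)).1 (e.symm (1, 0)).2
    rw [h0] at this
    simp at this
  refine ⟨AddEquiv.ofBijective ((AddMonoidHom.snd ℤ H).comp
    (e.toAddMonoidHom.comp (AddMonoidHom.inr ℤ G))) ⟨?_, ?_⟩⟩
  · rw [injective_iff_map_eq_zero]
    intro g hg
    have : e (0, g) = 0 := Prod.ext (h g) hg
    simpa using this
  · intro y
    have h1 := hlin (e.symm (0, y)).1 (e.symm (0, y)).2
    simp only [Prod.mk.eta, AddEquiv.apply_symm_apply, zero_eq_mul] at h1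
    refine ⟨(e.symm (0, y)).2, ?_⟩
    have h2 : ((0, (e.symm (0, y)).2) : ℤ × G) = e.symm (0, y) :=
      Prod.ext (h1.resolve_right hne).symm rfl
    change (e (0, (e.symm (0, y)).2)).2 = y
    rw [h2, e.apply_symm_apply]

/-- If neither `G` nor `H` is carried into the other, both split as ℤ plus a kernel. Under `e` the
two kernels are the same group, the intersection of `G` with `H`. -/
theorem nonempty_equiv_of_int_prod (e : ℤ × G ≃+ ℤ × H) : Nonempty (G ≃+ H) := by
  let f : G →+ ℤ := (AddMonoidHom.fst ℤ H).comp (e.toAddMonoidHom.comp (AddMonoidHom.inr ℤ G))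
  let f' : H →+ ℤ :=
    (AddMonoidHom.fst ℤ G).comp (e.symm.toAddMonoidHom.comp (AddMonoidHom.inr ℤ H))
  by_cases hf : f = 0
  · exact nonempty_equiv_of_fst_eq_zero e fun g => DFunLike.congr_fun hf g
  by_cases hf' : f' = 0
  · exact (nonempty_equiv_of_fst_eq_zero e.symm fun g => DFunLike.congr_fun hf' g).map .symm
  obtain ⟨e₁⟩ := f.nonempty_equiv_int_prod_ker hf
  obtain ⟨e₂⟩ := f'.nonempty_equiv_int_prod_ker hf'
  have h1 : ∀ g : f.ker, ((0, (e (0, g)).2) : ℤ × H) = e (0, g) :=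
    fun g => Prod.ext (Eq.symm g.2) rfl
  have h2 : ∀ h : f'.ker, ((0, (e.symm (0, h)).2) : ℤ × G) = e.symm (0, h) :=
    fun h => Prod.ext (Eq.symm h.2) rfl
  let k : f.ker ≃+ f'.ker :=
    { toFun g := ⟨(e (0, g)).2, by
        change (e.symm (0, (e (0, g)).2)).1 = 0
        rw [h1, e.symm_apply_apply]⟩
      invFun h := ⟨(e.symm (0, h)).2, by
        change (e (0, (e.symm (0, h)).2)).1 = 0
        rw [h2, e.apply_symm_apply]⟩
      left_inv g := Subtype.ext (by
        change (e.symm (0, (e (0, g)).2)).2 = g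
        rw [h1, e.symm_apply_apply])
      right_inv h := Subtype.ext (by
        change (e (0, (e.symm (0, h)).2)).2 = h
        rw [h2, e.apply_symm_apply])
      map_add' g g' := Subtype.ext (by
        change (e (0, (g + g' : f.ker))).2 = (e (0, g)).2 + (e (0, g')).2
        rw [← Prod.snd_add, ← map_add]; simp) }
  exact ⟨e₁.trans (((AddEquiv.refl ℤ).prodCongr k).trans e₂.symm)⟩

end IntCancellation

theorem isCancellable_of_isAddCyclic {A : Type*} [AddCommGroup A] (hA : IsTorsionFreeRankOne A)
    (hc : IsAddCyclic A) : IsCancellable.{u} A := by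
  obtain ⟨htf, g₀, hg₀, -⟩ := (isTorsionFreeRankOne_iff A).1 hA
  obtain ⟨g, hg⟩ := hc.exists_zsmul_surjective
  have hg0 : g ≠ 0 := by
    rintro rfl
    obtain ⟨n, hn⟩ := hg g₀
    exact hg₀ (by simpa using hn.symm)
  have e : ℤ ≃+ A := AddEquiv.ofBijective (zmultiplesHom A g) ⟨by
    rw [injective_iff_map_eq_zero]
    intro n hn
    simpa [hg0] using hn, hg⟩
  refine IsCancellable.congr e ?_
  rintro G H _ _ ⟨f⟩
  exact nonempty_equiv_of_int_prod f

/-! ### Glued sums of two rank one groups. -/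

namespace AddSubgroup

variable (A B : AddSubgroup ℚ)

/-- The extension of `A × B` by the multiples of `(u / b, 1 / b)`. -/
def glue (b : ℕ) (u : ℤ) : AddSubgroup (ℚ × ℚ) where
  carrier := {z | ∃ k : ℤ, z.1 - k * u / b ∈ A ∧ z.2 - k / b ∈ B}
  add_mem' := by
    rintro z z' ⟨k, h1, h2⟩ ⟨k', h1', h2'⟩
    refine ⟨k + k', ?_, ?_⟩
    · convert! A.add_mem h1 h1' using 1
      push_cast [Prod.fst_add]; ring
    · convert! B.add_mem h2 h2' using 1
      push_cast [Prod.snd_add]; ring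
  zero_mem' := ⟨0, by simp [A.zero_mem, B.zero_mem]⟩
  neg_mem' := by
    rintro z ⟨k, h1, h2⟩
    refine ⟨-k, ?_, ?_⟩
    · convert! A.neg_mem h1 using 1
      push_cast [Prod.fst_neg]; ring
    · convert! B.neg_mem h2 using 1
      push_cast [Prod.snd_neg]; ring

variable {A B} {b : ℕ} {u : ℤ}

theorem intCast_mul_mem {x : ℚ} (hx : x ∈ A) (n : ℤ) : (n : ℚ) * x ∈ A := by
  rw [← zsmul_eq_mul]; exact A.zsmul_mem hx n

theorem intCast_mem_of_one_mem (h : (1 : ℚ) ∈ A) (n : ℤ) : (n : ℚ) ∈ A := by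
  simpa using intCast_mul_mem h n

theorem mul_mem_of_sub_mem (h : (1 : ℚ) ∈ A) (hb : 0 < b) {x : ℚ} {k : ℤ}
    (hx : x - k / b ∈ A) : b * x ∈ A := by
  have hb' : (b : ℚ) ≠ 0 := by positivity
  have : (b : ℚ) * x = (b : ℤ) * (x - k / b) + k := by push_cast; field_simp; ring
  rw [this]
  exact A.add_mem (intCast_mul_mem hx _) (intCast_mem_of_one_mem h _)

/-- With `X u + Z b = 1`, the integral matrix with rows `(X, b)` and `(-Z, u)` has determinant 1. It
acts on the two coordinates coming from `A`, fixes the one from `B`, and turns the gluing vector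
`(1/b, 1/b)` into `(u/b, 1/b)` up to elements of `A`. -/
theorem nonempty_prod_glue_equiv (hA : (1 : ℚ) ∈ A) (hb : 0 < b) (hu : IsCoprime u b) :
    Nonempty (A × A.glue B b 1 ≃+ A × A.glue B b u) := by
  obtain ⟨X, Z, hXZ⟩ := hu
  have hb' : (b : ℚ) ≠ 0 := by positivity
  have hXZ' : (X : ℚ) * u + Z * b = 1 := by exact_mod_cast hXZ
  refine ⟨{
    toFun := fun p => (⟨X * p.1 + b * p.2.1.1, ?_⟩, ⟨(-Z * p.1 + u * p.2.1.1, p.2.1.2), ?_⟩)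
    invFun := fun p => (⟨u * p.1 - b * p.2.1.1, ?_⟩, ⟨(Z * p.1 + X * p.2.1.1, p.2.1.2), ?_⟩)
    left_inv := ?_
    right_inv := ?_
    map_add' := ?_ }⟩
  · obtain ⟨⟨x, hx⟩, ⟨y, z⟩, k, h1, h2⟩ := p
    refine A.add_mem (intCast_mul_mem hx _) (mul_mem_of_sub_mem (k := k) hA hb ?_)
    simpa using h1
  · obtain ⟨⟨x, hx⟩, ⟨y, z⟩, k, h1, h2⟩ := p
    refine ⟨k, ?_, h2⟩
    convert! A.add_mem (intCast_mul_mem hx (-Z)) (intCast_mul_mem h1 u) using 1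
    push_cast; ring
  · obtain ⟨⟨x, hx⟩, ⟨y, z⟩, k, h1, h2⟩ := p
    refine A.sub_mem (intCast_mul_mem hx _) (mul_mem_of_sub_mem (k := k * u) hA hb ?_)
    simpa using h1
  · obtain ⟨⟨x, hx⟩, ⟨y, z⟩, k, h1, h2⟩ := p
    refine ⟨k, ?_, h2⟩
    convert! A.sub_mem (A.add_mem (intCast_mul_mem hx Z) (intCast_mul_mem h1 X))
      (intCast_mem_of_one_mem hA (k * Z)) using 1
    push_cast
    field_simp
    linear_combination (k : ℚ) * hXZ'
  · rintro ⟨⟨x, hx⟩, ⟨⟨y, z⟩, h⟩⟩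
    refine Prod.ext (Subtype.ext ?_) (Subtype.ext (Prod.ext ?_ rfl))
    · change u * (X * x + b * y) - b * (-Z * x + u * y) = x
      linear_combination x * hXZ'
    · change Z * (X * x + b * y) + X * (-Z * x + u * y) = y
      linear_combination y * hXZ'
  · rintro ⟨⟨x, hx⟩, ⟨⟨y, z⟩, h⟩⟩
    refine Prod.ext (Subtype.ext ?_) (Subtype.ext (Prod.ext ?_ rfl))
    · change X * (u * x - b * y) + b * (Z * x + X * y) = x
      linear_combination x * hXZ'
    · change -Z * (u * x - b * y) + u * (Z * x + X * y) = y
      linear_combination y * hXZ'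
  · rintro ⟨⟨x, hx⟩, ⟨⟨y, z⟩, h⟩⟩ ⟨⟨x', hx'⟩, ⟨⟨y', z'⟩, h'⟩⟩
    refine Prod.ext (Subtype.ext ?_) (Subtype.ext (Prod.ext ?_ rfl))
    · change X * (x + x') + b * (y + y') = X * x + b * y + (X * x' + b * y')
      ring
    · change -Z * (x + x') + u * (y + y') = -Z * x + u * y + (-Z * x' + u * y')
      ring

/-- If there are no nonzero homomorphisms between `A` and `B`, then the homomorphisms between
two extensions of `A × B` are diagonal. -/
theorem glue_hom_eq_diagonal (hA : (1 : ℚ) ∈ A) (hB : (1 : ℚ) ∈ B) (hb : 0 < b)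
    (hAb : ∀ k : ℤ, (k : ℚ) / b ∈ A → (b : ℤ) ∣ k) (hBb : ∀ k : ℤ, (k : ℚ) / b ∈ B → (b : ℤ) ∣ k)
    (hAB : ∀ c : ℚ, (∀ x ∈ A, c * x ∈ B) → c = 0) (hBA : ∀ c : ℚ, (∀ x ∈ B, c * x ∈ A) → c = 0)
    {v : ℤ} (hv : IsCoprime v b) (f : A.glue B b u →+ A.glue B b v) :
    ∃ α ∈ A.multipliers, ∃ β ∈ B.multipliers, ∀ z : A.glue B b u,
      (f z : ℚ × ℚ) = (α * z.1.1, β * z.1.2) := by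
  have hb' : (b : ℚ) ≠ 0 := by positivity
  have hbz : (b : ℤ) ≠ 0 := by positivity
  have mA : ∀ x ∈ A, (x, (0 : ℚ)) ∈ A.glue B b u := fun x hx => ⟨0, by simpa using hx, by simp⟩
  have mB : ∀ x ∈ B, ((0 : ℚ), x) ∈ A.glue B b u := fun x hx => ⟨0, by simp, by simpa using hx⟩
  obtain ⟨α, γ, hp⟩ : ∃ α γ, (f ⟨_, mA 1 hA⟩ : ℚ × ℚ) = (α, γ) := ⟨_, _, rfl⟩
  obtain ⟨δ, β, hq⟩ : ∃ δ β, (f ⟨_, mB 1 hB⟩ : ℚ × ℚ) = (δ, β) := ⟨_, _, rfl⟩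
  -- Clearing denominators shows that `f` is given by a rational matrix, whose columns are the
  -- images of `(1, 0)` and `(0, 1)`.
  have key : ∀ z : A.glue B b u, (f z : ℚ × ℚ) =
      (α * z.1.1 + δ * z.1.2, γ * z.1.1 + β * z.1.2) := by
    rintro ⟨⟨x, y⟩, hz⟩
    have h : (x.den * y.den) • (⟨(x, y), hz⟩ : A.glue B b u) =
        (x.num * y.den) • ⟨_, mA 1 hA⟩ + (y.num * x.den) • ⟨_, mB 1 hB⟩ := by
      apply Subtype.ext
      have h1 : (x.den : ℚ) * x = x.num := Rat.den_mul_eq_num x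
      have h2 : (y.den : ℚ) * y = y.num := Rat.den_mul_eq_num y
      simp only [coe_nsmul, coe_add, coe_zsmul, Prod.smul_mk, Prod.mk_add_mk, nsmul_eq_mul,
        zsmul_eq_mul, mul_one, mul_zero, add_zero, zero_add, Int.cast_mul, Int.cast_natCast,
        Nat.cast_mul, ← h1, ← h2]
      exact Prod.ext (by ring) (by ring)
    have h' := congrArg (fun z => (f z : ℚ × ℚ)) h
    have hx : (x.den : ℚ) ≠ 0 := by simp
    have hy : (y.den : ℚ) ≠ 0 := by simp
    have h1 : (x.den : ℚ) * x = x.num := Rat.den_mul_eq_num x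
    have h2 : (y.den : ℚ) * y = y.num := Rat.den_mul_eq_num y
    simp only [map_nsmul, map_add, map_zsmul, coe_nsmul, coe_add, coe_zsmul, hp, hq] at h'
    generalize (f ⟨(x, y), hz⟩ : ℚ × ℚ) = w at h' ⊢
    obtain ⟨w₁, w₂⟩ := w
    have e1 := congrArg Prod.fst h'
    have e2 := congrArg Prod.snd h'
    simp only [Prod.smul_mk, Prod.mk_add_mk, nsmul_eq_mul,
      zsmul_eq_mul, Int.cast_mul, Int.cast_natCast, Nat.cast_mul, ← h1, ← h2] at e1 e2
    refine Prod.ext (mul_left_cancel₀ (mul_ne_zero hx hy) ?_)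
      (mul_left_cancel₀ (mul_ne_zero hx hy) ?_)
    · rw [e1]; ring
    · rw [e2]; ring
  -- Multiplication by `b` carries second coordinates of the glued group into `B`, so `b * γ` maps
  -- `A` into `B`.
  have hγ : γ = 0 := by
    have : (b : ℚ) * γ = 0 := hAB _ fun x hx => by
      obtain ⟨k, -, h2⟩ := (f ⟨_, mA x hx⟩).2
      rw [key] at h2
      have := mul_mem_of_sub_mem hB hb h2
      simpa [mul_assoc] using this
    simpa [hb'] using this
  have hδ : δ = 0 := by
    have : (b : ℚ) * δ = 0 := hBA _ fun x hx => by
      obtain ⟨k, h1, -⟩ := (f ⟨_, mB x hx⟩).2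
      rw [key] at h1
      have := mul_mem_of_sub_mem (k := k * v) hA hb (by simpa using h1)
      simpa [mul_assoc] using this
    simpa [hb'] using this
  refine ⟨α, fun x hx => ?_, β, fun x hx => ?_, fun z => by rw [key, hγ, hδ]; simp⟩
  · obtain ⟨k, h1, h2⟩ := (f ⟨_, mA x hx⟩).2
    rw [key] at h1 h2
    -- The second coordinate is 0, so `k / b` lies in `B`. Hence `b` divides `k`, and the correction
    -- `k * v / b` is an integer, which `A` contains.
    obtain ⟨l, rfl⟩ : (b : ℤ) ∣ k := by
      rw [← dvd_neg]
      apply hBb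
      simpa [hγ, neg_div] using h2
    have := A.add_mem h1 (intCast_mem_of_one_mem hA (l * v))
    convert! this using 1
    push_cast
    field_simp
    simp
  · obtain ⟨k, h1, h2⟩ := (f ⟨_, mB x hx⟩).2
    rw [key] at h1 h2
    obtain ⟨l, rfl⟩ : (b : ℤ) ∣ k := by
      refine hv.symm.dvd_of_dvd_mul_right ?_
      rw [← dvd_neg]
      apply hAb
      simpa [hδ, neg_div] using h1
    have := B.add_mem h2 (intCast_mem_of_one_mem hB l)
    convert! this using 1
    push_cast
    field_simp
    simp

/-- The isomorphism and its inverse are diagonal, so both entries `α, β` are units, and `β = ±1`.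
The image `(α/b, β/b)` of the gluing vector is congruent to some `k(u/b, 1/b)`. The second
coordinate gives `k ≡ β` modulo `b`, and the first then gives `α ≡ βu`. -/
theorem exists_unit_of_glue_equiv (hA : (1 : ℚ) ∈ A) (hB : (1 : ℚ) ∈ B) (hb : 0 < b)
    (hAb : ∀ k : ℤ, (k : ℚ) / b ∈ A → (b : ℤ) ∣ k) (hBb : ∀ k : ℤ, (k : ℚ) / b ∈ B → (b : ℤ) ∣ k)
    (hAB : ∀ c : ℚ, (∀ x ∈ A, c * x ∈ B) → c = 0) (hBA : ∀ c : ℚ, (∀ x ∈ B, c * x ∈ A) → c = 0)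
    (hBu : ∀ c ∈ B.multipliers, c⁻¹ ∈ B.multipliers → c ≠ 0 → c = 1 ∨ c = -1)
    (hu : IsCoprime u b) (e : A.glue B b 1 ≃+ A.glue B b u) :
    ∃ c ∈ A.multipliers, c⁻¹ ∈ A.multipliers ∧ c ≠ 0 ∧
      ((c - u) / b ∈ A ∨ (c + u) / b ∈ A) := by
  obtain ⟨α, hα, β, hβ, h⟩ := glue_hom_eq_diagonal hA hB hb hAb hBb hAB hBA hu e.toAddMonoidHom
  obtain ⟨α', hα', β', hβ', h'⟩ := glue_hom_eq_diagonal (v := 1) hA hB hb hAb hBb hAB hBA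
    isCoprime_one_left e.symm.toAddMonoidHom
  have hb' : (b : ℚ) ≠ 0 := by positivity
  have m1 : ((1 : ℚ), (1 : ℚ)) ∈ A.glue B b 1 := ⟨0, by simpa using hA, by simpa using hB⟩
  have hinv := h' (e ⟨_, m1⟩)
  have h1 := h ⟨_, m1⟩
  simp only [AddEquiv.toAddMonoidHom_eq_coe, AddMonoidHom.coe_coe, AddEquiv.symm_apply_apply]
    at hinv h1
  rw [h1] at hinv
  have hαα : α' * α = 1 := by simpa using (congrArg Prod.fst hinv).symm
  have hββ : β' * β = 1 := by simpa using (congrArg Prod.snd hinv).symm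
  have hα0 : α ≠ 0 := right_ne_zero_of_mul_eq_one hαα
  have hβ0 : β ≠ 0 := right_ne_zero_of_mul_eq_one hββ
  refine ⟨α, hα, by rwa [inv_eq_of_mul_eq_one_left hαα], hα0, ?_⟩
  have m2 : ((1 : ℚ) / b, (1 : ℚ) / b) ∈ A.glue B b 1 := ⟨1, by simp, by simp⟩
  obtain ⟨k, h3, h4⟩ := (e ⟨_, m2⟩).2
  have h2 := h ⟨_, m2⟩
  simp only [AddEquiv.toAddMonoidHom_eq_coe, AddMonoidHom.coe_coe] at h2
  rw [h2] at h3 h4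
  have step : ∀ ε : ℤ, β = ε → (α - ε * u) / b ∈ A := by
    rintro ε rfl
    obtain ⟨j, hj⟩ := hBb (ε - k) (by convert! h4 using 1; push_cast; ring)
    have hj' : (ε : ℚ) - k = b * j := by exact_mod_cast hj
    convert! A.sub_mem h3 (intCast_mem_of_one_mem hA (j * u)) using 1
    push_cast
    field_simp
    linear_combination (-u : ℚ) * hj'
  rcases hBu β hβ (by rwa [inv_eq_of_mul_eq_one_left hββ]) hβ0 with h5 | h5
  · left; simpa using step 1 (by simpa using h5)
  · right; simpa using step (-1) (by simpa using h5)

end AddSubgroup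

/-! ### Construction of noncancellable pairs for noncyclic groups whose units do not lift. -/

namespace AddSubgroup

/-- The rational numbers whose denominator divides a product of prime powers `p ^ e p` with
`p ∈ J`. -/
def withDenominators (J : Set ℕ) (e : ℕ → ℕ) : AddSubgroup ℚ where
  carrier := {x | ∃ F : Finset ℕ, ↑F ⊆ J ∧ ∃ a : ℤ, ((∏ p ∈ F, p ^ e p : ℕ) : ℚ) * x = a}
  add_mem' := by
    classical
    rintro x y ⟨F, hF, a, ha⟩ ⟨F', hF', a', ha'⟩
    obtain ⟨c, hc⟩ := Finset.prod_dvd_prod_of_subset F (F ∪ F') (fun p => p ^ e p)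
      Finset.subset_union_left
    obtain ⟨c', hc'⟩ := Finset.prod_dvd_prod_of_subset F' (F ∪ F') (fun p => p ^ e p)
      Finset.subset_union_right
    refine ⟨F ∪ F', by simp [hF, hF'], a * c + a' * c', ?_⟩
    rw [mul_add]
    nth_rw 1 [hc]
    rw [hc']
    push_cast at ha ha' ⊢
    rw [← ha, ← ha']
    ring
  zero_mem' := ⟨∅, by simp, 0, by simp⟩
  neg_mem' := by
    rintro x ⟨F, hF, a, ha⟩
    exact ⟨F, hF, -a, by rw [mul_neg, ha]; simp⟩

variable {J : Set ℕ} {e : ℕ → ℕ}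

theorem one_mem_withDenominators : (1 : ℚ) ∈ withDenominators J e :=
  ⟨∅, by simp, 1, by simp⟩

theorem inv_pow_mem_withDenominators {p : ℕ} (hp : p ∈ J) (hp0 : p ≠ 0) :
    ((p : ℚ) ^ e p)⁻¹ ∈ withDenominators J e :=
  ⟨{p}, by simpa using hp, 1, by simp [hp0]⟩

theorem dvd_of_div_mem_withDenominators {n : ℕ} (hn : 0 < n) (hJ : ∀ p ∈ J, p.Coprime n) {k : ℤ}
    (h : (k : ℚ) / n ∈ withDenominators J e) : (n : ℤ) ∣ k := by
  obtain ⟨F, hF, a, ha⟩ := h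
  have hn' : (n : ℚ) ≠ 0 := by positivity
  rw [← mul_div_assoc, div_eq_iff hn'] at ha
  have ha' : ((∏ p ∈ F, p ^ e p : ℕ) : ℤ) * k = a * n := by exact_mod_cast ha
  have hc : Nat.Coprime n (∏ p ∈ F, p ^ e p) :=
    Nat.Coprime.prod_right fun p hp => ((hJ p (hF hp)).symm).pow_right _
  exact (Nat.isCoprime_iff_coprime.2 hc).dvd_of_dvd_mul_left ⟨a, by rw [ha']; ring⟩

theorem inv_pow_notMem_withDenominators (hJ : ∀ p ∈ J, p.Prime) {p m : ℕ} (hp : p.Prime)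
    (hm : e p < m) : ((p : ℚ) ^ m)⁻¹ ∉ withDenominators J e := by
  rintro ⟨F, hF, a, ha⟩
  have hp' : ((p : ℚ) ^ m) ≠ 0 := by have := hp.ne_zero; positivity
  rw [← div_eq_mul_inv, div_eq_iff hp'] at ha
  have hd : p ^ m ∣ ∏ q ∈ F, q ^ e q := by
    rw [← Int.natCast_dvd_natCast]
    exact ⟨a, by push_cast; rw [mul_comm]; exact_mod_cast ha⟩
  classical
  have hd' : p ^ m ∣ p ^ e p * ∏ q ∈ F.erase p, q ^ e q := by
    by_cases hpF : p ∈ F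
    · rwa [Finset.mul_prod_erase F (fun q => q ^ e q) hpF]
    · rw [Finset.erase_eq_of_notMem hpF]; exact hd.mul_left _
  have hc : Nat.Coprime (p ^ m) (∏ q ∈ F.erase p, q ^ e q) := by
    refine Nat.Coprime.prod_right fun q hq => Nat.Coprime.pow _ _ ?_
    rw [Finset.mem_erase] at hq
    exact (Nat.coprime_primes hp (hJ q (hF hq.2))).2 hq.1.symm
  have := (Nat.pow_dvd_pow_iff_le_right hp.one_lt).1 (hc.dvd_of_dvd_mul_right hd')
  omega

/-- Since 1 has finite height at every prime, no prime is inverted by a multiplier. Multipliers are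
therefore integers. -/
theorem unit_multipliers_withDenominators (hJ : ∀ p ∈ J, p.Prime) {c : ℚ}
    (hc : c ∈ (withDenominators J e).multipliers) (hc' : c⁻¹ ∈ (withDenominators J e).multipliers)
    (hc0 : c ≠ 0) : c = 1 ∨ c = -1 := by
  have hden : ∀ c ∈ (withDenominators J e).multipliers, c.den = 1 := by
    intro c hc
    by_contra hne
    obtain ⟨p, hp, hpd⟩ := Nat.exists_prime_and_dvd hne
    have h := inv_mem_multipliers_of_dvd c.den_pos hpd (inv_den_mem_multipliers hc)
    have := pow_mem h (e p + 1) 1 one_mem_withDenominators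
    rw [mul_one, inv_pow] at this
    exact inv_pow_notMem_withDenominators hJ hp (Nat.lt_succ_self _) this
  have h1 := hden c hc
  have h2 := hden _ hc'
  have h3 : c.num.natAbs = 1 := by
    rw [Rat.den_inv_of_ne_zero hc0] at h2
    exact h2
  have h4 : (c.num : ℚ) = c := Rat.coe_int_num_of_den_eq_one h1
  rcases Int.natAbs_eq_iff.1 h3 with h | h
  · left; rw [← h4, h]; simp
  · right; rw [← h4, h]; simp

variable {A : AddSubgroup ℚ}

theorem isAddCyclic_of_forall_mul (M : ℕ) (hM : 0 < M) (h : ∀ x ∈ A, ∃ a : ℤ, (M : ℚ) * x = a) :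
    IsAddCyclic A := by
  have hM' : (M : ℚ) ≠ 0 := by positivity
  choose f hf using h
  let φ : A →+ ℤ := AddMonoidHom.mk' (fun x => f x x.2) (by
    intro x y
    have : (f (x + y : A) (x + y).2 : ℚ) = f x x.2 + f y y.2 := by
      rw [← hf, ← hf, ← hf]; simp [mul_add]
    exact_mod_cast this)
  refine isAddCyclic_of_injective φ ?_
  intro x y hxy
  have : (M : ℚ) * x = M * y := by rw [hf x x.2, hf y y.2]; exact_mod_cast hxy
  exact Subtype.ext (mul_left_cancel₀ hM' this)

theorem inv_den_mem (h1 : (1 : ℚ) ∈ A) {x : ℚ} (hx : x ∈ A) : (x.den : ℚ)⁻¹ ∈ A := by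
  obtain ⟨a, c, hac⟩ : IsCoprime x.num (x.den : ℤ) := Int.isCoprime_iff_nat_coprime.2 x.reduced
  have hd : (x.den : ℚ) ≠ 0 := by simp
  have h2 : (x.den : ℚ) * x = x.num := Rat.den_mul_eq_num x
  have h3 : (a : ℚ) * x.num + c * x.den = 1 := by exact_mod_cast hac
  have : (x.den : ℚ)⁻¹ = a * x + c := by
    field_simp
    linear_combination -h3 - a * h2
  rw [this]
  exact A.add_mem (intCast_mul_mem hx _) (intCast_mem_of_one_mem h1 _)

theorem inv_mem_of_dvd {m n : ℕ} (hn : 0 < n) (hmn : m ∣ n) (h : (n : ℚ)⁻¹ ∈ A) :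
    (m : ℚ)⁻¹ ∈ A := by
  obtain ⟨k, rfl⟩ := hmn
  have hm : (m : ℚ) ≠ 0 := by rintro h0; simp_all
  have hk : (k : ℚ) ≠ 0 := by rintro h0; simp_all
  have : (m : ℚ)⁻¹ = (k : ℤ) * ((m * k : ℕ) : ℚ)⁻¹ := by push_cast; field_simp
  rw [this]
  exact intCast_mul_mem h k

/-- The construction of a noncancellable pair from primes `J` on which `A` has finite heights and
infinitely many denominators of `A` prime to `J`. -/
theorem not_isCancellable_of_infinite (h1 : (1 : ℚ) ∈ A) {b u : ℕ} (hb : 0 < b)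
    (hu : u.Coprime b) (hAb : ∀ k : ℤ, (k : ℚ) / b ∈ A → (b : ℤ) ∣ k)
    (hno : ¬ ∃ v w, 0 < v ∧ 0 < w ∧ DivBy A v ∧ DivBy A w ∧ (v ≡ u * w [MOD b] ∨ b ∣ v + u * w))
    (hJ : ∀ p ∈ J, p.Prime ∧ ¬ p ∣ b) (hinf : J.Infinite)
    (he : ∀ p ∈ J, ((p : ℚ) ^ e p)⁻¹ ∉ A)
    (hD : {n : ℕ | 0 < n ∧ (n : ℚ)⁻¹ ∈ A ∧ ∀ p ∈ J, p.Coprime n}.Infinite) :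
    ¬ IsCancellable.{u} A := by
  intro hcan
  set B := withDenominators J e with hBdef
  have hu' : IsCoprime (u : ℤ) (b : ℤ) := Nat.isCoprime_iff_coprime.2 hu
  obtain ⟨E⟩ := nonempty_prod_glue_equiv (B := B) h1 hb hu'
  -- The lift moves the two groups into the universe over which cancellability quantifies.
  obtain ⟨E'⟩ := hcan (ULift.{u} (A.glue B b 1)) (ULift.{u} (A.glue B b u))
    ⟨((AddEquiv.refl A).prodCongr AddEquiv.ulift).trans
      (E.trans ((AddEquiv.refl A).prodCongr AddEquiv.ulift.symm))⟩
  -- Each of the infinitely many denominators `n` of `A` prime to `J` would divide the numerator of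
  -- `c`.
  have hAB : ∀ c : ℚ, (∀ x ∈ A, c * x ∈ B) → c = 0 := by
    intro c hc
    by_contra hc0
    refine hD ((Set.finite_le_nat c.num.natAbs).subset ?_)
    rintro n ⟨hn, hnA, hnJ⟩
    have h2 : (c.num : ℚ) / n ∈ B := by
      have := intCast_mul_mem (hc _ hnA) c.den
      rw [← mul_assoc] at this
      simpa [Rat.den_mul_eq_num, div_eq_mul_inv] using this
    have h3 := dvd_of_div_mem_withDenominators hn hnJ h2
    exact Nat.le_of_dvd (Int.natAbs_pos.2 (Rat.num_ne_zero.2 hc0)) (Int.natCast_dvd.1 h3)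
  -- For a prime `p` in `J` not dividing the numerator of `c`, the map would give 1 height at least
  -- `e p` at `p` in `A`.
  have hBA : ∀ c : ℚ, (∀ x ∈ B, c * x ∈ A) → c = 0 := by
    intro c hc
    by_contra hc0
    obtain ⟨p, hp, hpc⟩ := hinf.exists_notMem_finset (Finset.range (c.num.natAbs + 1))
    have hpp := (hJ p hp).1
    have hnd : ¬ p ∣ c.num.natAbs := fun h => hpc (Finset.mem_range.2
      (Nat.lt_succ_of_le (Nat.le_of_dvd (Int.natAbs_pos.2 (Rat.num_ne_zero.2 hc0)) h)))
    obtain ⟨x, y, hxy⟩ : IsCoprime c.num ((p ^ e p : ℕ) : ℤ) :=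
      Int.isCoprime_iff_nat_coprime.2 (((hpp.coprime_iff_not_dvd.2 hnd).symm).pow_right _)
    have h2 := intCast_mul_mem (hc _ (inv_pow_mem_withDenominators hp hpp.ne_zero)) (x * c.den)
    have h3 := A.add_mem h2 (intCast_mem_of_one_mem h1 y)
    refine he p hp ?_
    convert! h3 using 1
    have h4 : (c.den : ℚ) * c = c.num := Rat.den_mul_eq_num c
    have h5 : ((p : ℚ) ^ e p) ≠ 0 := by have := hpp.ne_zero; positivity
    have h6 : (x : ℚ) * c.num + y * (p : ℚ) ^ e p = 1 := by exact_mod_cast hxy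
    push_cast
    field_simp
    linear_combination -h6 - x * h4
  obtain ⟨c, hc, hc', hc0, hcu⟩ := exists_unit_of_glue_equiv h1 one_mem_withDenominators hb hAb
    (fun k => dvd_of_div_mem_withDenominators hb fun p hp =>
      (hJ p hp).1.coprime_iff_not_dvd.2 (hJ p hp).2) hAB hBA
    (fun c => unit_multipliers_withDenominators fun p hp => (hJ p hp).1) hu'
    ((AddEquiv.ulift.symm.trans E').trans AddEquiv.ulift)
  have hd := inv_den_mem_multipliers hc
  have hn := inv_den_mem_multipliers hc'
  rw [Rat.den_inv_of_ne_zero hc0] at hn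
  have hn0 : 0 < c.num.natAbs := Int.natAbs_pos.2 (Rat.num_ne_zero.2 hc0)
  -- The unit is, up to sign, the quotient of these two numbers, and both act invertibly because the
  -- inverse of a unit is again a multiplier.
  refine hno ⟨c.num.natAbs, c.den, hn0, c.den_pos,
    (divBy_iff_inv_mem hn0).2 hn, (divBy_iff_inv_mem c.den_pos).2 hd, ?_⟩
  have h4 : (c.den : ℚ) * c = c.num := Rat.den_mul_eq_num c
  have h5 : (b : ℤ) ∣ c.num - u * c.den ∨ (b : ℤ) ∣ c.num + u * c.den := by
    rcases hcu with h | h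
    · left
      apply hAb
      convert! intCast_mul_mem h c.den using 1
      push_cast; rw [← h4]; ring
    · right
      apply hAb
      convert! intCast_mul_mem h c.den using 1
      push_cast; rw [← h4]; ring
  rw [Nat.modEq_iff_dvd, ← Int.natCast_dvd_natCast]
  push_cast
  rcases abs_choice c.num with h6 | h6 <;> rw [h6]
  · exact h5.imp (fun h => by rw [← dvd_neg]; convert! h using 1; ring) id
  · exact h5.symm.imp (fun h => by convert! h using 1; ring)
      (fun h => by rw [← dvd_neg]; convert! h using 1; ring)

theorem inv_mem_of_forall_prime (R : Subring ℚ) {v : ℕ} (hv : 0 < v)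
    (h : ∀ p, p.Prime → p ∣ v → (p : ℚ)⁻¹ ∈ R) : (v : ℚ)⁻¹ ∈ R := by
  obtain ⟨c, b, rfl, hc, hb⟩ := exists_eq_unit_mul R v hv
  have hb1 : b = 1 := by
    by_contra hne
    obtain ⟨p, hp, hpb⟩ := Nat.exists_prime_and_dvd hne
    exact hb p hp.one_lt hpb (h p hp (hpb.mul_left c))
  simpa [hb1] using hc

/-- It remains to find the primes `J` on which `B` is built. If some `p` is invertible, its powers
are denominators of `A`, and `J` may consist of all noninvertible primes not dividing `b`. If none
is, then `A`, not being cyclic, has infinitely many primes as denominators, and these are divided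
between `J` and the required denominators prime to `J`. -/
theorem not_isCancellable (h1 : (1 : ℚ) ∈ A) (hcyc : ¬ IsAddCyclic A) {b u : ℕ} (hb : 0 < b)
    (hu : u.Coprime b) (hAb : ∀ k : ℤ, (k : ℚ) / b ∈ A → (b : ℤ) ∣ k)
    (hno : ¬ ∃ v w, 0 < v ∧ 0 < w ∧ DivBy A v ∧ DivBy A w ∧
      (v ≡ u * w [MOD b] ∨ b ∣ v + u * w)) : ¬ IsCancellable.{u} A := by
  -- In rank one, infinite height of 1 at `p` makes every element divisible by `p`: split the
  -- denominator of `x` into its `p`-part and the rest, and apply Bézout.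
  have hheight : ∀ p : ℕ, p.Prime → (p : ℚ)⁻¹ ∉ A.multipliers → ∃ m, ((p : ℚ) ^ m)⁻¹ ∉ A := by
    intro p hp hpA
    by_contra! hall
    refine hpA fun x hx => ?_
    obtain ⟨m, d, hd, hxd⟩ := Nat.exists_eq_pow_mul_and_not_dvd (n := x.den) x.den_nz p hp.ne_one
    have hd0 : (d : ℚ) ≠ 0 := by rintro h0; simp_all
    have hp0 : (p : ℚ) ≠ 0 := by exact_mod_cast hp.ne_zero
    have hxden : (x.den : ℚ) = p ^ m * d := by exact_mod_cast hxd
    have hdA : (d : ℚ)⁻¹ ∈ A :=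
      inv_mem_of_dvd x.den_pos ⟨p ^ m, by rw [hxd]; ring⟩ (inv_den_mem h1 hx)
    have hpA := hall (m + 1)
    obtain ⟨r, s, hrs⟩ : IsCoprime ((p ^ (m + 1) : ℕ) : ℤ) (d : ℤ) :=
      Nat.isCoprime_iff_coprime.2 ((hp.coprime_iff_not_dvd.2 hd).pow_left _)
    have hrs' : (r : ℚ) * p ^ (m + 1) + s * d = 1 := by exact_mod_cast hrs
    have h2 := A.add_mem (intCast_mul_mem hdA (x.num * r)) (intCast_mul_mem hpA (x.num * s))
    convert! h2 using 1
    have hx' : x = x.num / (p ^ m * d) := by rw [← hxden, Rat.num_div_den]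
    conv_lhs => rw [hx']
    push_cast
    field_simp
    linear_combination (-(x.num : ℚ) * p * p ^ m) * hrs'
  -- If these primes were finite in number, a number congruent to `u` modulo `b` and to 1 modulo
  -- their product would have invertible prime factors only, and would lift `u`.
  have hmany : {p : ℕ | p.Prime ∧ (p : ℚ)⁻¹ ∉ A.multipliers ∧ ¬ p ∣ b}.Infinite := by
    intro hfin
    set N := ∏ p ∈ hfin.toFinset, p with hN
    have hmem : ∀ p, p ∈ hfin.toFinset ↔ p.Prime ∧ (p : ℚ)⁻¹ ∉ A.multipliers ∧ ¬ p ∣ b :=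
      fun p => hfin.mem_toFinset
    have hc : b.Coprime N := Nat.Coprime.prod_right fun p hp =>
      (((hmem p).1 hp).1.coprime_iff_not_dvd.2 ((hmem p).1 hp).2.2).symm
    have hN0 : N ≠ 0 := Finset.prod_ne_zero_iff.2 fun p hp => ((hmem p).1 hp).1.ne_zero
    obtain ⟨v₀, hv1, hv2⟩ := Nat.chineseRemainder hc u 1
    -- Adding `b * N` keeps both residues and makes the number positive.
    set v := v₀ + b * N with hv
    have hbN : 0 < b * N := Nat.mul_pos hb (Nat.pos_of_ne_zero hN0)
    have hv1' : v ≡ u [MOD b] := by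
      have : v ≡ v₀ [MOD b] := by simp [hv, Nat.ModEq]
      exact this.trans hv1
    have hv2' : v ≡ 1 [MOD N] := by
      have : v ≡ v₀ [MOD N] := by simp [hv, Nat.ModEq]
      exact this.trans hv2
    refine hno ⟨v, 1, by omega, one_pos, (divBy_iff_inv_mem (by omega)).2 ?_,
      (divBy_iff_inv_mem one_pos).2 (by simp), .inl (by simpa using hv1')⟩
    refine inv_mem_of_forall_prime _ (by omega) fun p hp hpv => ?_
    by_contra hpA
    by_cases hpb : p ∣ b
    · have h2 : p ∣ u := (hv1'.dvd_iff hpb).1 hpv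
      have h3 := Nat.dvd_gcd h2 hpb
      rw [hu] at h3
      exact hp.one_lt.ne' (Nat.dvd_one.1 h3)
    · have h2 : p ∣ N := Finset.dvd_prod_of_mem _ ((hmem p).2 ⟨hp, hpA, hpb⟩)
      exact hp.one_lt.ne' (Nat.dvd_one.1 ((hv2'.dvd_iff h2).1 hpv))
  choose! e he using hheight
  by_cases hP : ∃ p : ℕ, p.Prime ∧ (p : ℚ)⁻¹ ∈ A.multipliers
  · obtain ⟨p, hp, hpA⟩ := hP
    refine not_isCancellable_of_infinite (e := e) h1 hb hu hAb hno (fun q hq => ⟨hq.1, hq.2.2⟩)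
      hmany (fun q hq => he q hq.1 hq.2.1) ?_
    refine Set.infinite_of_injective_forall_mem (f := fun m : ℕ => p ^ m)
      (Nat.pow_right_injective hp.two_le) fun m => ⟨pow_pos hp.pos _, ?_, fun q hq => ?_⟩
    · have := pow_mem hpA m 1 h1
      simpa using this
    · refine Nat.Coprime.pow_right _ ((Nat.coprime_primes hq.1 hp).2 ?_)
      rintro rfl
      exact hq.2.1 hpA
  · push Not at hP
    -- Finitely many prime denominators, all of finite height, would bound the denominators of `A`
    -- by a common `M` and make `A` cyclic.
    have hT : {p : ℕ | p.Prime ∧ (p : ℚ)⁻¹ ∈ A ∧ ¬ p ∣ b}.Infinite := by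
      intro hfin
      have hfin' : {p : ℕ | p.Prime ∧ (p : ℚ)⁻¹ ∈ A}.Finite := by
        refine (hfin.union b.divisors.finite_toSet).subset ?_
        rintro p ⟨hp, hpA⟩
        by_cases hpb : p ∣ b
        · right; simp [hpb, hb.ne']
        · exact .inl ⟨hp, hpA, hpb⟩
      set M := ∏ p ∈ hfin'.toFinset, p ^ e p with hM
      have hM0 : 0 < M := Finset.prod_pos fun p hp =>
        pow_pos (hfin'.mem_toFinset.1 hp).1.pos _
      refine hcyc (isAddCyclic_of_forall_mul M hM0 fun x hx => ?_)
      have hdvd : x.den ∣ M := by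
        rw [← Nat.factorization_prime_le_iff_dvd x.den_nz hM0.ne']
        intro p hp
        have hxA := inv_den_mem h1 hx
        have hlt : x.den.factorization p ≤ e p := by
          by_contra! hlt
          have h2 : p ^ e p ∣ x.den := (pow_dvd_pow p hlt.le).trans (Nat.ordProj_dvd x.den p)
          have := inv_mem_of_dvd x.den_pos h2 hxA
          exact he p hp (hP p hp) (by simpa using this)
        rcases Nat.eq_zero_or_pos (x.den.factorization p) with h0 | hpos
        · rw [h0]; exact Nat.zero_le _
        · have hpx : p ∣ x.den := Nat.dvd_of_factorization_pos hpos.ne'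
          have hpm : p ∈ hfin'.toFinset :=
            hfin'.mem_toFinset.2 ⟨hp, inv_mem_of_dvd x.den_pos hpx hxA⟩
          have h3 : p ^ e p ∣ M := Finset.dvd_prod_of_mem (fun p => p ^ e p) hpm
          exact hlt.trans ((hp.pow_dvd_iff_le_factorization hM0.ne').1 h3)
      obtain ⟨c, hc⟩ := hdvd
      refine ⟨c * x.num, ?_⟩
      rw [hc]; push_cast
      rw [← Rat.den_mul_eq_num x]; ring
    obtain ⟨J, K, hJK, hdis, hcard⟩ := Set.Infinite.exists_union_disjoint_cardinal_eq_of_infinite hT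
    have hboth : J.Infinite ∧ K.Infinite := by
      have h2 : J.Infinite ↔ K.Infinite := by
        rw [← Set.infinite_coe_iff, ← Set.infinite_coe_iff, Cardinal.infinite_iff,
          Cardinal.infinite_iff, hcard]
      rw [← hJK, Set.infinite_union] at hT
      tauto
    have hsub : ∀ p, p ∈ J ∨ p ∈ K → p.Prime ∧ (p : ℚ)⁻¹ ∈ A ∧ ¬ p ∣ b :=
      fun p hp => by rw [← Set.mem_union, hJK] at hp; exact hp
    refine not_isCancellable_of_infinite (e := e) h1 hb hu hAb hno
      (fun q hq => ⟨(hsub q (.inl hq)).1, (hsub q (.inl hq)).2.2⟩) hboth.1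
      (fun q hq => he q (hsub q (.inl hq)).1 (hP q (hsub q (.inl hq)).1)) ?_
    refine hboth.2.mono fun n hn => ?_
    obtain ⟨hn1, hn2, -⟩ := hsub n (.inr hn)
    refine ⟨hn1.pos, hn2, fun p hp => (Nat.coprime_primes (hsub p (.inl hp)).1 hn1).2 ?_⟩
    rintro rfl
    exact Set.disjoint_left.1 hdis hp hn

end AddSubgroup

/-! ### The algebraic characterization of cancellability. -/

/-- Such a `g` serves as the element sent to 1 in ℚ: then the inverses of the primes in `s` do not
lie in the image. -/
theorem exists_notMem_prime_multiples {A : Type*} [AddCommGroup A] (s : Finset ℕ)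
    (hs : ∀ p ∈ s, p.Prime ∧ ¬ DivBy A p) : ∃ g : A, ∀ p ∈ s, ∀ y : A, p • y ≠ g := by
  classical
  induction s using Finset.induction_on with
  | empty => exact ⟨0, by simp⟩
  | insert q s hq ih =>
    obtain ⟨g, hg⟩ := ih fun p hp => hs p (Finset.mem_insert_of_mem hp)
    obtain ⟨hqp, hqd⟩ := hs q (Finset.mem_insert_self q s)
    by_cases hgq : ∃ y : A, q • y = g
    · obtain ⟨y, rfl⟩ := hgq
      unfold DivBy at hqd
      push Not at hqd
      obtain ⟨x, hx⟩ := hqd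
      set M := ∏ p ∈ s, p with hM
      -- The summand `M • x` is divisible by all primes of `s`, so it does not affect them. It is
      -- not divisible by `q`, because `x` is not and `M` is prime to `q`.
      refine ⟨q • y + M • x, fun p hp z hz => ?_⟩
      rcases Finset.mem_insert.1 hp with rfl | hp
      · have hc : Nat.Coprime p M := Nat.Coprime.prod_right fun r hr => by
          refine (Nat.coprime_primes hqp (hs r (Finset.mem_insert_of_mem hr)).1).2 ?_
          rintro rfl; exact hq hr
        obtain ⟨α, β, hαβ⟩ := Nat.isCoprime_iff_coprime.2 hc
        have hMx : (M : ℤ) • x = (p : ℤ) • (z - y) := by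
          rw [smul_sub, natCast_zsmul, natCast_zsmul, natCast_zsmul, hz]; abel
        refine hx (α • x + β • (z - y)) ?_
        rw [← natCast_zsmul, smul_add, smul_comm _ β, ← hMx, smul_smul, smul_smul, ← add_smul,
          mul_comm, hαβ, one_smul]
      · obtain ⟨c, hc⟩ : p ∣ M := Finset.dvd_prod_of_mem (fun p => p) hp
        refine hg p hp (z - c • x) ?_
        rw [smul_sub, hz, smul_smul, ← hc, add_sub_cancel_right]
    · push Not at hgq
      refine ⟨g, fun p hp => ?_⟩
      rcases Finset.mem_insert.1 hp with rfl | hp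
      · exact hgq
      · exact hg p hp

/-- The negative direction needs an embedding into ℚ in which `k / b` belongs to the image only if
it is an integer; this is obtained by the choice of the element that goes to 1. -/
theorem isCancellable_iff {A : Type*} [AddCommGroup A] (hA : IsTorsionFreeRankOne A) :
    IsCancellable.{u} A ↔ IsAddCyclic A ∨ LiftsUnits A := by
  constructor
  · intro hcan
    by_contra! hc
    obtain ⟨hcyc, hL⟩ := hc
    unfold LiftsUnits at hL
    push Not at hL
    obtain ⟨b, u, hb, hu, hpb, hno⟩ := hL
    obtain ⟨htf, g₀, hg₀, -⟩ := (isTorsionFreeRankOne_iff A).1 hA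
    obtain ⟨g, hg⟩ : ∃ g : A, g ≠ 0 ∧ ∀ p ∈ b.primeFactors, ∀ y : A, p • y ≠ g := by
      rcases b.primeFactors.eq_empty_or_nonempty with h | ⟨p, hp⟩
      · exact ⟨g₀, hg₀, by simp [h]⟩
      · obtain ⟨g, hg⟩ := exists_notMem_prime_multiples (A := A) b.primeFactors fun p hp =>
          ⟨Nat.prime_of_mem_primeFactors hp, hpb p (Nat.prime_of_mem_primeFactors hp).one_lt
            (Nat.dvd_of_mem_primeFactors hp)⟩
        exact ⟨g, fun h0 => hg p hp 0 (by simp [h0]), hg⟩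
    obtain ⟨B, e, he⟩ := hA.exists_equiv_subgroup hg.1
    have h1 : (1 : ℚ) ∈ B := by rw [← he]; exact (e g).2
    refine AddSubgroup.not_isCancellable h1 (fun h => hcyc (isAddCyclic_congr e.symm h)) hb hu ?_ ?_
      (hcan.congr e)
    · intro k hk
      -- If `k / b` is not an integer, a prime `p` of its reduced denominator yields a fraction with
      -- denominator `p` in `B`. Bézout then gives the inverse of `p`, so `g` would be divisible by
      -- a prime factor of `b`.
      by_contra hbk
      have hd0 : Int.gcd k b ≠ 0 := by simp [Int.gcd_eq_zero_iff, hb.ne']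
      obtain ⟨b', hb'⟩ := Nat.gcd_dvd_right k.natAbs b
      have hgcd : Nat.gcd k.natAbs b = Int.gcd k b := by simp [Int.gcd]
      rw [hgcd] at hb'
      obtain ⟨k', hk'⟩ := Int.gcd_dvd_left k (b : ℤ)
      have hb1 : b' ≠ 1 := by
        rintro rfl
        rw [mul_one] at hb'
        have h2 : (b : ℤ) = Int.gcd k b := by exact_mod_cast hb'
        exact hbk (by rw [h2]; exact Int.gcd_dvd_left k b)
      obtain ⟨p, hp, l, rfl⟩ := Nat.exists_prime_and_dvd hb1
      have hpk : ¬ (p : ℤ) ∣ k' := by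
        rintro ⟨k'', rfl⟩
        have h2 : Int.gcd k b * p ∣ Int.gcd k b := by
          refine Int.dvd_gcd ?_ ?_
          · exact ⟨k'', by push_cast; rw [mul_assoc]; exact hk'⟩
          · exact Int.natCast_dvd_natCast.2 ⟨l, by rw [mul_assoc]; exact hb'⟩
        have h3 := Nat.le_of_dvd (Nat.pos_of_ne_zero hd0) h2
        have h4 := hp.two_le
        have h5 := Nat.pos_of_ne_zero hd0
        nlinarith
      have hpb' : p ∣ b := ⟨Int.gcd k b * l, hb'.trans (by ring)⟩
      have hl0 : l ≠ 0 := by rintro rfl; simp at hb'; omega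
      have hmem : (k' : ℚ) / p ∈ B := by
        have h2 := AddSubgroup.intCast_mul_mem hk l
        convert! h2 using 1
        have h3 : (k : ℚ) = Int.gcd k b * k' := by exact_mod_cast hk'
        have h4 : (b : ℚ) = Int.gcd k b * (p * l) := by exact_mod_cast hb'
        rw [h4, h3]
        have h5 : (Int.gcd k b : ℚ) ≠ 0 := by exact_mod_cast hd0
        have h6 : (p : ℚ) ≠ 0 := by exact_mod_cast hp.ne_zero
        have h7 : (l : ℚ) ≠ 0 := by exact_mod_cast hl0
        push_cast
        field_simp
      have hc : IsCoprime (p : ℤ) k' :=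
        (Nat.prime_iff_prime_int.1 hp).irreducible.coprime_iff_not_dvd.2 hpk
      obtain ⟨r, s, hrs⟩ := hc
      have hrs' : (r : ℚ) * p + s * k' = 1 := by exact_mod_cast hrs
      have hinv : (p : ℚ)⁻¹ ∈ B := by
        have h2 := B.add_mem (AddSubgroup.intCast_mem_of_one_mem h1 r)
          (AddSubgroup.intCast_mul_mem hmem s)
        convert! h2 using 1
        have h6 : (p : ℚ) ≠ 0 := by exact_mod_cast hp.ne_zero
        field_simp
        linear_combination -hrs'
      refine hg.2 p (Nat.mem_primeFactors.2 ⟨hp, hpb', hb.ne'⟩) (e.symm ⟨_, hinv⟩) ?_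
      rw [← map_nsmul, AddEquiv.symm_apply_eq]
      have h6 : (p : ℚ) ≠ 0 := by exact_mod_cast hp.ne_zero
      exact Subtype.ext (by simp [he, h6])
    · rintro ⟨v, w, hv, hw, hvd, hwd, h⟩
      have := hno v w hv hw (hvd.congr e.symm) (hwd.congr e.symm)
      tauto
  · rintro (h | h)
    · exact isCancellable_of_isAddCyclic hA h
    · obtain ⟨-, g, hg, -⟩ := (isTorsionFreeRankOne_iff A).1 hA
      obtain ⟨B, e, he⟩ := hA.exists_equiv_subgroup hg
      exact IsCancellable.congr e.symm (AddSubgroup.isCancellable_of_liftsUnits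
        (by rw [← he]; exact (e g).2) (h.congr e))

/-! ### Computability relative to an oracle: enumeration and parameters. -/

/-- `f` is partial recursive in the oracle `X`. -/
abbrev PartrecIn (X : ℕ → ℕ) (f : ℕ →. ℕ) : Prop := Nat.RecursiveIn {(X : ℕ →. ℕ)} f

/-- The total function `f` is computable from the oracle `X`. -/
abbrev TotalIn (X : ℕ → ℕ) (f : ℕ → ℕ) : Prop := PartrecIn X (f : ℕ →. ℕ)

namespace TotalIn

variable {X : ℕ → ℕ} {f g : ℕ → ℕ}

theorem of_computable (hf : Computable f) : TotalIn X f :=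
  (Partrec.nat_iff.1 hf).recursiveIn

theorem of_primrec (hf : Primrec f) : TotalIn X f := of_computable hf.to_comp

theorem oracle : TotalIn X X := Nat.RecursiveIn.oracle _ rfl

theorem comp (hf : TotalIn X f) (hg : TotalIn X g) : TotalIn X fun n => f (g n) :=
  (Nat.RecursiveIn.comp hf hg).of_eq fun _ => Part.bind_some _ _

theorem pair (hf : TotalIn X f) (hg : TotalIn X g) : TotalIn X fun n => Nat.pair (f n) (g n) :=
  (Nat.RecursiveIn.pair hf hg).of_eq fun n => by simp [Seq.seq]

theorem initSeg (hf : TotalIn X f) : TotalIn X fun k => Encodable.encode (initSeg f k) := by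
  have psnd : Primrec fun p : ℕ => p.unpair.2 := Primrec.snd.comp Primrec.unpair
  have pfst : Primrec fun p : ℕ => p.unpair.1 := Primrec.fst.comp Primrec.unpair
  have h1 := Nat.RecursiveIn.prec (of_primrec (X := X) (Primrec.const 0))
    ((of_primrec Primrec.succ).comp ((hf.comp (of_primrec (pfst.comp psnd))).pair
      (of_primrec (psnd.comp psnd))))
  refine (Nat.RecursiveIn.comp h1 ((of_primrec (Primrec.const 0)).pair
    (of_primrec Primrec.id))).of_eq fun k => ?_
  simp only [PFun.coe_val, Part.bind_eq_bind, Part.bind_some, Nat.unpair_pair, id]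
  induction k with
  | zero => rfl
  | succ k ih => simp only [ih]; simp [_root_.initSeg, Encodable.encode_list_cons]

end TotalIn

theorem Primrec.unpair_fst : Primrec fun n : ℕ => n.unpair.1 := Primrec.fst.comp Primrec.unpair

theorem Primrec.unpair_snd : Primrec fun n : ℕ => n.unpair.2 := Primrec.snd.comp Primrec.unpair

/-- Encoded result of stage `s` of the `e`-th computation on input `n`, with
`p = ⟨⟨e, n⟩, s⟩`. -/
def stageValue (X : ℕ → ℕ) (p : ℕ) : ℕ :=
  Encodable.encode (Nat.Partrec.Code.evaln p.unpair.2.unpair.1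
    (Nat.Partrec.Code.ofNatCode p.unpair.1.unpair.1)
    (Nat.pair (Encodable.encode (initSeg X p.unpair.2.unpair.2)) p.unpair.1.unpair.2))

theorem totalIn_stageValue (X : ℕ → ℕ) : TotalIn X (stageValue X) := by
  let E : ℕ → ℕ := fun q => Encodable.encode
    (Nat.Partrec.Code.evaln q.unpair.2.unpair.2.unpair.1
      (Nat.Partrec.Code.ofNatCode q.unpair.2.unpair.1.unpair.1)
      (Nat.pair q.unpair.1 q.unpair.2.unpair.1.unpair.2))
  have h1 := Primrec.unpair_fst
  have h2 := Primrec.unpair_snd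
  have hcode : Primrec Nat.Partrec.Code.ofNatCode := by
    rw [← Nat.Partrec.Code.ofNatCode_eq]; exact Primrec.ofNat _
  have hE : Primrec E := Primrec.encode.comp (Nat.Partrec.Code.primrec_evaln.comp
    (((h1.comp (h2.comp h2)).pair (hcode.comp (h1.comp (h1.comp h2)))).pair
      (Primrec₂.natPair.comp h1 (h2.comp (h1.comp h2)))))
  have := (TotalIn.of_primrec (X := X) hE).comp
    ((TotalIn.oracle.initSeg.comp (TotalIn.of_primrec (h2.comp h2))).pair
      (TotalIn.of_primrec Primrec.id))
  simpa [E, stageValue, Function.comp_def,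
    show stageValue X = fun p => stageValue X p from rfl] using this

theorem stageValue_pair (X : ℕ → ℕ) (e n s : ℕ) : stageValue X (Nat.pair (Nat.pair e n) s) =
    Encodable.encode (Nat.Partrec.Code.evaln s.unpair.1 (Nat.Partrec.Code.ofNatCode e)
      (Nat.pair (Encodable.encode (initSeg X s.unpair.2)) n)) := by
  simp [stageValue]

/-- The enumeration `phi X` is uniformly partial recursive in `X`. -/
theorem partrecIn_phi (X : ℕ → ℕ) : PartrecIn X fun p => phi X p.unpair.1 p.unpair.2 := by
  have hT := totalIn_stageValue X
  -- The code of `none` is 0 and that of `some v` is `v + 1`: the search finds the first stage with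
  -- nonzero code, and the predecessor recovers the value.
  have hU := Nat.RecursiveIn.rfind ((TotalIn.of_primrec
    (Primrec.nat_sub.comp (Primrec.const 1) Primrec.id)).comp hT)
  have hV := Nat.RecursiveIn.comp ((TotalIn.of_primrec Primrec.pred).comp hT)
    (Nat.RecursiveIn.pair (TotalIn.of_primrec Primrec.id) hU)
  refine hV.of_eq fun n => ?_
  obtain ⟨⟨e, n⟩, rfl⟩ := Nat.pairEquiv.surjective n
  simp only [Nat.pairEquiv_apply, Function.uncurry_apply_pair, Nat.unpair_pair]
  have hs : (fun s => (fun m => decide (m = 0)) <$>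
        ((fun p => 1 - id (stageValue X p) : ℕ → ℕ) : ℕ →. ℕ) (Nat.pair (Nat.pair e n) s)) =
      ((fun s => (Nat.Partrec.Code.evaln s.unpair.1 (Nat.Partrec.Code.ofNatCode e)
        (Nat.pair (Encodable.encode (initSeg X s.unpair.2)) n)).isSome : ℕ → Bool) :
          ℕ →. Bool) := by
    funext s
    simp only [PFun.coe_val, stageValue_pair, id, Part.map_eq_map, Part.map_some]
    cases Nat.Partrec.Code.evaln s.unpair.1 (Nat.Partrec.Code.ofNatCode e)
        (Nat.pair (Encodable.encode (initSeg X s.unpair.2)) n) <;> simp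
  rw [hs]
  have hb : ∀ P : Part ℕ, ((Nat.pair <$> Part.some (id (Nat.pair e n)) <*> P) >>= fun p =>
      Part.some (stageValue X p).pred) =
        P.bind fun s => Part.some (stageValue X (Nat.pair (Nat.pair e n) s)).pred := by
    intro P
    simp [Seq.seq, Part.map_some, Part.bind_map]
  refine (hb _).trans (Part.ext fun m => ?_)
  refine Part.mem_bind_iff.trans (Iff.trans ?_ Part.mem_bind_iff.symm)
  refine exists_congr fun s => and_congr_right fun hs => ?_
  have hd := Nat.rfind_spec hs
  simp only [PFun.coe_val, Part.mem_some_iff] at hd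
  obtain ⟨v, hv⟩ := Option.isSome_iff_exists.1 hd.symm
  rw [stageValue_pair, hv]; simp [hv]

/-- The parameter theorem for the enumeration `phi X`. -/
theorem exists_phi_param {X : ℕ → ℕ} {f : ℕ →. ℕ} (hf : PartrecIn X f) :
    ∃ s : ℕ → ℕ, Computable s ∧ ∀ i n, phi X (s i) n = f (Nat.pair i n) := by
  obtain ⟨F, hF, mF, eF⟩ := exists_finite_use X hf
  -- The parameter is put outermost, so that fixing it by currying leaves a program expecting an
  -- oracle segment and an input, as `phi` does.
  have hG : Partrec fun p : ℕ => F (Denumerable.ofNat (List ℕ) p.unpair.2.unpair.1)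
      (Nat.pair p.unpair.1 p.unpair.2.unpair.2) :=
    hF.comp ((Computable.ofNat _).comp (Primrec.unpair_fst.comp Primrec.unpair_snd).to_comp)
      (Primrec₂.natPair.comp Primrec.unpair_fst
        (Primrec.unpair_snd.comp Primrec.unpair_snd)).to_comp
  obtain ⟨c, hc⟩ := Nat.Partrec.Code.exists_code.1 (Partrec.nat_iff.1 hG)
  have hc' : ∀ i k n m,
      m ∈ (c.curry i).eval (Nat.pair (Encodable.encode (initSeg X k)) n) ↔
        m ∈ F (initSeg X k) (Nat.pair i n) := by
    intro i k n m; rw [Nat.Partrec.Code.eval_curry, hc]; simp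
  refine ⟨fun i => Encodable.encode (c.curry i), Primrec.to_comp (Primrec.encode.comp
    (Nat.Partrec.Code.primrec₂_curry.comp (Primrec.const c) Primrec.id)), fun i n =>
      Part.ext fun m => ?_⟩
  have he : Nat.Partrec.Code.ofNatCode (Encodable.encode (c.curry i)) = c.curry i := by
    rw [← Nat.Partrec.Code.ofNatCode_eq]; exact Denumerable.ofNat_encode _
  have sound : ∀ m, m ∈ phi X (Encodable.encode (c.curry i)) n → m ∈ f (Nat.pair i n) := by
    intro m hm
    obtain ⟨s, hs⟩ := Nat.rfindOpt_spec hm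
    rw [he] at hs
    exact (eF _ m).2 ⟨_, (hc' _ _ _ _).1 (Nat.Partrec.Code.evaln_sound hs)⟩
  refine ⟨sound m, fun hm => ?_⟩
  obtain ⟨k, hk⟩ := (eF _ m).1 hm
  obtain ⟨t, ht⟩ := Nat.Partrec.Code.evaln_complete.1 ((hc' _ _ _ _).2 hk)
  have hd : (phi X (Encodable.encode (c.curry i)) n).Dom :=
    Nat.rfindOpt_dom.2 ⟨Nat.pair t k, m, by simpa [he] using ht⟩
  have := sound _ (Part.get_mem hd)
  rw [Part.mem_unique hm this]
  exact Part.get_mem hd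

theorem computableIn_iff {X : ℕ → ℕ} {α : Type*} [Primcodable α] {f : ℕ → α} :
    ComputableIn {(X : ℕ →. ℕ)} f ↔ TotalIn X fun n => Encodable.encode (f n) := by
  have : (fun n => Part.bind (Encodable.decode (α := ℕ) n : Part ℕ)
      fun a => (Part.some (f a)).map Encodable.encode) =
      ((fun n => Encodable.encode (f n) : ℕ → ℕ) : ℕ →. ℕ) := by
    funext n; simp
  unfold ComputableIn RecursiveIn
  rw [this]

/-! ### Closure properties of the arithmetical hierarchy -/

section Hierarchy

variable {X : ℕ → ℕ} {S T : Set ℕ} {k : ℕ}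

theorem isSigma_zero_iff : IsSigma X 0 S ↔ ∃ c : ℕ → ℕ, TotalIn X c ∧ ∀ n, n ∈ S ↔ c n ≠ 0 := by
  constructor
  · rintro ⟨χ, hχ, h⟩
    refine ⟨_, computableIn_iff.1 hχ, fun n => (h n).trans ?_⟩
    cases χ n <;> simp
  · rintro ⟨c, hc, h⟩
    refine ⟨fun n => decide (c n ≠ 0), computableIn_iff.2 ?_, fun n => by rw [h]; simp⟩
    have hp : Primrec fun m : ℕ => Encodable.encode (decide (m ≠ 0)) :=
      Primrec.encode.comp (Primrec.eq.not.comp Primrec.id (Primrec.const 0)).decide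
    exact (TotalIn.of_primrec hp).comp hc

theorem IsSigma.preimage (h : IsSigma X k S) {g : ℕ → ℕ} (hg : Computable g) :
    IsSigma X k (g ⁻¹' S) := by
  induction k generalizing S g with
  | zero =>
    rw [isSigma_zero_iff] at h ⊢
    obtain ⟨c, hc, h⟩ := h
    exact ⟨_, hc.comp (.of_computable hg), fun n => h _⟩
  | succ k ih =>
    obtain ⟨R, hR, h⟩ := h
    refine ⟨(fun p => Nat.pair (g p.unpair.1) p.unpair.2) ⁻¹' R, ih hR ?_, fun n => ?_⟩
    · exact Primrec₂.natPair.to_comp.comp (hg.comp Primrec.unpair_fst.to_comp)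
        Primrec.unpair_snd.to_comp
    · simpa using h (g n)

theorem IsSigma.succ_of_compl (h : IsSigma X k Sᶜ) : IsSigma X (k + 1) S :=
  ⟨(fun p => p.unpair.1) ⁻¹' S, h.preimage Primrec.unpair_fst.to_comp, fun n => by simp⟩

theorem IsSigma.compl_zero (h : IsSigma X 0 S) : IsSigma X 0 Sᶜ := by
  rw [isSigma_zero_iff] at h ⊢
  obtain ⟨c, hc, h⟩ := h
  refine ⟨fun n => 1 - c n, (TotalIn.of_primrec
    (Primrec.nat_sub.comp (Primrec.const 1) Primrec.id)).comp hc, fun n => ?_⟩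
  rw [Set.mem_compl_iff, h, not_not]
  change c n = 0 ↔ 1 - c n ≠ 0
  omega

theorem IsSigma.succ (h : IsSigma X k S) : IsSigma X (k + 1) S := by
  induction k generalizing S with
  | zero => exact h.compl_zero.succ_of_compl
  | succ k ih =>
    obtain ⟨R, hR, h⟩ := h
    exact ⟨R, ih hR, h⟩

theorem IsSigma.ex (h : IsSigma X (k + 1) S) :
    IsSigma X (k + 1) {n | ∃ m, Nat.pair n m ∈ S} := by
  obtain ⟨R, hR, h⟩ := h
  refine ⟨(fun p => Nat.pair (Nat.pair p.unpair.1 p.unpair.2.unpair.1) p.unpair.2.unpair.2) ⁻¹' R,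
    hR.preimage ?_, fun n => ?_⟩
  · exact (Primrec₂.natPair.comp (Primrec₂.natPair.comp Primrec.unpair_fst
      (Primrec.unpair_fst.comp Primrec.unpair_snd))
      (Primrec.unpair_snd.comp Primrec.unpair_snd)).to_comp
  · simp only [Set.mem_ofPred_eq, h, Set.mem_preimage, Nat.unpair_pair]
    constructor
    · rintro ⟨m, j, hj⟩; exact ⟨Nat.pair m j, by simpa using hj⟩
    · rintro ⟨m, hm⟩; exact ⟨_, _, hm⟩

/-- Each level is defined through complements of the previous one, which interchange intersection
and union; hence the joint induction. -/
theorem IsSigma.inter_union : ∀ {k : ℕ} {S T : Set ℕ}, IsSigma X k S → IsSigma X k T →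
    IsSigma X k (S ∩ T) ∧ IsSigma X k (S ∪ T) := by
  intro k
  induction k with
  | zero =>
    intro S T hS hT
    rw [isSigma_zero_iff] at hS hT
    obtain ⟨c, hc, h⟩ := hS
    obtain ⟨d, hd, h'⟩ := hT
    have hcd := hc.pair hd
    refine ⟨isSigma_zero_iff.2 ⟨fun n => c n * d n, ?_, fun n => ?_⟩,
      isSigma_zero_iff.2 ⟨fun n => c n + d n, ?_, fun n => ?_⟩⟩
    · simpa using (TotalIn.of_primrec (Primrec.nat_mul.comp Primrec.unpair_fst
        Primrec.unpair_snd)).comp hcd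
    · simp [h, h']
    · simpa using (TotalIn.of_primrec (Primrec.nat_add.comp Primrec.unpair_fst
        Primrec.unpair_snd)).comp hcd
    · simp [h, h']; omega
  | succ k ih =>
    rintro S T ⟨R, hR, h⟩ ⟨R', hR', h'⟩
    constructor
    · have h1 : Computable fun p : ℕ => Nat.pair p.unpair.1 p.unpair.2.unpair.1 :=
        (Primrec₂.natPair.comp Primrec.unpair_fst
          (Primrec.unpair_fst.comp Primrec.unpair_snd)).to_comp
      have h2 : Computable fun p : ℕ => Nat.pair p.unpair.1 p.unpair.2.unpair.2 :=
        (Primrec₂.natPair.comp Primrec.unpair_fst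
          (Primrec.unpair_snd.comp Primrec.unpair_snd)).to_comp
      refine ⟨(fun p => Nat.pair p.unpair.1 p.unpair.2.unpair.1) ⁻¹' R ∩
        (fun p => Nat.pair p.unpair.1 p.unpair.2.unpair.2) ⁻¹' R', ?_, fun n => ?_⟩
      · rw [Set.compl_inter]; exact (ih (hR.preimage h1) (hR'.preimage h2)).2
      · simp only [Set.mem_inter_iff, h, h', Set.mem_preimage, Nat.unpair_pair]
        constructor
        · rintro ⟨⟨m, hm⟩, m', hm'⟩; exact ⟨Nat.pair m m', by simpa using ⟨hm, hm'⟩⟩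
        · rintro ⟨m, hm, hm'⟩; exact ⟨⟨_, hm⟩, _, hm'⟩
    · refine ⟨R ∪ R', by rw [Set.compl_union]; exact (ih hR hR').1, fun n => ?_⟩
      simp only [Set.mem_union, h, h', exists_or]

theorem PartrecIn.isSigma_dom {f : ℕ →. ℕ} (hf : PartrecIn X f) :
    IsSigma X 1 {n | (f n).Dom} := by
  obtain ⟨e, rfl⟩ := (exists_phi_eq_iff X f).2 hf
  refine ⟨{p | stageValue X (Nat.pair (Nat.pair e p.unpair.1) p.unpair.2) ≠ 0}, ?_, fun n => ?_⟩
  · refine (isSigma_zero_iff.2 ⟨_, (totalIn_stageValue X).comp (.of_primrec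
      (Primrec₂.natPair.comp (Primrec₂.natPair.comp (Primrec.const e) Primrec.unpair_fst)
        Primrec.unpair_snd)), fun n => Iff.rfl⟩).compl_zero
  · refine Nat.rfindOpt_dom.trans (exists_congr fun s => ?_)
    simp only [Set.mem_ofPred_eq, Nat.unpair_pair, stageValue_pair]
    cases Nat.Partrec.Code.evaln s.unpair.1 (Nat.Partrec.Code.ofNatCode e)
        (Nat.pair (Encodable.encode (initSeg X s.unpair.2)) n) <;> simp

/-- The graph of a function partial recursive in `X` is `Σ⁰₁`. -/
theorem PartrecIn.isSigma_graph {f : ℕ →. ℕ} (hf : PartrecIn X f) :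
    IsSigma X 1 {p | p.unpair.2 ∈ f p.unpair.1} := by
  have h1 : PartrecIn X fun p => f p.unpair.1 :=
    (Nat.RecursiveIn.comp hf (TotalIn.of_primrec Primrec.unpair_fst)).of_eq
      fun _ => Part.bind_some _ _
  -- This search stops at once if the two components agree and never otherwise. Applied to the value
  -- of `f` and the proposed value, it turns the graph into a domain.
  have hd : PartrecIn X fun p => Nat.rfind fun _ =>
      (fun m : ℕ => decide (m = 0)) <$>
        (Part.some (if p.unpair.1 = p.unpair.2 then 0 else 1) : Part ℕ) := by
    have hc : Primrec fun p : ℕ => if p.unpair.1.unpair.1 = p.unpair.1.unpair.2 then 0 else 1 :=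
      Primrec.ite (Primrec.eq.comp (Primrec.unpair_fst.comp Primrec.unpair_fst)
        (Primrec.unpair_snd.comp Primrec.unpair_fst)) (Primrec.const 0) (Primrec.const 1)
    refine (Nat.RecursiveIn.rfind (TotalIn.of_primrec hc)).of_eq fun p => ?_
    simp
  have h2 := PartrecIn.isSigma_dom (Nat.RecursiveIn.comp hd (Nat.RecursiveIn.pair h1
    (TotalIn.of_primrec Primrec.unpair_snd)))
  convert! h2 using 1
  ext p
  simp only [Set.mem_ofPred_eq, PFun.coe_val, Part.bind_eq_bind, Part.dom_iff_mem,
    Part.mem_bind_iff]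
  constructor
  · intro h
    refine ⟨0, Nat.pair p.unpair.2 p.unpair.2, ?_, ?_⟩
    · simp only [Seq.seq, Part.mem_bind_iff, Part.map_eq_map, Part.mem_map_iff]
      exact ⟨_, ⟨_, h, rfl⟩, _, Part.mem_some _, rfl⟩
    · exact Nat.mem_rfind.2 ⟨by simp, by simp⟩
  · rintro ⟨y, z, hz, hy⟩
    simp only [Seq.seq, Part.mem_bind_iff, Part.map_eq_map, Part.mem_map_iff]
      at hz
    obtain ⟨_, ⟨a, ha, rfl⟩, b, hb, rfl⟩ := hz
    rw [Part.mem_some_iff] at hb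
    have := Nat.rfind_spec hy
    simp only [Nat.unpair_pair, Part.map_eq_map, Part.map_some, Part.mem_some_iff,
      true_eq_decide_iff] at this
    split_ifs at this with hab
    · rwa [← hb, ← hab]

end Hierarchy

/-- The predicate `p` is uniformly `Σ⁰ₖ` relative to `X`. -/
def SigmaPred (X : ℕ → ℕ) (k : ℕ) {α : Type*} [Primcodable α] (p : α → Prop) : Prop :=
  ∀ g : ℕ → α, Computable g → IsSigma X k {n | p (g n)}

/-- The predicate `p` is uniformly `Π⁰ₖ` relative to `X`. -/
def PiPred (X : ℕ → ℕ) (k : ℕ) {α : Type*} [Primcodable α] (p : α → Prop) : Prop :=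
  SigmaPred X k fun a => ¬ p a

/-- The predicate `p` is uniformly `Δ⁰₂` relative to `X`. -/
def DeltaTwoPred (X : ℕ → ℕ) {α : Type*} [Primcodable α] (p : α → Prop) : Prop :=
  SigmaPred X 2 p ∧ PiPred X 2 p

section Predicates

variable {X : ℕ → ℕ} {k : ℕ} {α β : Type*} [Primcodable α] [Primcodable β] {p q : α → Prop}

namespace SigmaPred

theorem of_eq (h : SigmaPred X k p) (hpq : ∀ a, p a ↔ q a) : SigmaPred X k q :=
  (funext fun a => propext (hpq a) : p = q) ▸ h

theorem and (hp : SigmaPred X k p) (hq : SigmaPred X k q) : SigmaPred X k fun a => p a ∧ q a :=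
  fun g hg => (IsSigma.inter_union (hp g hg) (hq g hg)).1

theorem or (hp : SigmaPred X k p) (hq : SigmaPred X k q) : SigmaPred X k fun a => p a ∨ q a :=
  fun g hg => (IsSigma.inter_union (hp g hg) (hq g hg)).2

theorem succ (hp : SigmaPred X k p) : SigmaPred X (k + 1) p := fun g hg => (hp g hg).succ

theorem ex {r : α → ℕ → Prop} (h : SigmaPred X (k + 1) fun q : α × ℕ => r q.1 q.2) :
    SigmaPred X (k + 1) fun a => ∃ m, r a m := by
  intro g hg
  have := (h (fun n => (g n.unpair.1, n.unpair.2))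
    ((hg.comp Primrec.unpair_fst.to_comp).pair Primrec.unpair_snd.to_comp)).ex
  simpa using this

theorem of_computablePred (hp : ComputablePred p) : SigmaPred X 0 p := by
  obtain ⟨_, hp⟩ := hp
  intro g hg
  exact ⟨_, (hp.comp hg).computableIn, fun n => by simp⟩

theorem of_graph {f : ℕ →. ℕ} (hf : PartrecIn X f) {n m : α → ℕ} (hn : Computable n)
    (hm : Computable m) : SigmaPred X 1 fun a => m a ∈ f (n a) := by
  intro g hg
  have := (PartrecIn.isSigma_graph hf).preimage
    (Primrec₂.natPair.to_comp.comp (hn.comp hg) (hm.comp hg))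
  simpa using this

end SigmaPred

namespace PiPred

theorem of_eq (h : PiPred X k p) (hpq : ∀ a, p a ↔ q a) : PiPred X k q :=
  SigmaPred.of_eq h fun a => not_congr (hpq a)

theorem and (hp : PiPred X k p) (hq : PiPred X k q) : PiPred X k fun a => p a ∧ q a :=
  (SigmaPred.or hp hq).of_eq fun _ => not_and_or.symm

theorem or (hp : PiPred X k p) (hq : PiPred X k q) : PiPred X k fun a => p a ∨ q a :=
  (SigmaPred.and hp hq).of_eq fun _ => not_or.symm

theorem succ (hp : PiPred X k p) : PiPred X (k + 1) p := SigmaPred.succ hp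

theorem all {r : α → ℕ → Prop} (h : PiPred X (k + 1) fun q : α × ℕ => r q.1 q.2) :
    PiPred X (k + 1) fun a => ∀ m, r a m :=
  (SigmaPred.ex (r := fun a m => ¬ r a m) h).of_eq fun _ => not_forall.symm

theorem sigma_succ (h : PiPred X k p) : SigmaPred X (k + 1) p := by
  intro g hg
  exact IsSigma.succ_of_compl (h g hg)

end PiPred

theorem SigmaPred.pi_succ (h : SigmaPred X k p) : PiPred X (k + 1) p := by
  intro g hg
  refine IsSigma.succ_of_compl ?_
  convert! h g hg using 1
  ext n
  exact not_not

namespace DeltaTwoPred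

theorem of_sigma_one (h : SigmaPred X 1 p) : DeltaTwoPred X p := ⟨h.succ, h.pi_succ⟩

theorem of_computablePred (h : ComputablePred p) : DeltaTwoPred X p :=
  of_sigma_one (SigmaPred.of_computablePred h).succ

theorem not (h : DeltaTwoPred X p) : DeltaTwoPred X fun a => ¬ p a :=
  ⟨h.2, h.1.of_eq fun _ => not_not.symm⟩

theorem or (hp : DeltaTwoPred X p) (hq : DeltaTwoPred X q) : DeltaTwoPred X fun a => p a ∨ q a :=
  ⟨hp.1.or hq.1, hp.2.or hq.2⟩

theorem imp (hp : DeltaTwoPred X p) (hq : DeltaTwoPred X q) : DeltaTwoPred X fun a => p a → q a :=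
  ⟨(hp.not.1.or hq.1).of_eq fun _ => imp_iff_not_or.symm,
    (hp.not.2.or hq.2).of_eq fun _ => imp_iff_not_or.symm⟩

end DeltaTwoPred

theorem primrecRel_dvd : PrimrecRel fun a b : ℕ => a ∣ b :=
  (Primrec.eq.comp (Primrec.nat_mod.comp Primrec.snd Primrec.fst) (Primrec.const 0)).of_eq
    fun _ => (Nat.dvd_iff_mod_eq_zero).symm

theorem primrecPred_modEq {a b n : α → ℕ} (ha : Primrec a) (hb : Primrec b) (hn : Primrec n) :
    PrimrecPred fun x => a x ≡ b x [MOD n x] :=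
  Primrec.eq.comp (Primrec.nat_mod.comp ha hn) (Primrec.nat_mod.comp hb hn)

theorem primrecRel_coprime : PrimrecRel fun a b : ℕ => a.Coprime b := by
  -- No common divisor exceeds 1. The number 0 is a common divisor only of 0 and 0, which are not
  -- coprime; the last clause excludes this case.
  have h : PrimrecRel fun x p : ℕ =>
      ¬ (x ∣ p.unpair.1 ∧ x ∣ p.unpair.2) ∨ x ≤ 1 ∧ (x = 0 → p.unpair.1 + p.unpair.2 ≠ 0) := by
    have h1 : Primrec fun q : ℕ × ℕ => q.2.unpair.1 := Primrec.unpair_fst.comp Primrec.snd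
    have h2 : Primrec fun q : ℕ × ℕ => q.2.unpair.2 := Primrec.unpair_snd.comp Primrec.snd
    refine PrimrecPred.or (PrimrecPred.not ((primrecRel_dvd.comp Primrec.fst h1).and
      (primrecRel_dvd.comp Primrec.fst h2))) ((Primrec.nat_le.comp Primrec.fst
        (Primrec.const 1)).and ?_)
    refine ((Primrec.eq.comp Primrec.fst (Primrec.const 0)).not.or
      (Primrec.eq.comp (Primrec.nat_add.comp h1 h2) (Primrec.const 0)).not).of_eq fun q => ?_
    tauto
  refine (h.forall_lt.comp (Primrec.succ.comp (Primrec.nat_add.comp Primrec.fst Primrec.snd))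
    (Primrec₂.natPair.comp Primrec.fst Primrec.snd)).of_eq ?_
  rintro ⟨a, b⟩
  simp only [Nat.unpair_pair]
  constructor
  · intro hd
    have hlt : Nat.gcd a b < (a + b).succ := by
      rcases Nat.eq_zero_or_pos a with rfl | ha
      · simp
      · have := Nat.gcd_le_left b ha; omega
    rcases hd _ hlt with h1 | ⟨h1, h2⟩
    · exact absurd ⟨Nat.gcd_dvd_left a b, Nat.gcd_dvd_right a b⟩ h1
    · have : Nat.gcd a b ≠ 0 := by
        intro h0
        rw [Nat.gcd_eq_zero_iff] at h0
        exact h2 (by rw [h0.1, h0.2]; simp) (by omega)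
      change Nat.gcd a b = 1
      omega
  · intro hc x hx
    by_cases hd : x ∣ a ∧ x ∣ b
    · right
      have := Nat.dvd_gcd hd.1 hd.2
      rw [hc, Nat.dvd_one] at this
      omega
    · exact .inl hd

end Predicates

/-! ### The arithmetical description of the index set -/

/-- The partial function taking `⟨⟨e, a⟩, k⟩` to `(k + 1) • a` in the `e`-th structure. -/
def nsmulSucc (X : ℕ → ℕ) (p : ℕ) : Part ℕ :=
  Nat.rec (Part.some p.unpair.1.unpair.2)
    (fun _ r => r.bind fun i => phi X p.unpair.1.unpair.1.unpair.2 (Nat.pair i p.unpair.1.unpair.2))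
    p.unpair.2

theorem partrecIn_nsmulSucc (X : ℕ → ℕ) : PartrecIn X (nsmulSucc X) := by
  have h1 := Primrec.unpair_fst
  have h2 := Primrec.unpair_snd
  have hs : TotalIn X fun q : ℕ => Nat.pair q.unpair.1.unpair.1.unpair.2
      (Nat.pair q.unpair.2.unpair.2 q.unpair.1.unpair.2) :=
    .of_primrec (Primrec₂.natPair.comp (h2.comp (h1.comp h1))
      (Primrec₂.natPair.comp (h2.comp h2) (h2.comp h1)))
  refine (Nat.RecursiveIn.prec (TotalIn.of_primrec h2)
    (Nat.RecursiveIn.comp (partrecIn_phi X) hs)).of_eq fun p => ?_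
  have hb : ∀ q, (((fun q : ℕ => Nat.pair q.unpair.1.unpair.1.unpair.2
      (Nat.pair q.unpair.2.unpair.2 q.unpair.1.unpair.2) : ℕ → ℕ) : ℕ →. ℕ) q >>= fun p =>
      phi X p.unpair.1 p.unpair.2) = phi X q.unpair.1.unpair.1.unpair.2
        (Nat.pair q.unpair.2.unpair.2 q.unpair.1.unpair.2) := by
    intro q
    refine (Part.bind_some _ _).trans ?_
    simp
  simp only [hb, Nat.unpair_pair]
  rfl

/-- Membership in the domain of the `e`-th structure. -/
def InDom (X : ℕ → ℕ) (e a : ℕ) : Prop := 1 ∈ phi X e.unpair.1 a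

/-- The relation `a + b = c` of the `e`-th structure. -/
def AddRel (X : ℕ → ℕ) (e a b c : ℕ) : Prop := c ∈ phi X e.unpair.2 (Nat.pair a b)

/-- The relation `(k + 1) • a = b` of the `e`-th structure. -/
def SmulRel (X : ℕ → ℕ) (e k a b : ℕ) : Prop := b ∈ nsmulSucc X (Nat.pair (Nat.pair e a) k)

/-- In the `e`-th structure, `c` is a multiple of `g`. -/
def MultipleRel (X : ℕ → ℕ) (e g c : ℕ) : Prop :=
  AddRel X e c c c ∨ ∃ l d, SmulRel X e l g d ∧ (d = c ∨ ∃ z, AddRel X e c d z ∧ AddRel X e z z z)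

/-- The `e`-th structure is an abelian group. -/
structure IsGroupIndex (X : ℕ → ℕ) (e : ℕ) : Prop where
  total : ∀ n, 0 ∈ phi X e.unpair.1 n ∨ InDom X e n
  add : ∀ a b, InDom X e a → InDom X e b → ∃ c, InDom X e c ∧ AddRel X e a b c
  comm : ∀ a b c, InDom X e a → InDom X e b → AddRel X e a b c → AddRel X e b a c
  assoc : ∀ a b c x y z, InDom X e a → InDom X e b → InDom X e c → AddRel X e a b x →
    AddRel X e x c y → AddRel X e b c z → AddRel X e a z y
  zero : ∃ z, InDom X e z ∧
    ∀ a, InDom X e a → AddRel X e a z a ∧ ∃ b, InDom X e b ∧ AddRel X e a b z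

/-- Multiplication by `k + 1` is surjective on the `e`-th structure. -/
def DivIndex (X : ℕ → ℕ) (e k : ℕ) : Prop :=
  ∀ a, InDom X e a → ∃ c, InDom X e c ∧ SmulRel X e k c a

/-- The `e`-th structure is torsion-free of rank one. -/
def IsRankOneIndex (X : ℕ → ℕ) (e : ℕ) : Prop :=
  (∀ k a b c, InDom X e a → InDom X e b → SmulRel X e k a c → SmulRel X e k b c → a = b) ∧
    ∃ g, InDom X e g ∧ ¬ AddRel X e g g g ∧
      ∀ a, InDom X e a → ∃ k c, SmulRel X e k a c ∧ MultipleRel X e g c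

/-- The `e`-th structure is cyclic. -/
def IsCyclicIndex (X : ℕ → ℕ) (e : ℕ) : Prop :=
  ∃ g, InDom X e g ∧ ∀ a, InDom X e a → MultipleRel X e g a

/-- The `e`-th structure satisfies `LiftsUnits`. -/
def LiftsUnitsIndex (X : ℕ → ℕ) (e : ℕ) : Prop :=
  ∀ b u : ℕ, u.Coprime (b + 1) →
    (∃ p, p + 2 ∣ b + 1 ∧ DivIndex X e (p + 1)) ∨
      ∃ v w, DivIndex X e v ∧ DivIndex X e w ∧
        (v + 1 ≡ u * (w + 1) [MOD b + 1] ∨ b + 1 ∣ v + 1 + u * (w + 1))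

/-! ### Quantifier complexity of the index predicates. -/

section Complexity

variable {X : ℕ → ℕ} {α : Type*} [Primcodable α] {e k a b c g : α → ℕ}

theorem sigmaPred_phi {m : α → ℕ} (he : Computable e) (ha : Computable a) (hm : Computable m) :
    SigmaPred X 1 fun x => m x ∈ phi X (e x) (a x) := by
  have := SigmaPred.of_graph (partrecIn_phi X) (Primrec₂.natPair.to_comp.comp he ha) hm
  simpa using this

theorem sigmaPred_inDom (he : Computable e) (ha : Computable a) :
    SigmaPred X 1 fun x => InDom X (e x) (a x) :=
  sigmaPred_phi (Primrec.unpair_fst.to_comp.comp he) ha (Computable.const 1)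

theorem sigmaPred_addRel (he : Computable e) (ha : Computable a) (hb : Computable b)
    (hc : Computable c) : SigmaPred X 1 fun x => AddRel X (e x) (a x) (b x) (c x) :=
  sigmaPred_phi (Primrec.unpair_snd.to_comp.comp he) (Primrec₂.natPair.to_comp.comp ha hb) hc

theorem sigmaPred_smulRel (he : Computable e) (hk : Computable k) (ha : Computable a)
    (hb : Computable b) : SigmaPred X 1 fun x => SmulRel X (e x) (k x) (a x) (b x) :=
  SigmaPred.of_graph (partrecIn_nsmulSucc X)
    (Primrec₂.natPair.to_comp.comp (Primrec₂.natPair.to_comp.comp he ha) hk) hb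

theorem sigmaPred_multipleRel (he : Computable e) (hg : Computable g) (hc : Computable c) :
    SigmaPred X 1 fun x => MultipleRel X (e x) (g x) (c x) := by
  have F {γ δ : Type _} [Primcodable γ] [Primcodable δ] : Computable (@Prod.fst γ δ) :=
    Computable.fst
  refine (sigmaPred_addRel he hc hc hc).or (.ex (.ex ?_))
  refine (sigmaPred_smulRel (he.comp (F.comp F)) (Computable.snd.comp F) (hg.comp (F.comp F))
    Computable.snd).and (.or (SigmaPred.of_computablePred ?_).succ (.ex ?_))
  · exact ComputablePred.of_eq (Computable.computablePred (p := fun x : (α × ℕ) × ℕ =>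
      x.2 = c x.1.1) ((Primrec.eq (α := ℕ)).decide.to_comp.comp Computable.snd
        (hc.comp (F.comp F)))) fun _ => Iff.rfl
  · have he' := he.comp (F.comp (F.comp F) : Computable fun x : ((α × ℕ) × ℕ) × ℕ => x.1.1.1)
    exact (sigmaPred_addRel he' (hc.comp (F.comp (F.comp F))) (Computable.snd.comp F)
      Computable.snd).and (sigmaPred_addRel he' Computable.snd Computable.snd Computable.snd)

/-- The form is `∀ a`, with a Σ⁰₁ premise and a Σ⁰₁ conclusion; such an implication is Δ⁰₂. -/
theorem piPred_divIndex (he : Computable e) (hk : Computable k) :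
    PiPred X 2 fun x => DivIndex X (e x) (k x) := by
  have F {γ δ : Type _} [Primcodable γ] [Primcodable δ] : Computable (@Prod.fst γ δ) :=
    Computable.fst
  refine .all (DeltaTwoPred.imp (.of_sigma_one (sigmaPred_inDom (he.comp F) .snd))
    (.of_sigma_one (.ex ?_))).2
  exact (sigmaPred_inDom (he.comp (F.comp F)) .snd).and
    (sigmaPred_smulRel (he.comp (F.comp F)) (hk.comp (F.comp F)) .snd (Computable.snd.comp F))

theorem sigmaPred_isCyclicIndex (he : Computable e) :
    SigmaPred X 3 fun x => IsCyclicIndex X (e x) := by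
  have F {γ δ : Type _} [Primcodable γ] [Primcodable δ] : Computable (@Prod.fst γ δ) :=
    Computable.fst
  refine .ex (PiPred.sigma_succ (.and
    (DeltaTwoPred.of_sigma_one (sigmaPred_inDom (he.comp F) .snd)).2 (.all ?_)))
  exact (DeltaTwoPred.imp (.of_sigma_one (sigmaPred_inDom (he.comp (F.comp F)) .snd))
    (.of_sigma_one (sigmaPred_multipleRel (he.comp (F.comp F)) (Computable.snd.comp F) .snd))).2

theorem piPred_isRankOneIndex (he : Computable e) :
    PiPred X 4 fun x => IsRankOneIndex X (e x) := by
  have F {γ δ : Type _} [Primcodable γ] [Primcodable δ] : Computable (@Prod.fst γ δ) :=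
    Computable.fst
  have S {γ δ : Type _} [Primcodable γ] [Primcodable δ] : Computable (@Prod.snd γ δ) :=
    Computable.snd
  refine .and (PiPred.succ (.succ (.all (.all (.all (.all ?_)))))) (SigmaPred.pi_succ
    (.ex (PiPred.sigma_succ (.and ?_ (.and ?_ (.all ?_))))))
  · have he' := he.comp (F.comp (F.comp (F.comp F)) :
      Computable fun x : (((α × ℕ) × ℕ) × ℕ) × ℕ => x.1.1.1.1)
    refine (DeltaTwoPred.imp (.of_sigma_one (sigmaPred_inDom he' (S.comp (F.comp F))))
      (.imp (.of_sigma_one (sigmaPred_inDom he' (S.comp F)))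
      (.imp (.of_sigma_one (sigmaPred_smulRel he' (S.comp (F.comp (F.comp F))) (S.comp (F.comp F))
        S)) (.imp (.of_sigma_one (sigmaPred_smulRel he' (S.comp (F.comp (F.comp F))) (S.comp F)
        S)) (.of_computablePred ?_))))).2
    exact Computable.computablePred (p := fun x : (((α × ℕ) × ℕ) × ℕ) × ℕ => x.1.1.2 = x.1.2)
      ((Primrec.eq (α := ℕ)).decide.to_comp.comp (S.comp (F.comp F)) (S.comp F))
  · exact (DeltaTwoPred.of_sigma_one (sigmaPred_inDom (he.comp F) S)).2
  · exact (DeltaTwoPred.of_sigma_one (sigmaPred_addRel (he.comp F) S S S)).not.2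
  · refine (DeltaTwoPred.imp (.of_sigma_one (sigmaPred_inDom (he.comp (F.comp F)) S))
      (.of_sigma_one (.ex (.ex ?_)))).2
    have he' := he.comp (F.comp (F.comp (F.comp F)) :
      Computable fun x : (((α × ℕ) × ℕ) × ℕ) × ℕ => x.1.1.1.1)
    exact (sigmaPred_smulRel he' (S.comp F) (S.comp (F.comp F)) S).and
      (sigmaPred_multipleRel he' (S.comp (F.comp (F.comp F))) S)

theorem piPred_isGroupIndex (he : Computable e) :
    PiPred X 4 fun x => IsGroupIndex X (e x) := by
  have F {γ δ : Type _} [Primcodable γ] [Primcodable δ] : Computable (@Prod.fst γ δ) :=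
    Computable.fst
  have S {γ δ : Type _} [Primcodable γ] [Primcodable δ] : Computable (@Prod.snd γ δ) :=
    Computable.snd
  have h1 : PiPred X 4 fun x => ∀ n, 0 ∈ phi X (e x).unpair.1 n ∨ InDom X (e x) n :=
    .succ (.succ (.all (DeltaTwoPred.or (.of_sigma_one (sigmaPred_phi
      (Primrec.unpair_fst.to_comp.comp (he.comp F)) S (Computable.const 0)))
      (.of_sigma_one (sigmaPred_inDom (he.comp F) S))).2))
  have h2 : PiPred X 4 fun x => ∀ a b, InDom X (e x) a → InDom X (e x) b →
      ∃ c, InDom X (e x) c ∧ AddRel X (e x) a b c :=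
    .succ (.succ (.all (.all (DeltaTwoPred.imp
      (.of_sigma_one (sigmaPred_inDom (he.comp (F.comp F)) (S.comp F)))
      (.imp (.of_sigma_one (sigmaPred_inDom (he.comp (F.comp F)) S))
      (.of_sigma_one (.ex (.and (sigmaPred_inDom (he.comp (F.comp (F.comp F))) S)
        (sigmaPred_addRel (he.comp (F.comp (F.comp F))) (S.comp (F.comp F)) (S.comp F)
          S)))))).2)))
  have h3 : PiPred X 4 fun x => ∀ a b c, InDom X (e x) a → InDom X (e x) b →
      AddRel X (e x) a b c → AddRel X (e x) b a c := by
    refine .succ (.succ (.all (.all (.all ?_))))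
    have he' := he.comp (F.comp (F.comp F) : Computable fun x : ((α × ℕ) × ℕ) × ℕ => x.1.1.1)
    exact (DeltaTwoPred.imp (.of_sigma_one (sigmaPred_inDom he' (S.comp (F.comp F))))
      (.imp (.of_sigma_one (sigmaPred_inDom he' (S.comp F)))
      (.imp (.of_sigma_one (sigmaPred_addRel he' (S.comp (F.comp F)) (S.comp F) S))
        (.of_sigma_one (sigmaPred_addRel he' (S.comp F) (S.comp (F.comp F)) S))))).2
  have h4 : PiPred X 4 fun x => ∀ a b c x' y z, InDom X (e x) a → InDom X (e x) b →
      InDom X (e x) c → AddRel X (e x) a b x' → AddRel X (e x) x' c y → AddRel X (e x) b c z →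
      AddRel X (e x) a z y := by
    refine .succ (.succ (.all (.all (.all (.all (.all (.all ?_)))))))
    let β := (((((α × ℕ) × ℕ) × ℕ) × ℕ) × ℕ) × ℕ
    have f1 : Computable fun x : β => x.1 := F
    have f2 : Computable fun x : β => x.1.1 := F.comp f1
    have f3 : Computable fun x : β => x.1.1.1 := F.comp f2
    have f4 : Computable fun x : β => x.1.1.1.1 := F.comp f3
    have f5 : Computable fun x : β => x.1.1.1.1.1 := F.comp f4
    have he' := he.comp (F.comp f5)
    have ha := S.comp f5
    have hb := S.comp f4
    have hc := S.comp f3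
    have hx := S.comp f2
    have hy := S.comp f1
    exact (DeltaTwoPred.imp (.of_sigma_one (sigmaPred_inDom he' ha))
      (.imp (.of_sigma_one (sigmaPred_inDom he' hb))
      (.imp (.of_sigma_one (sigmaPred_inDom he' hc))
      (.imp (.of_sigma_one (sigmaPred_addRel he' ha hb hx))
      (.imp (.of_sigma_one (sigmaPred_addRel he' hx hc hy))
      (.imp (.of_sigma_one (sigmaPred_addRel he' hb hc S))
        (.of_sigma_one (sigmaPred_addRel he' ha S hy)))))))).2
  have h5 : PiPred X 4 fun x => ∃ z, InDom X (e x) z ∧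
      ∀ a, InDom X (e x) a → AddRel X (e x) a z a ∧
        ∃ b, InDom X (e x) b ∧ AddRel X (e x) a b z := by
    refine SigmaPred.pi_succ (.ex (PiPred.sigma_succ (.and
      (DeltaTwoPred.of_sigma_one (sigmaPred_inDom (he.comp F) S)).2 (.all ?_))))
    refine (DeltaTwoPred.imp (.of_sigma_one (sigmaPred_inDom (he.comp (F.comp F)) S))
      (.of_sigma_one (.and (sigmaPred_addRel (he.comp (F.comp F)) S (S.comp F) S)
        (.ex ?_)))).2
    have he' := he.comp (F.comp (F.comp F) : Computable fun x : ((α × ℕ) × ℕ) × ℕ => x.1.1.1)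
    exact (sigmaPred_inDom he' S).and (sigmaPred_addRel he' (S.comp F) S (S.comp (F.comp F)))
  refine (h1.and (h2.and (h3.and (h4.and h5)))).of_eq fun x => ?_
  exact ⟨fun ⟨h1, h2, h3, h4, h5⟩ => ⟨h1, h2, h3, h4, h5⟩,
    fun ⟨h1, h2, h3, h4, h5⟩ => ⟨h1, h2, h3, h4, h5⟩⟩

/-- Here four quantifier blocks arise: divisibility is Π⁰₂, the existence of `p` or of `v, w` makes
Σ⁰₃, and the quantifier over `b, u` makes Π⁰₄. -/
theorem piPred_liftsUnitsIndex (he : Computable e) :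
    PiPred X 4 fun x => LiftsUnitsIndex X (e x) := by
  have F {γ δ : Type _} [Primcodable γ] [Primcodable δ] : Computable (@Prod.fst γ δ) :=
    Computable.fst
  have S {γ δ : Type _} [Primcodable γ] [Primcodable δ] : Computable (@Prod.snd γ δ) :=
    Computable.snd
  have N : Computable Nat.succ := Computable.succ
  refine .all (.all (SigmaPred.pi_succ ?_))
  have hcop : DeltaTwoPred X fun x : (α × ℕ) × ℕ => x.2.Coprime (x.1.2 + 1) := by
    refine .of_computablePred ⟨inferInstance, ?_⟩
    exact primrecRel_coprime.decide.to_comp.comp S (N.comp (S.comp F))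
  refine SigmaPred.of_eq (p := fun x : (α × ℕ) × ℕ => ¬ x.2.Coprime (x.1.2 + 1) ∨ (_ ∨ _))
    (.or hcop.not.1.succ (.or (.ex ?_) (.ex (.ex ?_)))) fun x => imp_iff_not_or.symm
  · refine .and (SigmaPred.of_computablePred ?_).succ.succ.succ
      (piPred_divIndex (he.comp (F.comp (F.comp F))) (N.comp S)).sigma_succ
    exact ⟨inferInstance, primrecRel_dvd.decide.to_comp.comp (N.comp (N.comp S))
      (N.comp (S.comp (F.comp F)))⟩
  · have he' := he.comp (F.comp (F.comp (F.comp F)) :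
      Computable fun x : (((α × ℕ) × ℕ) × ℕ) × ℕ => x.1.1.1.1)
    refine .and (piPred_divIndex he' (S.comp F)).sigma_succ (.and
      (piPred_divIndex he' S).sigma_succ (SigmaPred.of_computablePred ?_).succ.succ.succ)
    let γ := ((ℕ × ℕ) × ℕ) × ℕ
    have hp : PrimrecPred fun y : γ => y.1.2 + 1 ≡ y.1.1.2 * (y.2 + 1) [MOD y.1.1.1 + 1] ∨
        y.1.1.1 + 1 ∣ y.1.2 + 1 + y.1.1.2 * (y.2 + 1) := by
      have q1 : Primrec fun y : γ => y.1.1.1 + 1 :=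
        Primrec.succ.comp (Primrec.fst.comp (Primrec.fst.comp Primrec.fst))
      have q2 : Primrec fun y : γ => y.1.2 + 1 := Primrec.succ.comp (Primrec.snd.comp Primrec.fst)
      have q3 : Primrec fun y : γ => y.1.1.2 * (y.2 + 1) :=
        Primrec.nat_mul.comp (Primrec.snd.comp (Primrec.fst.comp Primrec.fst))
          (Primrec.succ.comp Primrec.snd)
      exact (primrecPred_modEq q2 q3 q1).or (primrecRel_dvd.comp q1 (Primrec.nat_add.comp q2 q3))
    obtain ⟨_, hp⟩ := hp
    exact ⟨fun _ => Classical.dec _, (hp.to_comp.comp (((S.comp (F.comp (F.comp F))).pair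
      (S.comp (F.comp F))).pair (S.comp F) |>.pair S) : Computable fun
        x : (((α × ℕ) × ℕ) × ℕ) × ℕ => _).of_eq fun x => by simp⟩

end Complexity

/-! ### Agreement of the arithmetical predicates with the algebraic ones. -/

theorem IsGroupIndex.exists_isComputableGroup {X : ℕ → ℕ} {e : ℕ} (h : IsGroupIndex X e) :
    ∃ inst : AddCommGroup (structDomain X e), IsComputableGroup X e inst := by
  choose! add hadd using h.add
  obtain ⟨z, hz, hz'⟩ := h.zero
  choose! neg hneg using fun a ha => (hz' a ha).2
  let D := structDomain X e
  have key : ∀ {a b c d : ℕ}, AddRel X e a b c → AddRel X e a b d → c = d :=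
    fun h1 h2 => Part.mem_unique h1 h2
  let iadd : Add D := ⟨fun a b => ⟨add a b, (hadd a b a.2 b.2).1⟩⟩
  let izero : Zero D := ⟨⟨z, hz⟩⟩
  let ineg : Neg D := ⟨fun a => ⟨neg a, (hneg a a.2).1⟩⟩
  have hcomm : ∀ a b : D, a + b = b + a := fun a b => Subtype.ext
    (key (h.comm _ _ _ a.2 b.2 (hadd a b a.2 b.2).2) (hadd b a b.2 a.2).2)
  have hassoc : ∀ a b c : D, a + b + c = a + (b + c) := fun a b c => Subtype.ext
    (key (h.assoc a b c _ _ _ a.2 b.2 c.2 (hadd a b a.2 b.2).2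
      (hadd (a + b : D) c (a + b).2 c.2).2 (hadd b c b.2 c.2).2)
      (hadd a (b + c : D) a.2 (b + c).2).2)
  have hzero : ∀ a : D, 0 + a = a := fun a => by
    rw [hcomm]
    exact Subtype.ext (key (hadd a z a.2 hz).2 (hz' a a.2).1)
  have hinv : ∀ a : D, -a + a = 0 := fun a => by
    rw [hcomm]
    exact Subtype.ext (key (hadd a (neg a) a.2 (hneg a a.2).1).2 (hneg a a.2).2)
  let G : AddGroup D := AddGroup.ofLeftAxioms hassoc hzero hinv
  exact ⟨{ G with add_comm := hcomm }, h.total, fun a b => (hadd a b a.2 b.2).2⟩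

section

variable {X : ℕ → ℕ} {e : ℕ} {inst : AddCommGroup (structDomain X e)}

namespace IsComputableGroup

theorem addRel_iff (h : IsComputableGroup X e inst) (a b : structDomain X e) {c : ℕ} :
    AddRel X e a b c ↔ ((a + b : structDomain X e) : ℕ) = c :=
  ⟨fun hc => Part.mem_unique (h.2 a b) hc, fun hc => hc ▸ h.2 a b⟩

theorem smulRel_iff (h : IsComputableGroup X e inst) (k : ℕ) (a : structDomain X e) {b : ℕ} :
    SmulRel X e k a b ↔ (((k + 1) • a : structDomain X e) : ℕ) = b := by
  have : nsmulSucc X (Nat.pair (Nat.pair e a) k) =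
      Part.some (((k + 1) • a : structDomain X e) : ℕ) := by
    unfold nsmulSucc
    simp only [Nat.unpair_pair]
    induction k with
    | zero => simp
    | succ k ih =>
      simp only [ih, Part.bind_some]
      rw [succ_nsmul a (k + 1)]
      exact Part.eq_some_iff.2 (h.2 _ _)
  unfold SmulRel
  rw [this, Part.mem_some_iff, eq_comm]

/-- The relation has no name for zero. It recognizes zero as the only idempotent, and negative
multiples as elements whose sum with a positive multiple is idempotent. -/
theorem multipleRel_iff (h : IsComputableGroup X e inst) (g c : structDomain X e) :
    MultipleRel X e g c ↔ ∃ m : ℤ, m • g = c := by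
  unfold MultipleRel
  constructor
  · rintro (h1 | ⟨l, d, h1, h2⟩)
    · have := Subtype.ext ((h.addRel_iff c c).1 h1)
      exact ⟨0, by simpa [eq_comm] using this⟩
    · rw [h.smulRel_iff] at h1
      subst h1
      rcases h2 with h2 | ⟨z, h2, h3⟩
      · exact ⟨(l + 1 : ℕ), by rw [natCast_zsmul]; exact Subtype.ext h2⟩
      · rw [h.addRel_iff] at h2
        subst h2
        rw [h.addRel_iff] at h3
        have := Subtype.ext h3
        rw [add_eq_left] at this
        exact ⟨-(l + 1 : ℕ), by
          rw [neg_smul, natCast_zsmul]; exact (eq_neg_of_add_eq_zero_left this).symm⟩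
  · rintro ⟨m, rfl⟩
    rcases lt_trichotomy m 0 with hm | rfl | hm
    · obtain ⟨l, hl⟩ : ∃ l : ℕ, m = -((l + 1 : ℕ) : ℤ) := ⟨(-m).toNat - 1, by omega⟩
      subst hl
      refine .inr ⟨l, _, (h.smulRel_iff l g).2 rfl, .inr ⟨(0 : structDomain X e), ?_, ?_⟩⟩
      · rw [h.addRel_iff, neg_smul, natCast_zsmul, neg_add_cancel]
      · rw [h.addRel_iff, add_zero]
    · left
      rw [h.addRel_iff]; simp
    · obtain ⟨l, hl⟩ : ∃ l : ℕ, m = ((l + 1 : ℕ) : ℤ) := ⟨m.toNat - 1, by omega⟩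
      subst hl
      exact .inr ⟨l, _, (h.smulRel_iff l g).2 rfl, .inl (by rw [natCast_zsmul])⟩

theorem isGroupIndex (h : IsComputableGroup X e inst) : IsGroupIndex X e := by
  refine ⟨h.1, fun a b ha hb => ?_, fun a b c ha hb hc => ?_,
    fun a b c x y z ha hb hc hx hy hz => ?_, ?_⟩
  · exact ⟨_, Subtype.property _, (h.addRel_iff ⟨a, ha⟩ ⟨b, hb⟩).2 rfl⟩
  · rw [h.addRel_iff ⟨a, ha⟩ ⟨b, hb⟩] at hc
    rw [h.addRel_iff ⟨b, hb⟩ ⟨a, ha⟩, add_comm, hc]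
  · rw [h.addRel_iff ⟨a, ha⟩ ⟨b, hb⟩] at hx
    subst hx
    rw [h.addRel_iff ⟨b, hb⟩ ⟨c, hc⟩] at hz
    subst hz
    rw [h.addRel_iff _ ⟨c, hc⟩] at hy
    rw [h.addRel_iff ⟨a, ha⟩, ← add_assoc, hy]
  · obtain ⟨z, hz⟩ : ∃ z : structDomain X e, z = 0 := ⟨_, rfl⟩
    refine ⟨z, z.2, fun a ha => ⟨?_, ?_⟩⟩
    · rw [h.addRel_iff ⟨a, ha⟩ z, hz, add_zero]
    · obtain ⟨b, hb⟩ : ∃ b : structDomain X e, ⟨a, ha⟩ + b = z :=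
        ⟨-⟨a, ha⟩, by rw [hz, add_neg_cancel]⟩
      exact ⟨b, b.2, (h.addRel_iff ⟨a, ha⟩ b).2 (congrArg Subtype.val hb)⟩

theorem isRankOneIndex_iff (h : IsComputableGroup X e inst) :
    IsRankOneIndex X e ↔ IsTorsionFreeRankOne (structDomain X e) := by
  rw [isTorsionFreeRankOne_iff]
  unfold IsRankOneIndex
  refine and_congr ?_ ?_
  · constructor
    · intro hT
      refine ⟨fun n hn a b hab => ?_⟩
      obtain ⟨k, rfl⟩ := Nat.exists_eq_succ_of_ne_zero hn
      exact Subtype.ext (hT k a b _ a.2 b.2 ((h.smulRel_iff k a).2 rfl)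
        ((h.smulRel_iff k b).2 (congrArg Subtype.val hab.symm)))
    · intro hT k a b c ha hb h1 h2
      rw [h.smulRel_iff k ⟨a, ha⟩] at h1
      rw [h.smulRel_iff k ⟨b, hb⟩] at h2
      have := hT.nsmul_right_injective (n := k + 1) (by omega) (Subtype.ext (h1.trans h2.symm))
      exact congrArg Subtype.val this
  · constructor
    · rintro ⟨g, hg, hg0, hall⟩
      refine ⟨⟨g, hg⟩, fun h0 => hg0 ?_, fun a => ?_⟩
      · rw [h.addRel_iff ⟨g, hg⟩ ⟨g, hg⟩, h0, add_zero, ← h0]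
      · obtain ⟨k, c, h1, h2⟩ := hall a a.2
        rw [h.smulRel_iff] at h1
        subst h1
        obtain ⟨m, hm⟩ := (h.multipleRel_iff ⟨g, hg⟩ _).1 h2
        exact ⟨(k + 1 : ℕ), m, by omega, by rw [natCast_zsmul, hm]⟩
    · rintro ⟨g, hg0, hall⟩
      refine ⟨g, g.2, fun h0 => hg0 ?_, fun a ha => ?_⟩
      · have := Subtype.ext ((h.addRel_iff g g).1 h0)
        rwa [add_eq_left] at this
      · obtain ⟨n, m, hn, hnm⟩ := hall ⟨a, ha⟩
        obtain ⟨k, hk⟩ : ∃ k, n.natAbs = k + 1 :=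
          Nat.exists_eq_succ_of_ne_zero (Int.natAbs_ne_zero.2 hn)
        refine ⟨k, _, (h.smulRel_iff k ⟨a, ha⟩).2 rfl, (h.multipleRel_iff g _).2 ?_⟩
        rw [← hk, ← natCast_zsmul]
        rcases Int.natAbs_eq n with h1 | h1
        · exact ⟨m, by rw [← h1, hnm]⟩
        · refine ⟨-m, ?_⟩
          have h2 : (n.natAbs : ℤ) = -n := by omega
          rw [h2, neg_smul, neg_smul, hnm]

theorem isCyclicIndex_iff (h : IsComputableGroup X e inst) :
    IsCyclicIndex X e ↔ IsAddCyclic (structDomain X e) := by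
  constructor
  · rintro ⟨g, hg, hall⟩
    exact ⟨⟨g, hg⟩, fun a => (h.multipleRel_iff ⟨g, hg⟩ a).1 (hall a a.2)⟩
  · rintro ⟨g, hg⟩
    exact ⟨g, g.2, fun a ha => (h.multipleRel_iff g ⟨a, ha⟩).2 (hg _)⟩

theorem divIndex_iff (h : IsComputableGroup X e inst) (k : ℕ) :
    DivIndex X e k ↔ DivBy (structDomain X e) (k + 1) := by
  constructor
  · intro hd a
    obtain ⟨c, hc, h1⟩ := hd a a.2
    exact ⟨⟨c, hc⟩, Subtype.ext ((h.smulRel_iff k ⟨c, hc⟩).1 h1)⟩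
  · intro hd a ha
    obtain ⟨c, hc⟩ := hd ⟨a, ha⟩
    exact ⟨c, c.2, (h.smulRel_iff k c).2 (congrArg Subtype.val hc)⟩

theorem liftsUnitsIndex_iff (h : IsComputableGroup X e inst) :
    LiftsUnitsIndex X e ↔ LiftsUnits (structDomain X e) := by
  unfold LiftsUnitsIndex LiftsUnits
  simp only [h.divIndex_iff]
  constructor
  · intro hL b u hb hu
    obtain ⟨b, rfl⟩ := Nat.exists_eq_succ_of_ne_zero hb.ne'
    rcases hL b u hu with ⟨p, h1, h2⟩ | ⟨v, w, h1, h2, h3⟩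
    · exact .inl ⟨p + 2, by omega, h1, h2⟩
    · exact .inr ⟨v + 1, w + 1, by omega, by omega, h1, h2, h3⟩
  · intro hL b u hu
    rcases hL (b + 1) u (by omega) hu with ⟨p, h0, h1, h2⟩ | ⟨v, w, h0, h0', h1, h2, h3⟩
    · obtain ⟨p, rfl⟩ := Nat.exists_eq_add_of_le' h0
      exact .inl ⟨p, h1, h2⟩
    · obtain ⟨v, rfl⟩ := Nat.exists_eq_succ_of_ne_zero h0.ne'
      obtain ⟨w, rfl⟩ := Nat.exists_eq_succ_of_ne_zero h0'.ne'
      exact .inr ⟨v, w, h1, h2, h3⟩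

end IsComputableGroup

theorem mem_cancellableIndexSet_iff :
    e ∈ cancellableIndexSet.{u} X ↔
      IsGroupIndex X e ∧ IsRankOneIndex X e ∧ (IsCyclicIndex X e ∨ LiftsUnitsIndex X e) := by
  constructor
  · rintro ⟨inst, h, h1, h2⟩
    refine ⟨h.isGroupIndex, h.isRankOneIndex_iff.2 h1, ?_⟩
    rw [h.isCyclicIndex_iff, h.liftsUnitsIndex_iff]
    exact (isCancellable_iff h1).1 h2
  · rintro ⟨hG, h1, h2⟩
    obtain ⟨inst, h⟩ := hG.exists_isComputableGroup
    rw [h.isRankOneIndex_iff] at h1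
    rw [h.isCyclicIndex_iff, h.liftsUnitsIndex_iff] at h2
    exact ⟨inst, h, h1, (isCancellable_iff h1).2 h2⟩

end

theorem isPi_cancellableIndexSet (X : ℕ → ℕ) : IsPi X 4 (cancellableIndexSet.{u} X) := by
  have hid : Computable (id : ℕ → ℕ) := Computable.id
  have h := (piPred_isGroupIndex (X := X) hid).and ((piPred_isRankOneIndex hid).and
    ((sigmaPred_isCyclicIndex hid).pi_succ.or (piPred_liftsUnitsIndex hid)))
  have := h id hid
  unfold IsPi
  convert! this using 1
  ext e
  exact not_congr mem_cancellableIndexSet_iff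

/-! ### The sequence of primes -/

/-- The request with number `s` is a pair of a modulus and a residue coprime to it. -/
def ActiveRequest (s : ℕ) : Prop := 0 < s.unpair.1 ∧ s.unpair.2.unpair.1.Coprime s.unpair.1

instance : DecidablePred ActiveRequest := fun s =>
  inferInstanceAs (Decidable (0 < s.unpair.1 ∧ s.unpair.2.unpair.1.Coprime s.unpair.1))

/-- The modulus of the request with number `s`, and `4` if there is none. -/
def requestModulus (s : ℕ) : ℕ := if ActiveRequest s then s.unpair.1 else 4

/-- The residue of the request with number `s`, and `1` if there is none. -/
def requestResidue (s : ℕ) : ℕ := if ActiveRequest s then s.unpair.2.unpair.1 else 1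

theorem requestModulus_pos (s : ℕ) : 0 < requestModulus s := by
  unfold requestModulus; split_ifs with h
  · exact h.1
  · norm_num

theorem requestResidue_coprime (s : ℕ) : (requestResidue s).Coprime (requestModulus s) := by
  unfold requestModulus requestResidue; split_ifs with h
  · exact h.2
  · norm_num

/-- `r` is a large prime that fulfils the request with number `s` and is trivial modulo the
divisors of `M` coprime to the modulus of that request. -/
def IsRequestedPrime (s M r : ℕ) : Prop :=
  r.Prime ∧ M + 2 < r ∧ r ≡ requestResidue s [MOD requestModulus s] ∧
    ∀ d < M + 1, 0 < d → d ∣ M → d.Coprime (requestModulus s) → r ≡ 1 [MOD d]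

/-- The product `D` of the relevant divisors of `M` is coprime to the modulus, so the Chinese
remainder theorem combines the congruences into one unit class. Dirichlet's theorem gives a large
prime in it. -/
theorem exists_isRequestedPrime (s M : ℕ) : ∃ r, IsRequestedPrime s M r := by
  classical
  set b := requestModulus s with hb
  set F := (Finset.range (M + 1)).filter fun d => 0 < d ∧ d ∣ M ∧ d.Coprime b with hF
  set D := ∏ d ∈ F, d with hD
  have hDb : b.Coprime D := Nat.Coprime.prod_right fun d hd =>
    ((Finset.mem_filter.1 hd).2.2.2).symm
  have hD0 : D ≠ 0 := Finset.prod_ne_zero_iff.2 fun d hd => (Finset.mem_filter.1 hd).2.1.ne'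
  have hb0 : b ≠ 0 := (requestModulus_pos s).ne'
  obtain ⟨a, ha1, ha2⟩ := Nat.chineseRemainder hDb (requestResidue s) 1
  have hac : a.Coprime (b * D) := by
    refine Nat.Coprime.mul_right ?_ ?_
    · have := ha1.gcd_eq
      rw [requestResidue_coprime s] at this
      exact this
    · have := ha2.gcd_eq
      rw [Nat.gcd_one_left] at this
      exact this
  obtain ⟨r, hr, hrp, hra⟩ :=
    Nat.forall_exists_prime_gt_and_modEq (M + 2) (mul_ne_zero hb0 hD0) hac
  refine ⟨r, hrp, hr, (hra.of_dvd (dvd_mul_right b D)).trans ha1, fun d hd hd0 hdM hdb => ?_⟩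
  have hdD : d ∣ D := Finset.dvd_prod_of_mem (fun d => d)
    (Finset.mem_filter.2 ⟨Finset.mem_range.2 hd, hd0, hdM, hdb⟩)
  exact ((hra.of_dvd (dvd_mul_left D b)).trans ha2).of_dvd hdD

theorem primrecPred_prime : PrimrecPred Nat.Prime := by
  have h : PrimrecRel fun d r : ℕ => ¬ d ∣ r ∨ d = 1 :=
    (primrecRel_dvd.comp Primrec.fst Primrec.snd).not.or
      (Primrec.eq.comp Primrec.fst (Primrec.const 1))
  refine ((Primrec.nat_le.comp (Primrec.const 2) Primrec.id).and
    (h.forall_lt.comp Primrec.id Primrec.id)).of_eq fun r => ?_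
  rw [Nat.prime_def_lt]
  refine and_congr_right fun _ => forall_congr' fun d => imp_congr_right fun _ => ?_
  rw [imp_iff_not_or]
  rfl

theorem primrecPred_activeRequest : PrimrecPred ActiveRequest :=
  (Primrec.nat_lt.comp (Primrec.const 0) Primrec.unpair_fst).and
    (primrecRel_coprime.comp (Primrec.unpair_fst.comp Primrec.unpair_snd) Primrec.unpair_fst)

theorem primrec_requestModulus : Primrec requestModulus :=
  Primrec.ite primrecPred_activeRequest Primrec.unpair_fst (Primrec.const 4)

theorem primrec_requestResidue : Primrec requestResidue :=
  Primrec.ite primrecPred_activeRequest (Primrec.unpair_fst.comp Primrec.unpair_snd)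
    (Primrec.const 1)

theorem primrecPred_isRequestedPrime :
    PrimrecPred fun p : (ℕ × ℕ) × ℕ => IsRequestedPrime p.1.1 p.1.2 p.2 := by
  have hs : Primrec fun p : (ℕ × ℕ) × ℕ => p.1.1 := Primrec.fst.comp Primrec.fst
  have hM : Primrec fun p : (ℕ × ℕ) × ℕ => p.1.2 := Primrec.snd.comp Primrec.fst
  have h : PrimrecRel fun d q : ℕ => ¬ 0 < d ∨ ¬ d ∣ q.unpair.1 ∨
      ¬ d.Coprime q.unpair.2.unpair.1 ∨ q.unpair.2.unpair.2 ≡ 1 [MOD d] := by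
    have h1 : Primrec fun x : ℕ × ℕ => x.2.unpair.1 := Primrec.unpair_fst.comp Primrec.snd
    have h2 : Primrec fun x : ℕ × ℕ => x.2.unpair.2 := Primrec.unpair_snd.comp Primrec.snd
    exact (Primrec.nat_lt.comp (Primrec.const 0) Primrec.fst).not.or
      ((primrecRel_dvd.comp Primrec.fst h1).not.or
      ((primrecRel_coprime.comp Primrec.fst (Primrec.unpair_fst.comp h2)).not.or
      (primrecPred_modEq (Primrec.unpair_snd.comp h2) (Primrec.const 1) Primrec.fst)))
  have hb := primrec_requestModulus.comp hs
  refine ((primrecPred_prime.comp Primrec.snd).and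
    ((Primrec.nat_lt.comp (Primrec.nat_add.comp hM (Primrec.const 2)) Primrec.snd).and
    ((primrecPred_modEq Primrec.snd (primrec_requestResidue.comp hs) hb).and
    (h.forall_lt.comp (Primrec.succ.comp hM) (Primrec₂.natPair.comp hM
      (Primrec₂.natPair.comp hb Primrec.snd)))))).of_eq fun p => ?_
  unfold IsRequestedPrime
  simp only [Nat.unpair_pair, imp_iff_not_or]

open Classical in
/-- The least prime fulfilling request `s`, given the product `M` of the previous primes. -/
noncomputable def nextPrime (s M : ℕ) : ℕ := Nat.find (exists_isRequestedPrime s M)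

theorem nextPrime_spec (s M : ℕ) : IsRequestedPrime s M (nextPrime s M) := by
  classical
  exact Nat.find_spec (exists_isRequestedPrime s M)

theorem computable_nextPrime : Computable fun p : ℕ × ℕ => nextPrime p.1 p.2 := by
  classical
  exact Computable.find (P := fun (p : ℕ × ℕ) r => IsRequestedPrime p.1 p.2 r)
    primrecPred_isRequestedPrime.computablePred fun p => exists_isRequestedPrime p.1 p.2

/-- The product of the first `s` primes of the sequence. -/
noncomputable def primeProd (s : ℕ) : ℕ := Nat.rec 1 (fun i M => M * nextPrime i M) s

/-- The sequence of primes. -/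
noncomputable def primeSeq (s : ℕ) : ℕ := nextPrime s (primeProd s)

theorem primeProd_succ (s : ℕ) : primeProd (s + 1) = primeProd s * primeSeq s := rfl

theorem computable_primeSeq : Computable primeSeq := by
  have h : Computable primeProd := Computable.nat_rec Computable.id (Computable.const 1)
    (h := fun _ x => x.2 * nextPrime x.1 x.2)
    (Primrec.nat_mul.to_comp.comp (Computable.snd.comp Computable.snd)
      (computable_nextPrime.comp ((Computable.fst.comp Computable.snd).pair
        (Computable.snd.comp Computable.snd))))
  exact computable_nextPrime.comp (Computable.id.pair h)

theorem primeSeq_prime (s : ℕ) : (primeSeq s).Prime := (nextPrime_spec s _).1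

theorem primeProd_pos (s : ℕ) : 0 < primeProd s := by
  induction s with
  | zero => exact one_pos
  | succ s ih => exact Nat.mul_pos ih (primeSeq_prime s).pos

/-- All earlier primes divide the product, so the sequence increases; the margin 2 keeps its members
odd. -/
theorem primeProd_lt (s : ℕ) : primeProd s + 2 < primeSeq s := (nextPrime_spec s _).2.1

theorem primeSeq_dvd_primeProd {t s : ℕ} (h : t < s) : primeSeq t ∣ primeProd s := by
  induction s with
  | zero => omega
  | succ s ih =>
    rw [primeProd_succ]
    rcases Nat.lt_succ_iff_lt_or_eq.1 h with h | rfl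
    · exact (ih h).mul_right _
    · exact dvd_mul_left _ _

theorem primeSeq_strictMono : StrictMono primeSeq := by
  intro t s h
  have := Nat.le_of_dvd (primeProd_pos s) (primeSeq_dvd_primeProd h)
  have := primeProd_lt s
  omega

theorem primeSeq_ne_two (s : ℕ) : primeSeq s ≠ 2 := by
  have := primeProd_lt s
  omega

theorem primeSeq_modEq_of_active {s : ℕ} (h : ActiveRequest s) :
    primeSeq s ≡ s.unpair.2.unpair.1 [MOD s.unpair.1] := by
  have := (nextPrime_spec s (primeProd s)).2.2.1
  rwa [requestModulus, requestResidue, if_pos h, if_pos h] at this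

theorem primeSeq_modEq_four {s : ℕ} (h : ¬ ActiveRequest s) : primeSeq s ≡ 1 [MOD 4] := by
  have := (nextPrime_spec s (primeProd s)).2.2.1
  rwa [requestModulus, requestResidue, if_neg h, if_neg h] at this

theorem primeSeq_modEq_one {t s : ℕ} (h : t < s) (hc : (primeSeq t).Coprime (requestModulus s)) :
    primeSeq s ≡ 1 [MOD primeSeq t] := by
  have hd := primeSeq_dvd_primeProd h
  have := Nat.le_of_dvd (primeProd_pos s) hd
  exact (nextPrime_spec s (primeProd s)).2.2.2 _ (by omega) (primeSeq_prime t).pos hd hc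

instance (s : ℕ) : Fact (primeSeq s).Prime := ⟨primeSeq_prime s⟩

/-- Modulo a prime of the sequence without request, all primes of the sequence are squares, except
those requested for a modulus that this prime divides. -/
theorem isSquare_primeSeq {s t : ℕ} (hs : ¬ ActiveRequest s) (ht : ActiveRequest t)
    (hdvd : ¬ primeSeq s ∣ t.unpair.1) : IsSquare (primeSeq t : ZMod (primeSeq s)) := by
  have h4 := primeSeq_modEq_four hs
  -- A later prime is 1 modulo `primeSeq s` by construction. For an earlier one, reciprocity with
  -- `primeSeq s ≡ 1` modulo 4 reverses the roles, and `primeSeq s` is 1 modulo the earlier prime.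
  rcases lt_trichotomy s t with h | rfl | h
  · have hc : (primeSeq s).Coprime (requestModulus t) := by
      rw [requestModulus, if_pos ht]
      exact (primeSeq_prime s).coprime_iff_not_dvd.2 hdvd
    have := (ZMod.natCast_eq_natCast_iff _ _ _).2 (primeSeq_modEq_one h hc)
    rw [this]
    exact ⟨1, by simp⟩
  · exact absurd ht hs
  · rw [ZMod.exists_sq_eq_prime_iff_of_mod_four_eq_one h4 (primeSeq_ne_two t)]
    have hc : (primeSeq t).Coprime (requestModulus s) := by
      rw [requestModulus, if_neg hs]
      have : (primeSeq t).Coprime (2 ^ 2) := Nat.Coprime.pow_right _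
        ((Nat.coprime_primes (primeSeq_prime t) Nat.prime_two).2 (primeSeq_ne_two t))
      exact this
    have := (ZMod.natCast_eq_natCast_iff _ _ _).2 (primeSeq_modEq_one h hc)
    rw [this]
    exact ⟨1, by simp⟩

theorem isSquare_neg_one_primeSeq {s : ℕ} (hs : ¬ ActiveRequest s) :
    IsSquare (-1 : ZMod (primeSeq s)) := by
  rw [ZMod.exists_sq_eq_neg_one_iff]
  have : primeSeq s % 4 = 1 := primeSeq_modEq_four hs
  omega

/-! ### The groups coding a set -/

/-- The `m`-th entry of the list of witnesses belonging to request `i`. -/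
def witness (i m : ℕ) : ℕ := (Denumerable.ofNat (List ℕ) i.unpair.2.unpair.2).getD m 0

/-- The `s`-th condition for inverting the `i`-th prime of the sequence in the `n`-th group. -/
def Permits (c : ℕ → ℕ) (n i s : ℕ) : Prop :=
  ActiveRequest i ∧ ∀ m < i.unpair.1 - 1,
    ∃ t, c (Nat.pair (Nat.pair (Nat.pair (Nat.pair n m) (witness i m)) s) t) = 0

/-- The product of powers of the first `N` primes of the sequence with exponents `e`. -/
noncomputable def primePowProd (N : ℕ) (e : ℕ → ℕ) : ℕ := ∏ i ∈ Finset.range N, primeSeq i ^ e i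

theorem primePowProd_pos (N : ℕ) (e : ℕ → ℕ) : 0 < primePowProd N e :=
  Finset.prod_pos fun i _ => pow_pos (primeSeq_prime i).pos _

theorem primePowProd_dvd {N N' : ℕ} {e e' : ℕ → ℕ} (hN : N ≤ N') (he : ∀ i, e i ≤ e' i) :
    primePowProd N e ∣ primePowProd N' e' :=
  (Finset.prod_dvd_prod_of_dvd _ _ fun i _ => pow_dvd_pow _ (he i)).trans
    (Finset.prod_dvd_prod_of_subset _ _ _ (Finset.range_mono hN))

theorem exists_of_prime_pow_dvd_primePowProd {N : ℕ} {e : ℕ → ℕ} {p m : ℕ} (hp : p.Prime)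
    (hm : 0 < m) (h : p ^ m ∣ primePowProd N e) : ∃ i, p = primeSeq i ∧ m ≤ e i := by
  obtain ⟨i, hi, hpi⟩ := (hp.prime.dvd_finsetProd_iff _).1 ((dvd_pow_self p hm.ne').trans h)
  have hpe : p = primeSeq i :=
    (Nat.prime_dvd_prime_iff_eq hp (primeSeq_prime i)).1 (hp.dvd_of_dvd_pow hpi)
  refine ⟨i, hpe, ?_⟩
  have hc : (p ^ m).Coprime (∏ j ∈ (Finset.range N).erase i, primeSeq j ^ e j) := by
    refine Nat.Coprime.prod_right fun j hj => Nat.Coprime.pow _ _ ?_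
    rw [hpe]
    exact (Nat.coprime_primes (primeSeq_prime i) (primeSeq_prime j)).2 fun hij =>
      (Finset.mem_erase.1 hj).1 (primeSeq_strictMono.injective hij).symm
  unfold primePowProd at h
  rw [← Finset.mul_prod_erase _ _ hi] at h
  have := hc.dvd_of_dvd_mul_right h
  rw [hpe] at this
  exact (Nat.pow_dvd_pow_iff_le_right (primeSeq_prime i).one_lt).1 this

/-- The group in which the `i`-th prime of the sequence is invertible if all its conditions are
permitted. -/
def codingGroup (c : ℕ → ℕ) (n : ℕ) : AddSubgroup ℚ where
  carrier := {x | ∃ N e, (∀ i s, s < e i → Permits c n i s) ∧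
    ∃ a : ℤ, (primePowProd N e : ℚ) * x = a}
  add_mem' := by
    rintro x y ⟨N, e, he, a, ha⟩ ⟨N', e', he', a', ha'⟩
    obtain ⟨d, hd⟩ : primePowProd N e ∣ primePowProd (max N N') fun i => max (e i) (e' i) :=
      primePowProd_dvd (le_max_left _ _) fun _ => le_max_left _ _
    obtain ⟨d', hd'⟩ : primePowProd N' e' ∣ primePowProd (max N N') fun i => max (e i) (e' i) :=
      primePowProd_dvd (le_max_right _ _) fun _ => le_max_right _ _
    refine ⟨max N N', fun i => max (e i) (e' i), fun i s hs => ?_, a * d + a' * d', ?_⟩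
    · exact (lt_max_iff.1 hs).elim (he i s) (he' i s)
    · rw [mul_add]
      nth_rw 1 [hd]
      rw [hd']
      push_cast
      rw [← ha, ← ha']
      ring
  zero_mem' := ⟨0, 0, by simp, 0, by simp⟩
  neg_mem' := by
    rintro x ⟨N, e, he, a, ha⟩
    exact ⟨N, e, he, -a, by rw [mul_neg, ha]; simp⟩

section

variable {c : ℕ → ℕ} {n : ℕ}

theorem one_mem_codingGroup : (1 : ℚ) ∈ codingGroup c n :=
  ⟨0, 0, by simp, 1, by simp [primePowProd]⟩

/-- The exponent at `i` may be raised by one in any permitted denominator. -/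
theorem inv_primeSeq_mem_multipliers {i : ℕ} (h : ∀ s, Permits c n i s) :
    (primeSeq i : ℚ)⁻¹ ∈ (codingGroup c n).multipliers := by
  rintro x ⟨N, e, he, a, ha⟩
  let e' : ℕ → ℕ := fun j => if j = i then e i + 1 else e j
  have hq : (primeSeq i : ℚ) ≠ 0 := by exact_mod_cast (primeSeq_prime i).ne_zero
  obtain ⟨d, hd⟩ : primePowProd N e * primeSeq i ∣ primePowProd (max N (i + 1)) e' := by
    unfold primePowProd
    have hi : i ∈ Finset.range (max N (i + 1)) := Finset.mem_range.2 (by omega)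
    have h1 := primePowProd_dvd (e := e) (le_max_left N (i + 1)) (fun _ => le_rfl)
    unfold primePowProd at h1
    refine (mul_dvd_mul_right h1 _).trans ?_
    rw [← Finset.mul_prod_erase _ _ hi, ← Finset.mul_prod_erase _ (fun j => primeSeq j ^ e' j) hi]
    simp only [e', if_true]
    rw [pow_succ, mul_right_comm]
    refine mul_dvd_mul_left _ (dvd_of_eq (Finset.prod_congr rfl fun j hj => ?_))
    rw [if_neg (Finset.mem_erase.1 hj).1]
  refine ⟨max N (i + 1), e', fun j s hs => ?_, a * d, ?_⟩
  · by_cases hj : j = i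
    · rw [hj]; exact h s
    · simp only [e', if_neg hj] at hs
      exact he j s hs
  · rw [hd]
    push_cast
    rw [← ha]
    field_simp

/-- All powers of the inverse of `p` lie in the group, as 1 does. A denominator divisible by `p ^ m`
needs the first `m` conditions to be permitted. -/
theorem exists_permits_of_inv_mem {p : ℕ} (hp : p.Prime)
    (h : (p : ℚ)⁻¹ ∈ (codingGroup c n).multipliers) :
    ∃ i, p = primeSeq i ∧ ∀ s, Permits c n i s := by
  have hpow : ∀ m, 0 < m → ∃ i, p = primeSeq i ∧ ∀ s < m, Permits c n i s := by
    intro m hm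
    have h1 := pow_mem h m 1 one_mem_codingGroup
    rw [mul_one, inv_pow] at h1
    obtain ⟨N, e, he, a, ha⟩ := h1
    have hp0 : (p : ℚ) ^ m ≠ 0 := pow_ne_zero _ (by exact_mod_cast hp.ne_zero)
    rw [← div_eq_mul_inv, div_eq_iff hp0] at ha
    have hd : p ^ m ∣ primePowProd N e := by
      rw [← Int.natCast_dvd_natCast]
      exact ⟨a, by push_cast; rw [mul_comm]; exact_mod_cast ha⟩
    obtain ⟨i, hi, hme⟩ := exists_of_prime_pow_dvd_primePowProd hp hm hd
    exact ⟨i, hi, fun s hs => he i s (by omega)⟩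
  obtain ⟨i, hi, -⟩ := hpow 1 one_pos
  refine ⟨i, hi, fun s => ?_⟩
  obtain ⟨j, hj, hs⟩ := hpow (s + 1) (by omega)
  rw [primeSeq_strictMono.injective (hi.symm.trans hj)]
  exact hs s (by omega)

theorem AddSubgroup.inv_mem_multipliers_of_divBy {A : AddSubgroup ℚ} {p v : ℕ} (hv : 0 < v)
    (h : DivBy A v) (hpv : p ∣ v) : (p : ℚ)⁻¹ ∈ A.multipliers :=
  inv_mem_multipliers_of_dvd hv hpv ((divBy_iff_inv_mem hv).1 h)

/-- A request with modulus 1 has no conditions on witnesses, so its prime is inverted in every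
coding group; no cyclic group of rank one is divisible by a prime. -/
theorem not_isAddCyclic_codingGroup : ¬ IsAddCyclic (codingGroup c n) := by
  rintro ⟨g, hg⟩
  let i := Nat.pair 1 0
  have hi : ∀ s, Permits c n i s := fun s => ⟨by simp [i, ActiveRequest], by simp [i]⟩
  have hinv := inv_primeSeq_mem_multipliers hi
  have hq0 : (primeSeq i : ℚ) ≠ 0 := by exact_mod_cast (primeSeq_prime i).ne_zero
  obtain ⟨k, hk⟩ := hg ⟨1, one_mem_codingGroup⟩
  obtain ⟨l, hl⟩ := hg ⟨_, hinv g g.2⟩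
  have hk' : (k : ℚ) * g = 1 := by simpa using congrArg Subtype.val hk
  have hl' : (l : ℚ) * g = (primeSeq i : ℚ)⁻¹ * g := by simpa using congrArg Subtype.val hl
  have hg0 : (g : ℚ) ≠ 0 := right_ne_zero_of_mul_eq_one hk'
  have h1 : (l : ℚ) * primeSeq i = 1 := by
    rw [mul_right_cancel₀ hg0 hl', inv_mul_cancel₀ hq0]
  have h2 : l * (primeSeq i : ℤ) = 1 := by exact_mod_cast h1
  have h3 : (primeSeq i : ℤ) ∣ 1 := ⟨l, by rw [mul_comm, h2]⟩
  exact (primeSeq_prime i).one_lt.ne' (Nat.dvd_one.1 (by exact_mod_cast h3))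

theorem liftsUnits_codingGroup
    (h : ∀ m, ∃ k, ∀ s, ∃ t, c (Nat.pair (Nat.pair (Nat.pair (Nat.pair n m) k) s) t) = 0) :
    LiftsUnits (codingGroup c n) := by
  intro b u hb hu
  choose k hk using h
  -- This request lists correct witnesses for all `m < b`, so its prime is inverted, and it is
  -- congruent to `u` modulo `b`.
  let i := Nat.pair b (Nat.pair u (Encodable.encode ((List.range b).map k)))
  have hact : ActiveRequest i := by simpa [i, ActiveRequest] using ⟨hb, hu⟩
  have hw : ∀ m < b, witness i m = k m := by
    intro m hm
    simp [witness, i, hm]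
  have hi : ∀ s, Permits c n i s := by
    refine fun s => ⟨hact, fun m hm => ?_⟩
    rw [hw m (by simp only [i, Nat.unpair_pair] at hm; omega)]
    exact hk m s
  have hpos := (primeSeq_prime i).pos
  refine .inr ⟨primeSeq i, 1, hpos, one_pos,
    (AddSubgroup.divBy_iff_inv_mem hpos).2 (inv_primeSeq_mem_multipliers hi),
    (AddSubgroup.divBy_iff_inv_mem one_pos).2 (by simp), .inl ?_⟩
  have := primeSeq_modEq_of_active hact
  simpa [i] using this

theorem not_liftsUnits_codingGroup {m : ℕ}
    (h : ∀ k, ∃ s, ∀ t, c (Nat.pair (Nat.pair (Nat.pair (Nat.pair n m) k) s) t) ≠ 0) :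
    ¬ LiftsUnits (codingGroup c n) := by
  intro hL
  -- Modulus 0 makes the request inactive; the second component forces the index, and with it the
  -- prime, to be at least `m + 2`.
  let s := Nat.pair 0 (m + 2)
  have hs : ¬ ActiveRequest s := by simp [s, ActiveRequest]
  have hsm : m + 2 ≤ primeSeq s := (Nat.right_le_pair 0 (m + 2)).trans primeSeq_strictMono.le_apply
  -- If `primeSeq s` divided the modulus of an inverted prime, that modulus would be at least `m +
  -- 2`, and its conditions would include the failing `m`.
  have hunit : ∀ i, (∀ s, Permits c n i s) → i ≠ s ∧ IsSquare (primeSeq i : ZMod (primeSeq s)) := by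
    intro i hi
    refine ⟨fun his => hs (his ▸ (hi 0).1), isSquare_primeSeq hs (hi 0).1 fun hd => ?_⟩
    have hle := Nat.le_of_dvd (hi 0).1.1 hd
    obtain ⟨s', hs'⟩ := h (witness i m)
    obtain ⟨t, ht⟩ := (hi s').2 m (by omega)
    exact hs' t ht
  have hsq : ∀ v, 0 < v → DivBy (codingGroup c n) v → IsSquare (v : ZMod (primeSeq s)) ∧
      ¬ primeSeq s ∣ v := by
    intro v hv hd
    constructor
    · have hpv : ∀ p, p.Prime → p ∣ v → IsSquare (p : ZMod (primeSeq s)) := by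
        intro p hp hpv
        obtain ⟨i, rfl, hi⟩ :=
          exists_permits_of_inv_mem hp (AddSubgroup.inv_mem_multipliers_of_divBy hv hd hpv)
        exact (hunit i hi).2
      clear hd hv
      induction v using Nat.recOnMul with
      | zero => exact ⟨0, by simp⟩
      | one => exact ⟨1, by simp⟩
      | prime p hp => exact hpv p hp dvd_rfl
      | mul a b iha ihb =>
        rw [Nat.cast_mul]
        exact (iha fun p hp hpa => hpv p hp (hpa.mul_right b)).mul
          (ihb fun p hp hpb => hpv p hp (hpb.mul_left a))
    · intro hdv
      obtain ⟨i, h1, hi⟩ := exists_permits_of_inv_mem (primeSeq_prime s)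
        (AddSubgroup.inv_mem_multipliers_of_divBy hv hd hdv)
      exact (hunit i hi).1 (primeSeq_strictMono.injective h1).symm
  -- A nonsquare class cannot be `±v / w`, since -1 and all numbers acting invertibly are squares
  -- modulo this prime.
  obtain ⟨a, ha⟩ := FiniteField.exists_nonsquare (F := ZMod (primeSeq s))
    (by rw [ZMod.ringChar_zmod_n]; exact primeSeq_ne_two s)
  have haval : (a.val : ZMod (primeSeq s)) = a := ZMod.natCast_zmod_val a
  have hcop : a.val.Coprime (primeSeq s) := by
    rw [Nat.coprime_comm, (primeSeq_prime s).coprime_iff_not_dvd, ← ZMod.natCast_eq_zero_iff, haval]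
    rintro rfl
    exact ha ⟨0, by simp⟩
  rcases hL (primeSeq s) a.val (primeSeq_prime s).pos hcop with
    ⟨p, hp1, hps, hd⟩ | ⟨v, w, hv, hw, hvd, hwd, hvw⟩
  · have hp : p = primeSeq s := ((Nat.dvd_prime (primeSeq_prime s)).1 hps).resolve_left hp1.ne'
    rw [hp] at hd
    exact (hsq _ (primeSeq_prime s).pos hd).2 dvd_rfl
  · have hw0 : (w : ZMod (primeSeq s)) ≠ 0 := by
      rw [Ne, ZMod.natCast_eq_zero_iff]
      exact (hsq w hw hwd).2
    refine ha ?_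
    rcases hvw with h1 | h1
    · have h2 := (ZMod.natCast_eq_natCast_iff _ _ _).2 h1
      rw [Nat.cast_mul, haval, ← div_eq_iff hw0] at h2
      rw [← h2]
      exact (hsq v hv hvd).1.div (hsq w hw hwd).1
    · rw [← ZMod.natCast_eq_zero_iff, Nat.cast_add, Nat.cast_mul, haval] at h1
      have h2 : a = -1 * v / w := by
        rw [eq_div_iff hw0]; linear_combination h1
      rw [h2]
      exact ((isSquare_neg_one_primeSeq hs).mul (hsq v hv hvd).1).div (hsq w hw hwd).1

theorem isCancellable_codingGroup_iff : IsCancellable.{u} (codingGroup c n) ↔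
    ∀ m, ∃ k, ∀ s, ∃ t, c (Nat.pair (Nat.pair (Nat.pair (Nat.pair n m) k) s) t) = 0 := by
  rw [isCancellable_iff (AddSubgroup.isTorsionFreeRankOne_of_one_mem _ one_mem_codingGroup)]
  constructor
  · intro h
    by_contra hc
    push Not at hc
    obtain ⟨m, hm⟩ := hc
    exact h.elim not_isAddCyclic_codingGroup (not_liftsUnits_codingGroup hm)
  · exact fun h => .inr (liftsUnits_codingGroup h)

end

/-- The normal form of a `Π⁰₄` set. -/
theorem IsPi.exists_normal_form {X : ℕ → ℕ} {S : Set ℕ} (h : IsPi X 4 S) :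
    ∃ c : ℕ → ℕ, TotalIn X c ∧ ∀ n, n ∈ S ↔
      ∀ m, ∃ k, ∀ s, ∃ t, c (Nat.pair (Nat.pair (Nat.pair (Nat.pair n m) k) s) t) = 0 := by
  obtain ⟨R₁, ⟨R₂, ⟨R₃, ⟨R₄, h4, e4⟩, e3⟩, e2⟩, e1⟩ := h
  obtain ⟨c, hc, h0⟩ := isSigma_zero_iff.1 h4
  refine ⟨c, hc, fun n => ?_⟩
  have e0 : ∀ p, p ∈ R₄ ↔ c p = 0 := fun p => by
    rw [← not_iff_not, ← Set.mem_compl_iff, h0]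
  have e1' : n ∈ S ↔ ∀ m, Nat.pair n m ∈ R₁ᶜ := by
    rw [← not_iff_not, ← Set.mem_compl_iff, e1]; simp
  have e2' : ∀ p, p ∈ R₁ᶜ ↔ ∃ k, ∀ s, Nat.pair (Nat.pair p k) s ∈ R₃ᶜ := fun p => by
    rw [e2]
    refine exists_congr fun k => ?_
    rw [← not_iff_not, ← Set.mem_compl_iff, e3]; simp
  simp only [e1', e2', e4, e0]

/-! ### Predicates decidable in an oracle -/

theorem TotalIn.prec {X f g : ℕ → ℕ} (hf : TotalIn X f) (hg : TotalIn X g) :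
    TotalIn X fun p => Nat.rec (motive := fun _ => ℕ) (f p.unpair.1)
      (fun y r => g (Nat.pair p.unpair.1 (Nat.pair y r))) p.unpair.2 := by
  refine (Nat.RecursiveIn.prec hf hg).of_eq fun p => ?_
  simp only [PFun.coe_val, Part.bind_eq_bind]
  induction p.unpair.2 with
  | zero => rfl
  | succ k ih => simp [ih]

section

variable {X b f g : ℕ → ℕ} {P Q : ℕ → Prop}

theorem TotalIn.map₂ {h : ℕ → ℕ → ℕ} (hh : Primrec₂ h) (hf : TotalIn X f) (hg : TotalIn X g) :
    TotalIn X fun n => h (f n) (g n) := by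
  simpa using (of_primrec (hh.comp Primrec.unpair_fst Primrec.unpair_snd)).comp (hf.pair hg)

theorem TotalIn.sum_range (hb : TotalIn X b) (hg : TotalIn X g) :
    TotalIn X fun n => ∑ i ∈ Finset.range (b n), g (Nat.pair i n) := by
  have p1 := TotalIn.of_primrec (X := X) Primrec.unpair_fst
  have p2 := TotalIn.of_primrec (X := X) Primrec.unpair_snd
  have h := (TotalIn.prec (TotalIn.of_primrec (X := X) (Primrec.const 0))
    (TotalIn.map₂ Primrec.nat_add (p2.comp p2) (hg.comp ((p1.comp p2).pair p1)))).comp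
    ((TotalIn.of_primrec Primrec.id).pair hb)
  refine h.of_eq fun n => ?_
  simp only [PFun.coe_val, Nat.unpair_pair, id]
  congr 1
  induction b n with
  | zero => rfl
  | succ k ih => rw [Finset.sum_range_succ, ← ih]

theorem TotalIn.prod_range (hb : TotalIn X b) (hg : TotalIn X g) :
    TotalIn X fun n => ∏ i ∈ Finset.range (b n), g (Nat.pair i n) := by
  have p1 := TotalIn.of_primrec (X := X) Primrec.unpair_fst
  have p2 := TotalIn.of_primrec (X := X) Primrec.unpair_snd
  have h := (TotalIn.prec (TotalIn.of_primrec (X := X) (Primrec.const 1))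
    (TotalIn.map₂ Primrec.nat_mul (p2.comp p2) (hg.comp ((p1.comp p2).pair p1)))).comp
    ((TotalIn.of_primrec Primrec.id).pair hb)
  refine h.of_eq fun n => ?_
  simp only [PFun.coe_val, Nat.unpair_pair, id]
  congr 1
  induction b n with
  | zero => rfl
  | succ k ih => rw [Finset.prod_range_succ, ← ih]

/-- The predicate `P` is decidable in the oracle `X`. -/
def DecidableIn (X : ℕ → ℕ) (P : ℕ → Prop) : Prop := ∃ f, TotalIn X f ∧ ∀ n, P n ↔ f n = 0

namespace DecidableIn

theorem of_primrecPred (h : PrimrecPred P) : DecidableIn X P := by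
  classical
  exact ⟨fun n => if P n then 0 else 1,
    .of_primrec (Primrec.ite h (Primrec.const 0) (Primrec.const 1)), fun n => by simp⟩

theorem of_eq (h : DecidableIn X P) (hPQ : ∀ n, P n ↔ Q n) : DecidableIn X Q :=
  let ⟨f, hf, e⟩ := h
  ⟨f, hf, fun n => (hPQ n).symm.trans (e n)⟩

theorem comp (h : DecidableIn X P) (hg : TotalIn X g) : DecidableIn X fun n => P (g n) :=
  let ⟨_, hf, e⟩ := h
  ⟨_, hf.comp hg, fun n => e (g n)⟩

theorem eq (hf : TotalIn X f) (hg : TotalIn X g) : DecidableIn X fun n => f n = g n := by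
  have h : PrimrecPred fun p : ℕ => p.unpair.1 = p.unpair.2 :=
    Primrec.eq.comp Primrec.unpair_fst Primrec.unpair_snd
  exact ((of_primrecPred h).comp (hf.pair hg)).of_eq fun n => by simp

theorem not (h : DecidableIn X P) : DecidableIn X fun n => ¬ P n := by
  obtain ⟨f, hf, e⟩ := h
  exact ⟨_, TotalIn.map₂ Primrec.nat_sub (.of_primrec (Primrec.const 1)) hf, fun n => by
    simp only [e]; omega⟩

theorem and (h : DecidableIn X P) (h' : DecidableIn X Q) : DecidableIn X fun n => P n ∧ Q n := by
  obtain ⟨f, hf, e⟩ := h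
  obtain ⟨f', hf', e'⟩ := h'
  exact ⟨_, TotalIn.map₂ Primrec.nat_add hf hf', fun n => by
    simp only [e, e']; omega⟩

/-- A sum of natural numbers vanishes exactly if all of its terms do. -/
theorem forall_lt {R : ℕ → ℕ → Prop} (hb : TotalIn X b)
    (h : DecidableIn X fun p => R p.unpair.1 p.unpair.2) :
    DecidableIn X fun n => ∀ i < b n, R i n := by
  obtain ⟨f, hf, e⟩ := h
  refine ⟨_, hb.sum_range hf, fun n => ?_⟩
  simp only [Finset.sum_eq_zero_iff, Finset.mem_range, ← e, Nat.unpair_pair]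

theorem exists_lt {R : ℕ → ℕ → Prop} (hb : TotalIn X b)
    (h : DecidableIn X fun p => R p.unpair.1 p.unpair.2) :
    DecidableIn X fun n => ∃ i < b n, R i n :=
  (forall_lt (R := fun i n => ¬ R i n) hb h.not).not.of_eq fun n => by push Not; rfl

open Classical in
theorem ite (h : DecidableIn X P) (hf : TotalIn X f) (hg : TotalIn X g) :
    TotalIn X fun n => if P n then f n else g n := by
  obtain ⟨t, ht, e⟩ := h
  have hp : Primrec fun p : ℕ => if p.unpair.1 = 0 then p.unpair.2.unpair.1
      else p.unpair.2.unpair.2 :=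
    Primrec.ite (Primrec.eq.comp Primrec.unpair_fst (Primrec.const 0))
      (Primrec.unpair_fst.comp Primrec.unpair_snd) (Primrec.unpair_snd.comp Primrec.unpair_snd)
  simpa [e] using (TotalIn.of_primrec hp).comp (ht.pair (hf.pair hg))

open Classical in
theorem find {R : ℕ → ℕ → Prop} (h : DecidableIn X fun p => R p.unpair.1 p.unpair.2)
    (hex : ∀ n, ∃ k, R n k) : TotalIn X fun n => Nat.find (hex n) := by
  obtain ⟨f, hf, e⟩ := h
  refine (Nat.RecursiveIn.rfind hf).of_eq fun n => ?_
  refine Part.eq_some_iff.2 ((mem_rfind_map (fun k => Part.some (f (Nat.pair n k))) _).2 ⟨?_, ?_⟩)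
  · have := (e (Nat.pair n (Nat.find (hex n)))).1 (by simpa using Nat.find_spec (hex n))
    rw [this]
    exact Part.mem_some _
  · intro j hj
    refine ⟨_, Part.mem_some _, ?_⟩
    rw [Ne, ← e]
    simpa using Nat.find_min (hex n) hj

end DecidableIn

end

/-! ### Computable presentations of groups of rational numbers -/

theorem IsTorsionFreeRankOne.congr {A B : Type*} [AddCommGroup A] [AddCommGroup B] (e : A ≃+ B)
    (h : IsTorsionFreeRankOne A) : IsTorsionFreeRankOne B := by
  rw [isTorsionFreeRankOne_iff] at h ⊢
  obtain ⟨h1, g, hg, h2⟩ := h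
  refine ⟨e.symm.injective.isAddTorsionFree e.symm.toAddMonoidHom, e g,
    by simpa using hg, fun b => ?_⟩
  obtain ⟨n, m, hn, hnm⟩ := h2 (e.symm b)
  refine ⟨n, m, hn, e.symm.injective ?_⟩
  simpa using hnm

/-- Each element is represented by its least code, and a sum is found by searching for the least
code of its value. The second clause is needed because index sets ask for some group structure: the
program for addition determines that structure. -/
theorem exists_computable_presentation {X : ℕ → ℕ} {A : ℕ → AddSubgroup ℚ} {v : ℕ → ℕ → ℚ}
    (hv : ∀ n x, x ∈ A n ↔ ∃ j, v n j = x)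
    (heq : DecidableIn X fun p => v p.unpair.2.unpair.1 p.unpair.1 =
      v p.unpair.2.unpair.1 p.unpair.2.unpair.2)
    (hadd : DecidableIn X fun p => v p.unpair.1.unpair.1 p.unpair.2 =
      v p.unpair.1.unpair.1 p.unpair.1.unpair.2.unpair.1 +
        v p.unpair.1.unpair.1 p.unpair.1.unpair.2.unpair.2) :
    ∃ f : ℕ → ℕ, Computable f ∧ ∀ n,
      (∃ inst, IsComputableGroup X (f n) inst) ∧
      ∀ inst : AddCommGroup (structDomain X (f n)), IsComputableGroup X (f n) inst →
        Nonempty (structDomain X (f n) ≃+ A n) := by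
  classical
  have hex : ∀ p : ℕ, ∃ k, v p.unpair.1 k =
      v p.unpair.1 p.unpair.2.unpair.1 + v p.unpair.1 p.unpair.2.unpair.2 := fun p =>
    (hv _ _).1 (add_mem ((hv _ _).2 ⟨_, rfl⟩) ((hv _ _).2 ⟨_, rfl⟩))
  have hdom : DecidableIn X fun q => ∀ j < q.unpair.2, v q.unpair.1 j ≠ v q.unpair.1 q.unpair.2 :=
    DecidableIn.forall_lt (.of_primrec Primrec.unpair_snd) heq.not
  have hχ := hdom.ite (.of_primrec (Primrec.const 1)) (.of_primrec (Primrec.const 0))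
  obtain ⟨s₁, hs₁, e₁⟩ := exists_phi_param hχ
  obtain ⟨s₂, hs₂, e₂⟩ := exists_phi_param (hadd.find hex)
  refine ⟨fun n => Nat.pair (s₁ n) (s₂ n), Primrec₂.natPair.to_comp.comp hs₁ hs₂, fun n => ?_⟩
  have hmem : ∀ j, j ∈ structDomain X (Nat.pair (s₁ n) (s₂ n)) ↔ ∀ i < j, v n i ≠ v n j := by
    intro j
    simp only [structDomain, Set.mem_ofPred_eq, Nat.unpair_pair, e₁, PFun.coe_val,
      Part.mem_some_iff]
    split_ifs with h <;> simpa using h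
  have htot : ∀ j, 0 ∈ phi X (Nat.pair (s₁ n) (s₂ n)).unpair.1 j ∨
      1 ∈ phi X (Nat.pair (s₁ n) (s₂ n)).unpair.1 j := by
    intro j
    simp only [Nat.unpair_pair, e₁, PFun.coe_val, Part.mem_some_iff]
    split_ifs <;> simp
  have hphi : ∀ a b k : ℕ, k ∈ phi X (Nat.pair (s₁ n) (s₂ n)).unpair.2 (Nat.pair a b) ↔
      v n k = v n a + v n b ∧ ∀ i < k, v n i ≠ v n a + v n b := by
    intro a b k
    simp only [Nat.unpair_pair, e₂, PFun.coe_val, Part.mem_some_iff]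
    rw [eq_comm, Nat.find_eq_iff]
  set D := structDomain X (Nat.pair (s₁ n) (s₂ n)) with hD
  let w : D → A n := fun j => ⟨v n j, (hv _ _).2 ⟨_, rfl⟩⟩
  have hw : Function.Bijective w := by
    constructor
    · rintro ⟨i, hi⟩ ⟨j, hj⟩ hij
      have h : v n i = v n j := congrArg Subtype.val hij
      rcases lt_trichotomy i j with hlt | rfl | hlt
      · exact absurd h ((hmem j).1 hj i hlt)
      · rfl
      · exact absurd h.symm ((hmem i).1 hi j hlt)
    · rintro ⟨x, hx⟩
      have hx' := (hv n x).1 hx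
      refine ⟨⟨Nat.find hx', (hmem _).2 fun i hi h => ?_⟩, Subtype.ext (Nat.find_spec hx')⟩
      exact Nat.find_min hx' hi (h.trans (Nat.find_spec hx'))
  let E : D ≃ A n := Equiv.ofBijective w hw
  constructor
  · refine ⟨E.addCommGroup, htot, fun a b => (hphi _ _ _).2 ?_⟩
    let := E.addCommGroup
    have h : E (a + b) = E a + E b := by
      rw [Equiv.add_def, Equiv.apply_symm_apply]
    have h' : v n (a + b : D) = v n a + v n b := congrArg Subtype.val h
    refine ⟨h', fun i hi => ?_⟩
    rw [← h']
    exact (hmem _).1 (a + b : D).2 i hi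
  · intro inst h
    exact ⟨{ E with map_add' := fun a b => Subtype.ext ((hphi _ _ _).1 (h.2 a b)).1 }⟩

/-! ### A computable presentation of the coding groups -/

/-- The exponents coded by `j`. -/
def exponents (j : ℕ) : List ℕ := Denumerable.ofNat (List ℕ) j.unpair.2.unpair.2.unpair.2

/-- The code `j` denotes a fraction whose denominator is permitted within its time bound. -/
def IsValidCode (c : ℕ → ℕ) (n j : ℕ) : Prop :=
  ∀ i < (exponents j).length, ∀ s < (exponents j).getD i 0, ActiveRequest i ∧
    ∀ m < i.unpair.1 - 1, ∃ t < j.unpair.2.unpair.2.unpair.1,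
      c (Nat.pair (Nat.pair (Nat.pair (Nat.pair n m) (witness i m)) s) t) = 0

section

open Classical in
/-- The positive part of the numerator of the fraction with code `p.unpair.2`. -/
noncomputable def codeLeft (c : ℕ → ℕ) (p : ℕ) : ℕ :=
  if IsValidCode c p.unpair.1 p.unpair.2 then p.unpair.2.unpair.1 else 0

open Classical in
/-- The negative part of the numerator of the fraction with code `p.unpair.2`. -/
noncomputable def codeRight (c : ℕ → ℕ) (p : ℕ) : ℕ :=
  if IsValidCode c p.unpair.1 p.unpair.2 then p.unpair.2.unpair.2.unpair.1 else 0

open Classical in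
/-- The denominator of the fraction with code `p.unpair.2`. -/
noncomputable def codeDen (c : ℕ → ℕ) (p : ℕ) : ℕ :=
  if IsValidCode c p.unpair.1 p.unpair.2 then
    primePowProd (exponents p.unpair.2).length fun i => (exponents p.unpair.2).getD i 0
  else 1

/-- The element of the `n`-th coding group with code `j`. -/
noncomputable def codeValue (c : ℕ → ℕ) (n j : ℕ) : ℚ :=
  ((codeLeft c (Nat.pair n j) : ℚ) - codeRight c (Nat.pair n j)) / codeDen c (Nat.pair n j)

end

theorem codeValue_of_isValidCode {c : ℕ → ℕ} {n j : ℕ} (h : IsValidCode c n j) :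
    codeValue c n j = ((j.unpair.1 : ℚ) - j.unpair.2.unpair.1) /
      primePowProd (exponents j).length fun i => (exponents j).getD i 0 := by
  unfold codeValue codeLeft codeRight codeDen
  rw [Nat.unpair_pair, if_pos h, if_pos h, if_pos h]

theorem codeValue_of_not_isValidCode {c : ℕ → ℕ} {n j : ℕ} (h : ¬ IsValidCode c n j) :
    codeValue c n j = 0 := by
  unfold codeValue codeLeft codeRight
  rw [Nat.unpair_pair, if_neg h, if_neg h]
  simp

theorem codeDen_pos (c : ℕ → ℕ) (p : ℕ) : 0 < codeDen c p := by
  unfold codeDen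
  split_ifs
  · exact primePowProd_pos _ _
  · exact one_pos

theorem primrec_exponents : Primrec exponents :=
  (Primrec.ofNat _).comp (Primrec.unpair_snd.comp (Primrec.unpair_snd.comp Primrec.unpair_snd))

theorem primrec_exponent : Primrec fun p : ℕ => (exponents p.unpair.2).getD p.unpair.1 0 :=
  (Primrec.list_getD 0).comp (primrec_exponents.comp Primrec.unpair_snd) Primrec.unpair_fst

theorem primrec_witness : Primrec fun p : ℕ => witness p.unpair.1 p.unpair.2 :=
  (Primrec.list_getD 0).comp ((Primrec.ofNat _).comp (Primrec.unpair_snd.comp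
    (Primrec.unpair_snd.comp Primrec.unpair_fst))) Primrec.unpair_snd

section

variable {X c : ℕ → ℕ}

/-- Permission is only enumerable, but the time bound stored in the code bounds the search for `t`,
so all quantifiers are bounded. -/
theorem decidableIn_isValidCode (hc : TotalIn X c) :
    DecidableIn X fun p => IsValidCode c p.unpair.1 p.unpair.2 := by
  have h1 := Primrec.unpair_fst
  have h2 := Primrec.unpair_snd
  have hpair {f g : ℕ → ℕ} (hf : Primrec f) (hg : Primrec g) : Primrec fun n =>
    Nat.pair (f n) (g n) := Primrec₂.natPair.comp hf hg
  unfold IsValidCode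
  refine DecidableIn.forall_lt (.of_primrec
    (Primrec.list_length.comp (primrec_exponents.comp h2))) ?_
  refine DecidableIn.forall_lt (R := fun s p => ActiveRequest p.unpair.1 ∧
    ∀ m < p.unpair.1.unpair.1 - 1, ∃ t < p.unpair.2.unpair.2.unpair.2.unpair.2.unpair.1,
      c (Nat.pair (Nat.pair (Nat.pair (Nat.pair p.unpair.2.unpair.1 m) (witness p.unpair.1 m)) s)
        t) = 0)
    (.of_primrec (primrec_exponent.comp (hpair h1 (h2.comp h2)) |>.of_eq fun p => by simp)) ?_
  refine ((DecidableIn.of_primrecPred primrecPred_activeRequest).comp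
    (.of_primrec (h1.comp h2))).and ?_
  refine DecidableIn.forall_lt (R := fun m q =>
    ∃ t < q.unpair.2.unpair.2.unpair.2.unpair.2.unpair.2.unpair.1,
      c (Nat.pair (Nat.pair (Nat.pair (Nat.pair q.unpair.2.unpair.2.unpair.1 m)
        (witness q.unpair.2.unpair.1 m)) q.unpair.1) t) = 0)
    (.of_primrec (Primrec.nat_sub.comp (h1.comp (h1.comp h2)) (Primrec.const 1))) ?_
  refine DecidableIn.exists_lt (R := fun t q =>
      c (Nat.pair (Nat.pair (Nat.pair (Nat.pair q.unpair.2.unpair.2.unpair.2.unpair.1 q.unpair.1)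
        (witness q.unpair.2.unpair.2.unpair.1 q.unpair.1)) q.unpair.2.unpair.1) t) = 0)
    (.of_primrec (h1.comp (h2.comp (h2.comp (h2.comp (h2.comp (h2.comp h2))))))) ?_
  refine DecidableIn.eq (hc.comp (.of_primrec (hpair (hpair (hpair (hpair
    (h1.comp (h2.comp (h2.comp (h2.comp h2)))) (h1.comp h2)) ?_) (h1.comp (h2.comp h2))) h1)))
    (.of_primrec (Primrec.const 0))
  exact (primrec_witness.comp (hpair (h1.comp (h2.comp (h2.comp h2))) (h1.comp h2))).of_eq
    fun p => by simp

theorem totalIn_codeLeft (hc : TotalIn X c) : TotalIn X (codeLeft c) :=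
  (decidableIn_isValidCode hc).ite
    (.of_primrec (Primrec.unpair_fst.comp Primrec.unpair_snd)) (.of_primrec (Primrec.const 0))

theorem totalIn_codeRight (hc : TotalIn X c) : TotalIn X (codeRight c) :=
  (decidableIn_isValidCode hc).ite
    (.of_primrec (Primrec.unpair_fst.comp (Primrec.unpair_snd.comp Primrec.unpair_snd)))
    (.of_primrec (Primrec.const 0))

theorem totalIn_codeDen (hc : TotalIn X c) : TotalIn X (codeDen c) := by
  refine (decidableIn_isValidCode hc).ite ?_ (.of_primrec (Primrec.const 1))
  have hpow : TotalIn X fun q : ℕ =>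
      primeSeq q.unpair.1 ^ (exponents q.unpair.2.unpair.2).getD q.unpair.1 0 := by
    have h : Primrec₂ fun a b : ℕ => a ^ b := by
      exact Primrec₂.unpaired'.1 Nat.Primrec.pow
    refine TotalIn.map₂ h ((TotalIn.of_computable computable_primeSeq).comp
      (.of_primrec Primrec.unpair_fst)) (.of_primrec ?_)
    exact (primrec_exponent.comp (Primrec₂.natPair.comp Primrec.unpair_fst
      (Primrec.unpair_snd.comp Primrec.unpair_snd))).of_eq fun p => by simp
  have := TotalIn.prod_range (.of_primrec
    (Primrec.list_length.comp (primrec_exponents.comp Primrec.unpair_snd))) hpow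
  simpa [primePowProd] using this

/-- Cross-multiplying and moving the negative parts across reduces the equation to one between
natural numbers. -/
theorem decidableIn_codeValue_eq (hc : TotalIn X c) {f g h : ℕ → ℕ} (hf : TotalIn X f)
    (hg : TotalIn X g) (hh : TotalIn X h) :
    DecidableIn X fun p => codeValue c (f p) (g p) = codeValue c (f p) (h p) := by
  have L := totalIn_codeLeft hc
  have R := totalIn_codeRight hc
  have D := totalIn_codeDen hc
  have a := hf.pair hg
  have b := hf.pair hh
  have add {f g : ℕ → ℕ} (hf : TotalIn X f) (hg : TotalIn X g) : TotalIn X fun n => f n + g n :=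
    TotalIn.map₂ Primrec.nat_add hf hg
  have mul {f g : ℕ → ℕ} (hf : TotalIn X f) (hg : TotalIn X g) : TotalIn X fun n => f n * g n :=
    TotalIn.map₂ Primrec.nat_mul hf hg
  refine (DecidableIn.eq
    (add (mul (L.comp a) (D.comp b)) (mul (R.comp b) (D.comp a)))
    (add (mul (L.comp b) (D.comp a)) (mul (R.comp a) (D.comp b)))).of_eq fun p => ?_
  have da : (codeDen c (Nat.pair (f p) (g p)) : ℚ) ≠ 0 := by exact_mod_cast (codeDen_pos _ _).ne'
  have db : (codeDen c (Nat.pair (f p) (h p)) : ℚ) ≠ 0 := by exact_mod_cast (codeDen_pos _ _).ne'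
  rw [codeValue, codeValue, div_eq_div_iff da db, ← @Nat.cast_inj ℚ]
  push_cast
  constructor <;> intro h <;> linear_combination h

theorem decidableIn_codeValue_add (hc : TotalIn X c) {f g h k : ℕ → ℕ} (hf : TotalIn X f)
    (hg : TotalIn X g) (hh : TotalIn X h) (hk : TotalIn X k) :
    DecidableIn X fun p =>
      codeValue c (f p) (k p) = codeValue c (f p) (g p) + codeValue c (f p) (h p) := by
  have L := totalIn_codeLeft hc
  have R := totalIn_codeRight hc
  have D := totalIn_codeDen hc
  have a := hf.pair hg
  have b := hf.pair hh
  have s := hf.pair hk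
  have add {f g : ℕ → ℕ} (hf : TotalIn X f) (hg : TotalIn X g) : TotalIn X fun n => f n + g n :=
    TotalIn.map₂ Primrec.nat_add hf hg
  have mul {f g : ℕ → ℕ} (hf : TotalIn X f) (hg : TotalIn X g) : TotalIn X fun n => f n * g n :=
    TotalIn.map₂ Primrec.nat_mul hf hg
  refine (DecidableIn.eq
    (add (mul (L.comp s) (mul (D.comp a) (D.comp b)))
      (mul (add (mul (R.comp a) (D.comp b)) (mul (R.comp b) (D.comp a))) (D.comp s)))
    (add (mul (R.comp s) (mul (D.comp a) (D.comp b)))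
      (mul (add (mul (L.comp a) (D.comp b)) (mul (L.comp b) (D.comp a))) (D.comp s)))).of_eq
    fun p => ?_
  have da : (codeDen c (Nat.pair (f p) (g p)) : ℚ) ≠ 0 := by exact_mod_cast (codeDen_pos _ _).ne'
  have db : (codeDen c (Nat.pair (f p) (h p)) : ℚ) ≠ 0 := by exact_mod_cast (codeDen_pos _ _).ne'
  have ds : (codeDen c (Nat.pair (f p) (k p)) : ℚ) ≠ 0 := by exact_mod_cast (codeDen_pos _ _).ne'
  rw [codeValue, codeValue, codeValue, div_add_div _ _ da db, div_eq_div_iff ds (mul_ne_zero da db),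
    ← @Nat.cast_inj ℚ]
  push_cast
  constructor <;> intro h <;> linear_combination h

/-- A denominator uses finitely many conditions, so one time bound serves for all of them.
Conversely, invalid codes denote 0, which lies in every group. -/
theorem mem_codingGroup_iff {n : ℕ} {x : ℚ} :
    x ∈ codingGroup c n ↔ ∃ j, codeValue c n j = x := by
  constructor
  · rintro ⟨N, e, he, a, ha⟩
    have hT : ∀ i s m, ∃ t, Permits c n i s → m < i.unpair.1 - 1 →
        c (Nat.pair (Nat.pair (Nat.pair (Nat.pair n m) (witness i m)) s) t) = 0 := by
      intro i s m
      by_cases h : Permits c n i s ∧ m < i.unpair.1 - 1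
      · obtain ⟨t, ht⟩ := h.1.2 m h.2
        exact ⟨t, fun _ _ => ht⟩
      · exact ⟨0, fun h1 h2 => absurd ⟨h1, h2⟩ h⟩
    choose T hT using hT
    -- The sum of all search times bounds each of them.
    let B := ∑ i ∈ Finset.range N, ∑ s ∈ Finset.range (e i),
      ∑ m ∈ Finset.range (i.unpair.1 - 1), T i s m
    have hB : ∀ i < N, ∀ s < e i, ∀ m < i.unpair.1 - 1, T i s m ≤ B := by
      intro i hi s hs m hm
      refine le_trans ?_ (Finset.single_le_sum (f := fun i => ∑ s ∈ Finset.range (e i),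
        ∑ m ∈ Finset.range (i.unpair.1 - 1), T i s m) (fun _ _ => Nat.zero_le _)
        (Finset.mem_range.2 hi))
      refine le_trans ?_ (Finset.single_le_sum (f := fun s =>
        ∑ m ∈ Finset.range (i.unpair.1 - 1), T i s m) (fun _ _ => Nat.zero_le _)
        (Finset.mem_range.2 hs))
      exact Finset.single_le_sum (f := fun m => T i s m) (fun _ _ => Nat.zero_le _)
        (Finset.mem_range.2 hm)
    let l := (List.range N).map e
    have hl : ∀ i < N, l.getD i 0 = e i := fun i hi => by simp [l, hi]
    let j := Nat.pair a.toNat (Nat.pair (-a).toNat (Nat.pair (B + 1) (Encodable.encode l)))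
    have hj : exponents j = l := by simp [exponents, j]
    have hlen : l.length = N := by simp [l]
    have hvalid : IsValidCode c n j := by
      intro i hi s hs
      rw [hj] at hi hs
      rw [hlen] at hi
      rw [hl i hi] at hs
      have hp := he i s hs
      refine ⟨hp.1, fun m hm => ⟨T i s m, ?_, hT i s m hp hm⟩⟩
      simp only [j, Nat.unpair_pair]
      exact Nat.lt_succ_of_le (hB i hi s hs m hm)
    refine ⟨j, ?_⟩
    have hden : primePowProd (exponents j).length (fun i => (exponents j).getD i 0) =
        primePowProd N e := by
      rw [hj, hlen]
      refine Finset.prod_congr rfl fun i hi => ?_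
      simp only [hl i (Finset.mem_range.1 hi)]
    have hnum : (a.toNat : ℚ) - ((-a).toNat : ℚ) = a := by
      exact_mod_cast Int.toNat_sub_toNat_neg a
    have hd : (primePowProd N e : ℚ) ≠ 0 := by exact_mod_cast (primePowProd_pos _ _).ne'
    rw [codeValue_of_isValidCode hvalid, hden, div_eq_iff hd, mul_comm, ha]
    simpa only [j, Nat.unpair_pair] using hnum
  · rintro ⟨j, rfl⟩
    by_cases hv : IsValidCode c n j
    · refine ⟨(exponents j).length, fun i => (exponents j).getD i 0, fun i s hs => ?_,
        (j.unpair.1 : ℤ) - j.unpair.2.unpair.1, ?_⟩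
      · have hi : i < (exponents j).length := by
          by_contra hi
          simp only [List.getD_eq_default _ _ (not_lt.1 hi)] at hs
          omega
        obtain ⟨h1, h2⟩ := hv i hi s hs
        exact ⟨h1, fun m hm => (h2 m hm).imp fun t ht => ht.2⟩
      · rw [codeValue_of_isValidCode hv,
          mul_div_cancel₀ _ (by exact_mod_cast (primePowProd_pos _ _).ne')]
        push_cast
        rfl
    · rw [codeValue_of_not_isValidCode hv]
      exact zero_mem _

end

/-! ### Completeness of the index set. -/

theorem mainTheorem1 (X : ℕ → ℕ) :
    IsPi X 4 (cancellableIndexSet.{u} X) ∧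
      ∀ S : Set ℕ, IsPi X 4 S →
        ∃ f : ℕ → ℕ, Computable f ∧
          ∀ n, f n ∈ rankOneIndexSet X ∧ (n ∈ S ↔ f n ∈ cancellableIndexSet.{u} X) := by
  refine ⟨isPi_cancellableIndexSet X, fun S hS => ?_⟩
  obtain ⟨c, hc, hS⟩ := hS.exists_normal_form
  have h1 : Primrec fun n : ℕ => n.unpair.1 := Primrec.unpair_fst
  have h2 : Primrec fun n : ℕ => n.unpair.2 := Primrec.unpair_snd
  obtain ⟨f, hf, h⟩ := exists_computable_presentation (A := codingGroup c) (v := codeValue c)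
    (fun _ _ => mem_codingGroup_iff)
    (decidableIn_codeValue_eq hc (.of_primrec (h1.comp h2)) (.of_primrec h1)
      (.of_primrec (h2.comp h2)))
    (decidableIn_codeValue_add hc (.of_primrec (h1.comp h1)) (.of_primrec (h1.comp (h2.comp h1)))
      (.of_primrec (h2.comp (h2.comp h1))) (.of_primrec h2))
  have hrank (n : ℕ) : IsTorsionFreeRankOne (codingGroup c n) :=
    AddSubgroup.isTorsionFreeRankOne_of_one_mem _ one_mem_codingGroup
  refine ⟨f, hf, fun n => ?_⟩
  obtain ⟨⟨inst, hinst⟩, hequiv⟩ := h n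
  obtain ⟨e⟩ := hequiv inst hinst
  have hr := (hrank n).congr e.symm
  refine ⟨⟨inst, hinst, hr⟩, ?_⟩
  rw [hS, ← isCancellable_codingGroup_iff.{u}]
  constructor
  · exact fun h => ⟨inst, hinst, hr, h.congr e.symm⟩
  -- The structure supplied by the index set need not be `inst`, but it is isomorphic to the same
  -- coding group.
  · rintro ⟨inst', hinst', -, h⟩
    obtain ⟨e'⟩ := hequiv inst' hinst'
    exact h.congr e'
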